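/- Let $\mathcal A$ be a finite set of linear hyperplanes in $\mathbb R^d$ with $\bigcap_{H\in\mathcal A}H=\{0\}$. Let $L$ be the set of all intersections of subsets of $\mathcal A$, and $L_i$ the set of $X\in L$ of codimension $i$. The chambers are the connected components of $\mathbb R^d\setminus\bigcup\mathcal A$. For chambers $c,c'$ let $L_1(c,c')$ be the set of hyperplanes of $\mathcal A$ separating $c$ from $c'$, and let $$L_2(c,c')=\{X\in L_2:\ H\in L_1(c,c')\text{ for all }H\in\mathcal A\text{ with }H\supseteq X\}.$$ Let $G_1$ be the graph on the chambers in which $c,c'$ are adjacent iff $|L_1(c,c')|=1$; a minimal gallery from $c$ to $c'$ is a shortest path in $G_1$. For minimal galleries $r,r'$ from $c$ to $c'$ let $L_2(r,r')$ be the set of $X\in L_2(c,c')$ such that $r$ and $r'$ cross the hyperplanes containing $X$ in different orders. Let $G_2(c,c')$ be the graph on the minimal galleries from $c$ to $c'$ in which $r,r'$ are adjacent iff $|L_2(r,r')|=1$. For $X\in L$ let $\mathcal A_X=\{H/X: H\in\mathcal A,\ H\supseteq X\}$, an arrangement in $\mathbb R^d/X$. A line $\ell\in L$ is a modular coatom if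 for all distinct $H,H'\in\mathcal A$ not containing $\ell$ there is $H''\in\mathcal A$ containing $\ell$ and $H\cap H'$. A modular flag is a chain $\{0\}=X_0\subset X_1\subset\dots\subset X_d=\mathbb R^d$ in $L$ with $\dim X_i=i$ such that each $X_{i+1}/X_{i}$ is a modular coatom of $\mathcal A_{X_{i}}$; the arrangement $\mathcal A$ is supersolvable if it has a modular flag. A chamber $c$ is incident to $X$ if $\overline c\cap X$ has the same dimension as $X$, and incident to a flag if it is incident to all its members. A minimal gallery from $c_0$ to $c$ is incident to the flag $F=\{X_i\}$ if, whenever $i<j$, it crosses every hyperplane of $L_1(c_0,c)$ containing $X_j$ before every hyperplane of $L_1(c_0,c)$ containing $X_i$ but not $X_j$. (1) Let $\mathcal A$ be supersolvable, $F$ a modular flag, $c_0$ a chamber incident to $F$, and $c$ any chamber. Then there is a unique minimal gallery $r_0$ from $c_0$ to $c$ incident to $F$, and in $G=G_2(c_0,c)$ any two galleries $r,r'$ satisfy $$|L_2(r,r')|\le d_G(r,r')\le |L_2(r_0,r)|+|L_2(r_0,r')|\le 2|L_2(c_0,c)|.$$ Thus $G$ has diameter at most $2|L_2(c_0,c)|$.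 (2) Let $\mathcal A$ be the reflection arrangement of type $A_{n-1}$ (the hyperplanes $x_i=x_j$, $i\ne j$, in $\{x\in\mathbb R^n:\sum x_i=0\}$), of type $B_n$ (the hyperplanes $x_i=\pm x_j$, $i\neq j$, and $x_i=0$ in $\mathbb R^n$) or of dihedral type $I_2(m)$, $m\ge2$ (the $m$ lines $x\cos\frac{k\pi}m+y\sin\frac{k\pi}m=0$, $0\le k<m$, in $\mathbb R^2$). Let $W$ be the group generated by the reflections in the hyperplanes of $\mathcal A$, let $c_0$ be any chamber, and let $S$ be the set of reflections in the walls of $c_0$. For $w\in W$ let $G(w)$ be the graph whose vertices are the reduced words of $w$ in the generators $S$ and whose edges are the applicable braid relations (replace a consecutive subword $sts\cdots$ by $tst\cdots$, both of length the order of $st$, for $s\ne t$ in $S$); a reduced word $(s_1,\dots,s_k)$ of $w$ is identified with the gallery $c_0,s_1c_0,s_1s_2c_0,\dots,wc_0$, which defines $L_2(r,r')$ for reduced words, and $L_2(w):=L_2(c_0,wc_0)$. Then $c_0$ is incident to some modular flag; for every modular flag $F$ to which $c_0$ is incident there is a unique reduced word $r_0$ of $w$ incident to $F$, and any two reduced words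 $r,r'$ of $w$ satisfy, with $G=G(w)$, $$|L_2(r,r')|\le d_G(r,r')\le |L_2(r_0,r)|+|L_2(r_0,r')|\le 2|L_2(w)|.$$ Thus $G(w)$ has diameter at most $2|L_2(w)|$. -/

import Mathlib

noncomputable section

namespace GalleryGraph

section Lattice

variable {V : Type*} [AddCommGroup V] [Module ℝ V]

/-- A finite, central, essential arrangement of linear hyperplanes. -/
structure IsArrangement (A : Set (Submodule ℝ V)) : Prop where
  finite : A.Finite
  hyperplane : ∀ H ∈ A, IsCoatom H
  essential : sInf A = ⊥

/-- The set `L` of all intersections of subsets of the arrangement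
(the empty intersection is the whole space). -/
def intersections (A : Set (Submodule ℝ V)) : Set (Submodule ℝ V) :=
  {X | ∃ S ⊆ A, X = sInf S}

/-- The set `L_i` of intersection subspaces of codimension `i`. -/
def rankSet (A : Set (Submodule ℝ V)) (i : ℕ) : Set (Submodule ℝ V) :=
  {X ∈ intersections A | Module.finrank ℝ X + i = Module.finrank ℝ V}

/-- The localized arrangement `A_X` in the quotient space `V / X`. -/
def localization (A : Set (Submodule ℝ V)) (X : Submodule ℝ V) : Set (Submodule ℝ (V ⧸ X)) :=
  {K | ∃ H ∈ A, X ≤ H ∧ K = H.map X.mkQ}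

/-- A modular coatom: an intersection subspace `ℓ` that is a line, such that for any two distinct
hyperplanes not containing `ℓ` some hyperplane contains both `ℓ` and their intersection. -/
structure IsModularCoatom (A : Set (Submodule ℝ V)) (ℓ : Submodule ℝ V) : Prop where
  mem : ℓ ∈ intersections A
  line : Module.finrank ℝ ℓ = 1
  modular : ∀ H ∈ A, ∀ H' ∈ A, H ≠ H' → ¬ ℓ ≤ H → ¬ ℓ ≤ H' →
    ∃ H'' ∈ A, ℓ ≤ H'' ∧ H ⊓ H' ≤ H''

/-- A modular flag `X_0 ⊂ X_1 ⊂ ⋯ ⊂ X_d`: a maximal flag of intersection subspaces such that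
`X_{i+1} / X_i` is a modular coatom of the localized arrangement `A_{X_i}` for all `i < d`
(the condition for `i = d - 1` is automatic). -/
structure IsModularFlag (A : Set (Submodule ℝ V))
    (F : Fin (Module.finrank ℝ V + 1) → Submodule ℝ V) : Prop where
  mem : ∀ i, F i ∈ intersections A
  dim : ∀ i, Module.finrank ℝ (F i) = i
  mono : Monotone F
  modular : ∀ i : Fin (Module.finrank ℝ V),
    IsModularCoatom (localization A (F i.castSucc)) ((F i.succ).map (F i.castSucc).mkQ)

/-- The hyperplanes of `A` separating `c` from `c'`, that is, having `c` and `c'` strictly on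
opposite sides. -/
def sep₁ (A : Set (Submodule ℝ V)) (c c' : Set V) : Set (Submodule ℝ V) :=
  {H ∈ A | ∃ f : V →ₗ[ℝ] ℝ, LinearMap.ker f = H ∧ (∀ x ∈ c, 0 < f x) ∧ ∀ y ∈ c', f y < 0}

/-- `L_2(c, c')`: the codimension-two intersection subspaces `X` all of whose hyperplanes
separate `c` from `c'`. -/
def sep₂ (A : Set (Submodule ℝ V)) (c c' : Set V) : Set (Submodule ℝ V) :=
  {X ∈ rankSet A 2 | ∀ H ∈ A, X ≤ H → H ∈ sep₁ A c c'}

/-- In the sequence of chambers `γ 0, γ 1, …` (eventually constant), the hyperplane `H` is crossed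
at an earlier step than the hyperplane `K`. -/
def CrossesBefore (A : Set (Submodule ℝ V)) (γ : ℕ → Set V) (H K : Submodule ℝ V) : Prop :=
  ∃ i j, i < j ∧ H ∈ sep₁ A (γ i) (γ (i + 1)) ∧ K ∈ sep₁ A (γ j) (γ (j + 1))

/-- `L_2(γ, γ')` for two sequences of chambers from `c` to `c'`: the subspaces `X` in `L_2(c, c')`
for which `γ` and `γ'` cross the hyperplanes containing `X` in different linear orders. -/
def pathSep (A : Set (Submodule ℝ V)) (c c' : Set V) (γ γ' : ℕ → Set V) :
    Set (Submodule ℝ V) :=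
  {X ∈ sep₂ A c c' | ¬ ∀ H ∈ A, ∀ K ∈ A, X ≤ H → X ≤ K →
    (CrossesBefore A γ H K ↔ CrossesBefore A γ' H K)}

/-- A sequence of chambers from `c` to `c'` is incident to the flag `F` if, whenever `i < j`, it
crosses the hyperplanes in `A_{X_j}` before those in `A_{X_i} \ A_{X_j}` (among the hyperplanes
that have to be crossed). -/
def PathIncident (A : Set (Submodule ℝ V)) (F : Fin (Module.finrank ℝ V + 1) → Submodule ℝ V)
    (c c' : Set V) (γ : ℕ → Set V) : Prop :=
  ∀ i j, i < j → ∀ H ∈ sep₁ A c c', ∀ K ∈ sep₁ A c c',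
    F j ≤ H → F i ≤ K → ¬ F j ≤ K → CrossesBefore A γ H K

theorem sep₁_comm (A : Set (Submodule ℝ V)) (c c' : Set V) : sep₁ A c c' = sep₁ A c' c := by
  have key : ∀ c c' : Set V, sep₁ A c c' ⊆ sep₁ A c' c := by
    rintro c c' H ⟨hH, f, hf, h1, h2⟩
    refine ⟨hH, -f, ?_, fun x hx => by simpa using h2 x hx, fun x hx => by simpa using h1 x hx⟩
    rw [← hf]
    ext x
    simp
  exact (key c c').antisymm (key c' c)

theorem sep₁_self (A : Set (Submodule ℝ V)) {c : Set V} (hc : c.Nonempty) :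
    sep₁ A c c = ∅ := by
  obtain ⟨x, hx⟩ := hc
  refine Set.eq_empty_of_forall_notMem ?_
  rintro H ⟨-, f, -, h1, h2⟩
  exact lt_asymm (h1 x hx) (h2 x hx)

theorem pathSep_comm (A : Set (Submodule ℝ V)) (c c' : Set V) (γ γ' : ℕ → Set V) :
    pathSep A c c' γ γ' = pathSep A c c' γ' γ := by
  simp only [pathSep, iff_comm]

theorem pathSep_self (A : Set (Submodule ℝ V)) (c c' : Set V) (γ : ℕ → Set V) :
    pathSep A c c' γ γ = ∅ := by
  simp [pathSep]

end Lattice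

section Galleries

variable {V : Type*} [NormedAddCommGroup V] [NormedSpace ℝ V]

/-- The complement of the union of the hyperplanes. -/
def complement (A : Set (Submodule ℝ V)) : Set V := {x | ∀ H ∈ A, x ∉ H}

/-- The chambers: connected components of the complement. -/
def Chamber (A : Set (Submodule ℝ V)) : Type _ :=
  {c : Set V // ∃ x ∈ complement A, c = connectedComponentIn (complement A) x}

theorem Chamber.nonempty {A : Set (Submodule ℝ V)} (c : Chamber A) : c.1.Nonempty := by
  obtain ⟨x, hx, h⟩ := c.2
  exact ⟨x, h ▸ mem_connectedComponentIn hx⟩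

/-- The graph `G_1` on chambers: adjacent when separated by exactly one hyperplane. -/
def G₁ (A : Set (Submodule ℝ V)) : SimpleGraph (Chamber A) where
  Adj c c' := (sep₁ A c.1 c'.1).encard = 1
  symm := ⟨fun c c' h => by rwa [sep₁_comm]⟩
  loopless := ⟨fun c h => by simp [sep₁_self A c.nonempty] at h⟩

/-- `R(c, c')`: the minimal galleries, that is, shortest paths from `c` to `c'` in `G_1`. -/
def MinGallery (A : Set (Submodule ℝ V)) (c c' : Chamber A) : Type _ :=
  {p : (G₁ A).Walk c c' // p.length = (G₁ A).dist c c'}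

/-- The sequence of chambers visited by a gallery (constant after its end). -/
def MinGallery.seq {A : Set (Submodule ℝ V)} {c c' : Chamber A} (r : MinGallery A c c') :
    ℕ → Set V :=
  fun k => (r.1.getVert k).1

/-- `L_2(r, r')`. -/
def MinGallery.sep {A : Set (Submodule ℝ V)} {c c' : Chamber A} (r r' : MinGallery A c c') :
    Set (Submodule ℝ V) :=
  pathSep A c.1 c'.1 r.seq r'.seq

/-- The graph `G_2(c, c')` on minimal galleries: adjacent when separated by exactly one
codimension-two intersection subspace. -/
def G₂ (A : Set (Submodule ℝ V)) (c c' : Chamber A) : SimpleGraph (MinGallery A c c') where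
  Adj r r' := (r.sep r').encard = 1
  symm := ⟨fun r r' h => by rwa [MinGallery.sep, pathSep_comm]⟩
  loopless := ⟨fun r h => by simp [MinGallery.sep, pathSep_self] at h⟩

/-- A chamber `c` is incident to a subspace `X` if the cone `closure c ∩ X` has the same
dimension as `X`. -/
def Incident (c : Set V) (X : Submodule ℝ V) : Prop :=
  Module.finrank ℝ (Submodule.span ℝ (closure c ∩ (X : Set V))) = Module.finrank ℝ X

/-- A gallery incident to a flag. -/
def MinGallery.IncidentTo {A : Set (Submodule ℝ V)} {c c' : Chamber A} (r : MinGallery A c c')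
    (F : Fin (Module.finrank ℝ V + 1) → Submodule ℝ V) : Prop :=
  PathIncident A F c.1 c'.1 r.seq

end Galleries

section Reflections

variable {V : Type*} [NormedAddCommGroup V] [InnerProductSpace ℝ V] [FiniteDimensional ℝ V]

/-- The arrangement of type `A_{n-1}`: the hyperplanes `x_i = x_j` in the space of vectors of
`ℝⁿ` with coordinate sum zero, which represents the quotient of `ℝⁿ` by the line
`x_1 = ⋯ = x_n`. -/
def IsTypeA (n : ℕ) (A : Set (Submodule ℝ V)) : Prop :=
  ∃ φ : V →ₗᵢ[ℝ] EuclideanSpace ℝ (Fin n), Set.range φ = {x | ∑ i, x i = 0} ∧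
    A = {H | ∃ i j, i ≠ j ∧ ∀ v, v ∈ H ↔ φ v i = φ v j}

/-- The arrangement of type `B_n` in `ℝⁿ`: the hyperplanes `x_i = x_j`, `x_i = -x_j` (`i ≠ j`)
and `x_i = 0`. -/
def IsTypeB (n : ℕ) (A : Set (Submodule ℝ V)) : Prop :=
  ∃ φ : V ≃ₗᵢ[ℝ] EuclideanSpace ℝ (Fin n),
    A = {H | (∃ i j, i ≠ j ∧ ∀ v, v ∈ H ↔ φ v i = φ v j) ∨
      (∃ i j, i ≠ j ∧ ∀ v, v ∈ H ↔ φ v i = -φ v j) ∨ ∃ i, ∀ v, v ∈ H ↔ φ v i = 0}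

/-- The arrangement of dihedral type `I_2(m)`: the `m` lines in the plane orthogonal to
`(cos (kπ/m), sin (kπ/m))`, `0 ≤ k < m`. -/
def IsTypeI₂ (m : ℕ) (A : Set (Submodule ℝ V)) : Prop :=
  ∃ φ : V ≃ₗᵢ[ℝ] EuclideanSpace ℝ (Fin 2),
    A = {H | ∃ k < m, ∀ v, v ∈ H ↔
      Real.cos (k * Real.pi / m) * φ v 0 + Real.sin (k * Real.pi / m) * φ v 1 = 0}

/-- The group `W` generated by the orthogonal reflections in the hyperplanes of `A`. -/
def reflGroup (A : Set (Submodule ℝ V)) : Subgroup (V ≃ₗᵢ[ℝ] V) :=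
  Subgroup.closure {g | ∃ H ∈ A, g = H.reflection}

/-- The Coxeter generators `S` for the base chamber `c₀`: reflections in its walls. -/
def simpleRefl (A : Set (Submodule ℝ V)) (c₀ : Chamber A) : Set (V ≃ₗᵢ[ℝ] V) :=
  {g | ∃ H ∈ A, Incident c₀.1 H ∧ g = H.reflection}

/-- The group element represented by a word in the Coxeter generators. -/
def wordProd {A : Set (Submodule ℝ V)} {c₀ : Chamber A} (l : List (simpleRefl A c₀)) :
    V ≃ₗᵢ[ℝ] V :=
  (l.map Subtype.val).prod

/-- The reduced words of `w`: words of minimal length representing `w`. -/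
def ReducedWord (A : Set (Submodule ℝ V)) (c₀ : Chamber A) (w : V ≃ₗᵢ[ℝ] V) : Type _ :=
  {l : List (simpleRefl A c₀) // wordProd l = w ∧
    ∀ l' : List (simpleRefl A c₀), wordProd l' = w → l.length ≤ l'.length}

/-- `l'` arises from `l` by a braid relation: an alternating factor of length `m(s, t)`, the order
of `s t`, in two generators `s ≠ t` is replaced by the other such alternating word. -/
def BraidMove {A : Set (Submodule ℝ V)} {c₀ : Chamber A} (l l' : List (simpleRefl A c₀)) : Prop :=
  ∃ (u v : List (simpleRefl A c₀)) (s t : simpleRefl A c₀), s ≠ t ∧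
    l = u ++ CoxeterSystem.alternatingWord s t (orderOf (s.1 * t.1)) ++ v ∧
    l' = u ++ CoxeterSystem.alternatingWord t s (orderOf (s.1 * t.1)) ++ v

/-- The graph `G(w)` of reduced words of `w`, with edges the applicable braid relations. -/
def wordGraph (A : Set (Submodule ℝ V)) (c₀ : Chamber A) (w : V ≃ₗᵢ[ℝ] V) :
    SimpleGraph (ReducedWord A c₀ w) :=
  SimpleGraph.fromRel fun r r' => BraidMove r.1 r'.1

/-- `L_2(w) = L_2(c₀, w c₀)`. -/
def elemSep₂ (A : Set (Submodule ℝ V)) (c₀ : Chamber A) (w : V ≃ₗᵢ[ℝ] V) :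
    Set (Submodule ℝ V) :=
  sep₂ A c₀.1 (w '' c₀.1)

/-- The sequence `c₀, s₁ c₀, s₁ s₂ c₀, …` of chambers visited by a word `(s₁, s₂, …)`. -/
def ReducedWord.seq {A : Set (Submodule ℝ V)} {c₀ : Chamber A} {w : V ≃ₗᵢ[ℝ] V}
    (r : ReducedWord A c₀ w) : ℕ → Set V :=
  fun k => wordProd (r.1.take k) '' c₀.1

/-- `L_2(r, r')` for reduced words. -/
def ReducedWord.sep {A : Set (Submodule ℝ V)} {c₀ : Chamber A} {w : V ≃ₗᵢ[ℝ] V}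
    (r r' : ReducedWord A c₀ w) : Set (Submodule ℝ V) :=
  pathSep A c₀.1 (w '' c₀.1) r.seq r'.seq

/-- A reduced word whose gallery is incident to a flag. -/
def ReducedWord.IncidentTo {A : Set (Submodule ℝ V)} {c₀ : Chamber A} {w : V ≃ₗᵢ[ℝ] V}
    (r : ReducedWord A c₀ w) (F : Fin (Module.finrank ℝ V + 1) → Submodule ℝ V) : Prop :=
  PathIncident A F c₀.1 (w '' c₀.1) r.seq

end Reflections

end GalleryGraph

end

/-! Choose for each hyperplane a defining functional that is positive on `c₀`. A chamber is then the
set of hyperplanes on which it is negative, and a minimal gallery from `c₀` is a repetition-free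
list of hyperplanes each of whose prefixes is the negative set of some point (`IsGalleryList`).

A modular flag incident to `c₀` gives every hyperplane a level, the index of the largest flag member
inside it, and gives points `p k` of the flag members in the closure of `c₀`. Translating in the
direction `p (i + 1)` leaves hyperplanes of level above `i` untouched and moves towards the positive
side of all others. For two hyperplanes `G`, `G'` of level `i`, modularity supplies `M` of higher
level through `G ⊓ G'`; the functional of `M` is a combination of those of `G` and `G'` and vanishes
at `p (i + 1)`. Hence the difference of the times at which a translated point meets `G` and `G'` is
a nonzero multiple of the functional of `M` (`crossTime_sub_of_le`): which comes first depends only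
on the side of `M`.

This fixes the gallery incident to the flag. Levels decrease along it, and inside a level the order
is forced by hyperplanes of higher level, which gives uniqueness; explicit points on the translated
rays show that the forced order is realised (`exists_point`, `exists_sorted`).

If a gallery has an ascent of levels, take the first one, from a block of level `i` to `K`, and let
`H` be the last member of the block. Crossing `K` reverses crossing times inside the pencil of `H ⊓
K` and no others of that level. So the pencil is crossed consecutively with `K` last, and reversing
it gives another gallery (`exists_flip`). Along `H ⊓ K` this agrees with `r₀` afterwards, so the
move shrinks `L_2(r₀, ·)` strictly (`listSep_flip`). Induction gives the upper bound, and the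
triangle inclusion for `L_2` gives the lower bound (`edist_bounds`).

For reflection arrangements, the hyperplanes crossed by a word identify reduced words with gallery
lists (`Reduced.isGalleryList`, `exists_word`), and reversing a pencil is a braid move
(`braidMove_of_crossed`). It remains to exhibit flags: sort the coordinates of a point of `c₀` in
type A, sort their absolute values in type B, and use a bounding ray of `c₀` in the plane. -/

namespace GalleryGraph

/-! ### Chambers as sign cells of chosen functionals. -/

section Cells

variable {V : Type*} [NormedAddCommGroup V] [NormedSpace ℝ V]

/-- The set of points at which exactly the functionals `f H` with `H ∈ T` are negative. -/
def cell (A : Set (Submodule ℝ V)) (f : Submodule ℝ V → V →ₗ[ℝ] ℝ) (T : Set (Submodule ℝ V)) :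
    Set V :=
  {x | ∀ H ∈ A, (H ∈ T → f H x < 0) ∧ (H ∉ T → 0 < f H x)}

variable {A : Set (Submodule ℝ V)} {f : Submodule ℝ V → V →ₗ[ℝ] ℝ} {T T' : Set (Submodule ℝ V)}

theorem mem_cell_iff_of_mem {x y : V} (hx : x ∈ cell A f T) :
    y ∈ cell A f T ↔ ∀ H ∈ A, (f H y < 0 ↔ f H x < 0) ∧ f H y ≠ 0 := by
  constructor
  · intro hy H hH
    by_cases h : H ∈ T
    · have h1 := (hx H hH).1 h
      have h2 := (hy H hH).1 h
      exact ⟨iff_of_true h2 h1, h2.ne⟩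
    · have h1 := (hx H hH).2 h
      have h2 := (hy H hH).2 h
      exact ⟨iff_of_false h2.not_gt h1.not_gt, h2.ne'⟩
  · intro hy H hH
    refine ⟨fun h => (hy H hH).1.2 ((hx H hH).1 h), fun h => ?_⟩
    have h1 := (hx H hH).2 h
    have h2 := (hy H hH).1.not.2 h1.not_gt
    exact lt_of_le_of_ne (not_lt.1 h2) (hy H hH).2.symm

theorem mem_iff_neg_of_mem_cell {x : V} (hx : x ∈ cell A f T) {H : Submodule ℝ V} (hH : H ∈ A) :
    H ∈ T ↔ f H x < 0 := by
  refine ⟨(hx H hH).1, fun h => ?_⟩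
  by_contra h'
  exact lt_asymm h ((hx H hH).2 h')

theorem ne_zero_of_mem_cell {x : V} (hx : x ∈ cell A f T) {H : Submodule ℝ V} (hH : H ∈ A) :
    f H x ≠ 0 := by
  by_cases h : H ∈ T
  · exact ((hx H hH).1 h).ne
  · exact ((hx H hH).2 h).ne'

theorem mem_cell_of_ne_zero {x : V} (hx : ∀ H ∈ A, f H x ≠ 0) :
    x ∈ cell A f {H | H ∈ A ∧ f H x < 0} := fun H hH =>
  ⟨fun h => h.2, fun h => lt_of_le_of_ne (not_lt.1 fun h' => h ⟨hH, h'⟩) (hx H hH).symm⟩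

theorem cell_congr (h : ∀ H ∈ A, H ∈ T ↔ H ∈ T') : cell A f T = cell A f T' := by
  ext x
  exact forall₂_congr fun H hH => by rw [h H hH]

theorem cell_congr_iff (hT : (cell A f T).Nonempty) :
    cell A f T = cell A f T' ↔ ∀ H ∈ A, H ∈ T ↔ H ∈ T' := by
  refine ⟨fun h H hH => ?_, cell_congr⟩
  obtain ⟨x, hx⟩ := hT
  rw [mem_iff_neg_of_mem_cell hx hH, mem_iff_neg_of_mem_cell (h ▸ hx) hH]

theorem convex_cell : Convex ℝ (cell A f T) := by
  intro x hx y hy a b ha hb hab H hH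
  -- A zero weight has to be split off because the inequalities are strict.
  rcases ha.eq_or_lt with rfl | ha
  · simp only [zero_add] at hab
    subst hab
    simpa using hy H hH
  refine ⟨fun h => ?_, fun h => ?_⟩
  · have h1 := (hx H hH).1 h
    have h2 := (hy H hH).1 h
    simp only [map_add, map_smul, smul_eq_mul]
    nlinarith
  · have h1 := (hx H hH).2 h
    have h2 := (hy H hH).2 h
    simp only [map_add, map_smul, smul_eq_mul]
    nlinarith

theorem mem_complement_iff (hf : ∀ H ∈ A, LinearMap.ker (f H) = H) {x : V} :
    x ∈ complement A ↔ ∀ H ∈ A, f H x ≠ 0 :=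
  forall₂_congr fun H hH => by
    conv_lhs => rw [← hf H hH]
    rw [LinearMap.mem_ker]

theorem cell_subset_complement (hf : ∀ H ∈ A, LinearMap.ker (f H) = H) :
    cell A f T ⊆ complement A := fun _ hx =>
  (mem_complement_iff hf).2 fun _ hH => ne_zero_of_mem_cell hx hH

/-- The connected components of the complement are the nonempty cells. -/
theorem connectedComponentIn_eq_cell [FiniteDimensional ℝ V]
    (hf : ∀ H ∈ A, LinearMap.ker (f H) = H) {x : V} (hx : x ∈ cell A f T) :
    connectedComponentIn (complement A) x = cell A f T := by
  apply Set.Subset.antisymm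
  · intro y hy
    rw [mem_cell_iff_of_mem hx]
    intro H hH
    have hC := isPreconnected_connectedComponentIn (F := complement A) (x := x)
    have hxC := mem_connectedComponentIn (cell_subset_complement hf hx)
    have hcont : Continuous (f H) := (f H).continuous_of_finiteDimensional
    have hne : ∀ z ∈ connectedComponentIn (complement A) x, f H z ≠ 0 := fun z hz =>
      (mem_complement_iff hf).1 (connectedComponentIn_subset _ _ hz) H hH
    refine ⟨⟨fun h => ?_, fun h => ?_⟩, hne y hy⟩
    · by_contra h'
      obtain ⟨z, hz, hz0⟩ := hC.intermediate_value hy hxC hcont.continuousOn ⟨h.le, not_lt.1 h'⟩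
      exact hne z hz hz0
    · by_contra h'
      obtain ⟨z, hz, hz0⟩ := hC.intermediate_value hxC hy hcont.continuousOn ⟨h.le, not_lt.1 h'⟩
      exact hne z hz hz0
  · exact convex_cell.isPreconnected.subset_connectedComponentIn hx (cell_subset_complement hf)

/-- The chamber given by a nonempty cell. -/
def cellChamber [FiniteDimensional ℝ V] (hf : ∀ H ∈ A, LinearMap.ker (f H) = H)
    (h : (cell A f T).Nonempty) : Chamber A :=
  ⟨cell A f T, h.some, cell_subset_complement hf h.some_mem,
    (connectedComponentIn_eq_cell hf h.some_mem).symm⟩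

theorem Chamber.eq_cell [FiniteDimensional ℝ V] (hf : ∀ H ∈ A, LinearMap.ker (f H) = H)
    (c : Chamber A) {x : V} (hx : x ∈ c.1) : c.1 = cell A f {H | H ∈ A ∧ f H x < 0} := by
  obtain ⟨y, hy, h⟩ := c.2
  have hy' := mem_cell_of_ne_zero ((mem_complement_iff hf).1 hy)
  have h' := h.trans (connectedComponentIn_eq_cell hf hy')
  have hx' := h' ▸ hx
  rw [h']
  exact cell_congr fun H hH => by
    rw [mem_iff_neg_of_mem_cell hy' hH]
    simp only [Set.mem_ofPred_eq, hH, true_and]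
    exact (((mem_cell_iff_of_mem hy').1 hx' H hH).1).symm

theorem sep₁_cell (hf : ∀ H ∈ A, LinearMap.ker (f H) = H) (hT : (cell A f T).Nonempty)
    (hT' : (cell A f T').Nonempty) :
    sep₁ A (cell A f T) (cell A f T') = {H | H ∈ A ∧ ¬ (H ∈ T ↔ H ∈ T')} := by
  ext H
  constructor
  · rintro ⟨hH, g, hg, h1, h2⟩
    refine ⟨hH, fun h => ?_⟩
    obtain ⟨x, hx⟩ := hT
    obtain ⟨y, hy⟩ := hT'
    have hx1 := h1 x hx
    have hy1 := h2 y hy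
    -- This positive combination of `x` and `y` lies on the hyperplane, whichever functional defines
    -- it. So `f H` vanishes there too, and cannot have the same sign at both points.
    have hz : g ((-(g y)) • x + (g x) • y) = 0 := by simp; ring
    rw [← LinearMap.mem_ker, hg, ← hf H hH, LinearMap.mem_ker] at hz
    simp only [map_add, map_smul, smul_eq_mul] at hz
    by_cases hHT : H ∈ T
    · have a1 := (hx H hH).1 hHT
      have a2 := (hy H hH).1 (h.1 hHT)
      nlinarith
    · have a1 := (hx H hH).2 hHT
      have a2 := (hy H hH).2 (fun h' => hHT (h.2 h'))
      nlinarith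
  · rintro ⟨hH, h⟩
    refine ⟨hH, ?_⟩
    by_cases hHT : H ∈ T
    · have hHT' : H ∉ T' := fun h' => h ⟨fun _ => h', fun _ => hHT⟩
      refine ⟨-f H, ?_, fun x hx => ?_, fun x hx => ?_⟩
      · rw [← hf H hH]
        ext x
        simp [hf H hH]
      · simpa using (hx H hH).1 hHT
      · simpa using (hx H hH).2 hHT'
    · have hHT' : H ∈ T' := by
        by_contra h'
        exact h (iff_of_false hHT h')
      exact ⟨f H, hf H hH, fun x hx => (hx H hH).2 hHT, fun x hx => (hx H hH).1 hHT'⟩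

/-- Pushing `v` slightly towards the interior point `x` makes every weak inequality strict. -/
theorem mem_closure_of_nonneg {x v : V} (hx : x ∈ cell A f ∅)
    (hv : ∀ K ∈ A, 0 ≤ f K v) : v ∈ closure (cell A f ∅) := by
  have h1 : Filter.Tendsto (fun ε : ℝ => v + ε • x) (nhdsWithin 0 (Set.Ioi 0)) (nhds v) := by
    have : Filter.Tendsto (fun ε : ℝ => v + ε • x) (nhds 0) (nhds (v + (0 : ℝ) • x)) := by
      apply Continuous.tendsto
      fun_prop
    rw [zero_smul, add_zero] at this
    exact this.mono_left nhdsWithin_le_nhds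
  refine mem_closure_of_tendsto h1 (Filter.eventually_of_mem self_mem_nhdsWithin fun ε hε => ?_)
  intro K hK
  refine ⟨by simp, fun _ => ?_⟩
  have h2 := mul_pos (show 0 < ε from hε) ((hx K hK).2 (by simp))
  have h3 := hv K hK
  simp only [map_add, map_smul, smul_eq_mul]
  linarith

end Cells

/-! ### Linear functionals defining hyperplanes. -/

section Functionals

variable {V : Type*} [AddCommGroup V] [Module ℝ V]

/-- A functional vanishing on the intersection of two hyperplanes is a combination of the two. -/
theorem exists_combination {g h k : V →ₗ[ℝ] ℝ}
    (H : LinearMap.ker g ⊓ LinearMap.ker h ≤ LinearMap.ker k) : ∃ a b : ℝ, k = a • g + b • h := by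
  have := mem_span_of_iInf_ker_le_ker (L := ![g, h]) (K := k) (by
    refine le_trans (fun x hx => ?_) H
    simp only [Submodule.mem_iInf] at hx
    exact ⟨hx 0, hx 1⟩)
  simp only [Matrix.range_cons, Matrix.range_empty, Set.union_empty, Set.singleton_union] at this
  obtain ⟨a, b, h⟩ := Submodule.mem_span_pair.1 this
  exact ⟨a, b, h.symm⟩

theorem exists_functional {H : Submodule ℝ V} (hH : IsCoatom H) :
    ∃ g : V →ₗ[ℝ] ℝ, LinearMap.ker g = H := by
  obtain ⟨g, hg0, hg⟩ := Submodule.exists_le_ker_of_lt_top H hH.lt_top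
  refine ⟨g, (hH.le_iff.1 hg).resolve_left fun h => hg0 ?_⟩
  exact LinearMap.ker_eq_top.1 h

end Functionals

/-! ### Normalising signs at the base chamber. -/

section Base

variable {V : Type*} [NormedAddCommGroup V] [NormedSpace ℝ V] [FiniteDimensional ℝ V]

/-- With signs normalised at `c₀`, the negative set of a chamber is exactly the set of hyperplanes
separating it from `c₀`. All later combinatorics is carried out in these terms. -/
theorem Chamber.exists_functionals {A : Set (Submodule ℝ V)} (hA : IsArrangement A)
    (c₀ : Chamber A) : ∃ f : Submodule ℝ V → V →ₗ[ℝ] ℝ,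
      (∀ H ∈ A, LinearMap.ker (f H) = H) ∧ c₀.1 = cell A f ∅ := by
  obtain ⟨x, hx⟩ := c₀.nonempty
  have hxc : x ∈ complement A := by
    obtain ⟨y, hy, h⟩ := c₀.2
    exact connectedComponentIn_subset _ _ (h ▸ hx)
  have : ∀ H : Submodule ℝ V, ∃ g : V →ₗ[ℝ] ℝ, H ∈ A → LinearMap.ker g = H ∧ 0 < g x := by
    intro H
    by_cases hH : H ∈ A
    · obtain ⟨g, hg⟩ := exists_functional (hA.hyperplane H hH)
      have hgx : g x ≠ 0 := fun h => hxc H hH (by rw [← hg]; exact h)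
      rcases hgx.lt_or_gt with h | h
      · refine ⟨-g, fun _ => ⟨?_, by simpa using h⟩⟩
        rw [← hg]
        ext y
        simp
      · exact ⟨g, fun _ => ⟨hg, h⟩⟩
    · exact ⟨0, fun h => absurd h hH⟩
  choose f hf using this
  refine ⟨f, fun H hH => (hf H hH).1, ?_⟩
  rw [c₀.eq_cell (fun H hH => (hf H hH).1) hx]
  exact cell_congr fun H hH => by
    simp [hH, ((hf H hH).2).le]

end Base

end GalleryGraph

namespace GalleryGraph

/-! ### Order of occurrence in lists. -/

section Lists

variable {α : Type*}

/-- In a list without repetitions the relation `[a, b].Sublist l` expresses that `a` is crossed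
before `b`; this is how crossing orders are compared throughout. -/
theorem pair_sublist_iff {a b : α} {l : List α} :
    [a, b].Sublist l ↔ ∃ s t, l = s ++ b :: t ∧ a ∈ s := by
  constructor
  · intro h
    have h' : ([a] ++ [b]).Sublist l := h
    obtain ⟨s, r, rfl, h1, h2⟩ := List.append_sublist_iff.1 h'
    obtain ⟨s', t, rfl⟩ := List.append_of_mem (List.singleton_sublist.1 h2)
    exact ⟨s ++ s', t, by simp, List.mem_append_left _ (List.singleton_sublist.1 h1)⟩
  · rintro ⟨s, t, rfl, h⟩
    exact (List.singleton_sublist.2 h).append ((List.nil_sublist t).cons_cons b)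

theorem pair_sublist_append {a b : α} {l l' : List α} :
    [a, b].Sublist (l ++ l') ↔ [a, b].Sublist l ∨ [a, b].Sublist l' ∨ (a ∈ l ∧ b ∈ l') := by
  constructor
  · intro h
    obtain ⟨s, t, h1, h2, h3⟩ := List.sublist_append_iff.1 h
    match s, h1 with
    | [], h1 => simp only [List.nil_append] at h1; subst h1; exact Or.inr (Or.inl h3)
    | [x], h1 =>
      simp only [List.cons_append, List.nil_append, List.cons.injEq] at h1
      obtain ⟨rfl, rfl⟩ := h1
      exact Or.inr (Or.inr ⟨List.singleton_sublist.1 h2, List.singleton_sublist.1 h3⟩)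
    | x :: y :: s, h1 =>
      simp only [List.cons_append, List.cons.injEq] at h1
      obtain ⟨rfl, rfl, h1⟩ := h1
      obtain ⟨rfl, rfl⟩ := List.append_eq_nil_iff.1 h1.symm
      exact Or.inl h2
  · rintro (h | h | ⟨h, h'⟩)
    · exact h.trans (List.sublist_append_left _ _)
    · exact h.trans (List.sublist_append_right _ _)
    · exact (List.singleton_sublist.2 h).append (List.singleton_sublist.2 h')

theorem mem_of_pair_sublist {a b : α} {l : List α} (h : [a, b].Sublist l) : a ∈ l ∧ b ∈ l :=
  ⟨h.subset (by simp), h.subset (by simp)⟩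

theorem pair_sublist_asymm {a b : α} {l : List α} (hl : l.Nodup) (h : [a, b].Sublist l) :
    ¬ [b, a].Sublist l := by
  intro h'
  obtain ⟨s, t, rfl, ha⟩ := pair_sublist_iff.1 h
  rw [List.nodup_append] at hl
  rcases pair_sublist_append.1 h' with h1 | h1 | ⟨h1, -⟩
  · exact hl.2.2 b (mem_of_pair_sublist h1).1 b (by simp) rfl
  · exact hl.2.2 a ha a (mem_of_pair_sublist h1).2 rfl
  · exact hl.2.2 b h1 b (by simp) rfl

theorem pair_sublist_total {a b : α} {l : List α} (ha : a ∈ l) (hb : b ∈ l) (hab : a ≠ b) :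
    [a, b].Sublist l ∨ [b, a].Sublist l := by
  obtain ⟨s, t, rfl⟩ := List.append_of_mem ha
  rcases List.mem_append.1 hb with h | h
  · exact Or.inr (pair_sublist_iff.2 ⟨s, t, rfl, h⟩)
  · rcases List.mem_cons.1 h with h | h
    · exact absurd h.symm hab
    · refine Or.inl (pair_sublist_append.2 (Or.inr (Or.inl ?_)))
      exact (List.singleton_sublist.2 h).cons_cons a

/-- Rearranging a factor does not affect the order of a pair not contained in the factor. -/
theorem pair_sublist_congr {a b : α} {u x x' v : List α} (hx : ∀ c, c ∈ x ↔ c ∈ x')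
    (h : ¬ (a ∈ x ∧ b ∈ x)) :
    [a, b].Sublist (u ++ x ++ v) ↔ [a, b].Sublist (u ++ x' ++ v) := by
  have h1 : ¬ [a, b].Sublist x := fun h' => h (mem_of_pair_sublist h')
  have h2 : ¬ [a, b].Sublist x' := fun h' => h (by
    rw [hx, hx]; exact mem_of_pair_sublist h')
  simp only [pair_sublist_append, List.mem_append, hx, h1, h2]

/-- Cut at the end of the longest prefix with weakly decreasing levels. Its last level `i` is the
minimum over that prefix, so the entries of level `i` form its final block. -/
theorem exists_first_ascent (lev : α → ℕ) (l : List α)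
    (h : ¬ l.Pairwise fun a b => lev b ≤ lev a) :
    ∃ u₁ u₂ K v i, l = u₁ ++ u₂ ++ K :: v ∧ u₂ ≠ [] ∧ (∀ a ∈ u₁, i < lev a) ∧
      (∀ a ∈ u₂, lev a = i) ∧ i < lev K := by
  induction l using List.reverseRecOn with
  | nil => simp at h
  | append_singleton l a ih =>
    by_cases hl : l.Pairwise fun a b => lev b ≤ lev a
    · rcases List.eq_nil_or_concat l with rfl | ⟨l', b, rfl⟩
      · simp at h
      rw [List.concat_eq_append] at h hl ⊢
      have hb : ∀ c ∈ l', lev b ≤ lev c := by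
        rw [List.pairwise_append] at hl
        exact fun c hc => hl.2.2 c hc b (by simp)
      have hba : lev b < lev a := by
        by_contra hab
        refine h (List.pairwise_append.2 ⟨hl, by simp, fun c hc d hd => ?_⟩)
        simp only [List.mem_singleton] at hd
        subst hd
        rcases List.mem_append.1 hc with hc | hc
        · exact (not_lt.1 hab).trans (hb c hc)
        · simp only [List.mem_singleton] at hc
          subst hc
          exact not_lt.1 hab
      have key : ∀ m : List α, m.Pairwise (fun a b => lev b ≤ lev a) → (∀ c ∈ m, lev b ≤ lev c) →
          ∃ u₁ u₂, m = u₁ ++ u₂ ∧ (∀ c ∈ u₁, lev b < lev c) ∧ ∀ c ∈ u₂, lev c = lev b := by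
        intro m
        induction m with
        | nil => exact fun _ _ => ⟨[], [], by simp⟩
        | cons c m ihm =>
          intro h1 h2
          rw [List.pairwise_cons] at h1
          rcases (h2 c (by simp)).eq_or_lt with h3 | h3
          · refine ⟨[], c :: m, rfl, by simp, fun e he => ?_⟩
            rcases List.mem_cons.1 he with rfl | he'
            · exact h3.symm
            · exact le_antisymm ((h1.1 e he').trans h3.ge) (h2 e he)
          · obtain ⟨u₁, u₂, rfl, h4, h5⟩ := ihm h1.2 fun e he => h2 e (by simp [he])
            exact ⟨c :: u₁, u₂, rfl, by simpa using ⟨h3, h4⟩, h5⟩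
      rw [List.pairwise_append] at hl
      obtain ⟨u₁, u₂, rfl, h4, h5⟩ := key l' hl.1 hb
      refine ⟨u₁, u₂ ++ [b], a, [], lev b, by simp, by simp, h4, fun c hc => ?_, hba⟩
      rcases List.mem_append.1 hc with hc | hc
      · exact h5 c hc
      · simp only [List.mem_singleton] at hc
        rw [hc]
    · obtain ⟨u₁, u₂, K, v, i, rfl, h1⟩ := ih hl
      exact ⟨u₁, u₂, K, v ++ [a], i, by simp, h1⟩

/-- Once `P` holds it persists, so the entries satisfying `P` form a suffix. It is applied to the
hyperplanes through a fixed codimension two subspace. -/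
theorem exists_suffix_of_pairwise {P : α → Prop} {l : List α}
    (h : l.Pairwise fun a b => P a → P b) :
    ∃ u w, l = u ++ w ∧ (∀ a ∈ u, ¬ P a) ∧ ∀ a ∈ w, P a := by
  induction l with
  | nil => exact ⟨[], [], by simp⟩
  | cons a l ih =>
    rw [List.pairwise_cons] at h
    by_cases ha : P a
    · exact ⟨[], a :: l, rfl, by simp, by simpa [ha] using fun b hb => h.1 b hb ha⟩
    · obtain ⟨u, w, rfl, h1, h2⟩ := ih h.2
      exact ⟨a :: u, w, rfl, by simpa [ha] using h1, h2⟩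

end Lists

/-! ### Pencils of hyperplanes through a codimension two subspace. -/

section Codimension

variable {V : Type*} [AddCommGroup V] [Module ℝ V] [FiniteDimensional ℝ V]

theorem finrank_add_one_of_isCoatom {H : Submodule ℝ V} (hH : IsCoatom H) :
    Module.finrank ℝ H + 1 = Module.finrank ℝ V := by
  obtain ⟨g, rfl⟩ := exists_functional hH
  exact Module.Dual.finrank_ker_add_one_of_ne_zero
    (fun h => hH.1 (LinearMap.ker_eq_top.2 h))

theorem finrank_inf_add_two {H K : Submodule ℝ V} (hH : IsCoatom H) (hK : IsCoatom K)
    (h : H ≠ K) : Module.finrank ℝ (H ⊓ K : Submodule ℝ V) + 2 = Module.finrank ℝ V := by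
  have h1 := Submodule.finrank_sup_add_finrank_inf_eq H K
  rw [hH.sup_eq_top_of_ne hK h, finrank_top] at h1
  have h2 := finrank_add_one_of_isCoatom hH
  have h3 := finrank_add_one_of_isCoatom hK
  omega

theorem inf_eq_of_finrank {H K X : Submodule ℝ V} (hH : IsCoatom H) (hK : IsCoatom K)
    (h : H ≠ K) (hX : Module.finrank ℝ X + 2 = Module.finrank ℝ V) (hXH : X ≤ H) (hXK : X ≤ K) :
    X = H ⊓ K := by
  refine Submodule.eq_of_le_of_finrank_eq (le_inf hXH hXK) ?_
  have := finrank_inf_add_two hH hK h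
  omega

/-- By dimension, any two distinct members of a pencil determine its axis. -/
theorem inf_eq_inf_of_le {G G' H K : Submodule ℝ V} (hG : IsCoatom G) (hG' : IsCoatom G')
    (hH : IsCoatom H) (hK : IsCoatom K) (hGG' : G ≠ G') (hHK : H ≠ K) (h : H ⊓ K ≤ G)
    (h' : H ⊓ K ≤ G') : H ⊓ K = G ⊓ G' :=
  inf_eq_of_finrank hG hG' hGG' (finrank_inf_add_two hH hK hHK) h h'

end Codimension

/-! ### Levels, crossing times, and the gallery incident to the flag. -/

section Core

variable {V : Type*} [NormedAddCommGroup V] [NormedSpace ℝ V]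

/-- A list of hyperplanes that is the sequence of walls crossed by a minimal gallery starting in
the cell where all functionals are positive. -/
structure IsGalleryList (A : Set (Submodule ℝ V)) (f : Submodule ℝ V → V →ₗ[ℝ] ℝ)
    (l : List (Submodule ℝ V)) : Prop where
  nodup : l.Nodup
  subset : ∀ H ∈ l, H ∈ A
  nonempty : ∀ k, (cell A f {H | H ∈ l.take k}).Nonempty

/-- The data obtained from a modular flag incident to the base chamber: `lev H` is the index of the
largest flag member inside `H`, and `p k` is a point of the `k`-th flag member in the relative
interior of a face of the base chamber. -/
structure FlagData (A : Set (Submodule ℝ V)) (f : Submodule ℝ V → V →ₗ[ℝ] ℝ)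
    (lev : Submodule ℝ V → ℕ) (p : ℕ → V) : Prop where
  arr : IsArrangement A
  ker : ∀ H ∈ A, LinearMap.ker (f H) = H
  vanish : ∀ k, ∀ H ∈ A, k ≤ lev H → f H (p k) = 0
  pos : ∀ k, ∀ H ∈ A, lev H < k → 0 < f H (p k)
  modular : ∀ H ∈ A, ∀ H' ∈ A, H ≠ H' → lev H = lev H' → ∃ M ∈ A, lev H < lev M ∧ H ⊓ H' ≤ M

/-- The time at which the line through `v` in direction `p (lev G + 1)` crosses `G`. -/
noncomputable def crossTime (f : Submodule ℝ V → V →ₗ[ℝ] ℝ) (lev : Submodule ℝ V → ℕ) (p : ℕ → V)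
    (G : Submodule ℝ V) (v : V) : ℝ :=
  - f G v / f G (p (lev G + 1))

variable {A : Set (Submodule ℝ V)} {f : Submodule ℝ V → V →ₗ[ℝ] ℝ} {lev : Submodule ℝ V → ℕ}
  {p : ℕ → V}

theorem IsGalleryList.nonempty_of_append {u v : List (Submodule ℝ V)}
    (h : IsGalleryList A f (u ++ v)) : (cell A f {H | H ∈ u}).Nonempty := by
  simpa using h.nonempty u.length

namespace FlagData

theorem combination (D : FlagData A f lev p) {G H K : Submodule ℝ V} (hG : G ∈ A) (hH : H ∈ A)
    (hK : K ∈ A) (h : H ⊓ K ≤ G) : ∃ a b : ℝ, f G = a • f H + b • f K :=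
  exists_combination (by rwa [D.ker G hG, D.ker H hH, D.ker K hK])

theorem crossTime_neg_iff (D : FlagData A f lev p) {G : Submodule ℝ V} (hG : G ∈ A) {v : V} :
    0 < crossTime f lev p G v ↔ f G v < 0 := by
  have := D.pos _ G hG (Nat.lt_succ_self _)
  rw [crossTime, lt_div_iff₀ this]
  simp

theorem crossTime_pos_iff (D : FlagData A f lev p) {G : Submodule ℝ V} (hG : G ∈ A) {v : V} :
    crossTime f lev p G v < 0 ↔ 0 < f G v := by
  have := D.pos _ G hG (Nat.lt_succ_self _)
  rw [crossTime, div_lt_iff₀ this]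
  simp

/-- Write `f M = a • f G + b • f G'`. Evaluation at `p (lev G + 1)`, which lies on `M` but on
neither `G` nor `G'`, determines the ratio of `b` to `a` and makes `f M` proportional to the
difference of crossing times. The coefficient `a` is nonzero, since otherwise `f M` would vanish
identically. -/
theorem crossTime_sub_of_le (D : FlagData A f lev p) {G G' M : Submodule ℝ V} (hG : G ∈ A)
    (hG' : G' ∈ A) (hM : M ∈ A) (hlev : lev G = lev G') (hGM : lev G < lev M)
    (h : G ⊓ G' ≤ M) :
    ∃ κ : ℝ, κ ≠ 0 ∧ ∀ v, crossTime f lev p G v - crossTime f lev p G' v = κ * f M v := by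
  obtain ⟨a, b, hab⟩ := D.combination hM hG hG' h
  have h1 := D.pos (lev G + 1) G hG (Nat.lt_succ_self _)
  have h2 := D.pos (lev G + 1) G' hG' (by omega)
  have h3 := D.vanish (lev G + 1) M hM hGM
  have h4 := D.pos (lev M + 1) M hM (Nat.lt_succ_self _)
  rw [hab] at h3
  simp only [LinearMap.add_apply, LinearMap.smul_apply, smul_eq_mul] at h3
  have ha : a ≠ 0 := by
    rintro rfl
    have hb : b = 0 := by
      rw [zero_mul, zero_add] at h3
      exact (mul_eq_zero.1 h3).resolve_right h2.ne'
    rw [hab, hb] at h4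
    simp at h4
  refine ⟨-(a * f G (p (lev G + 1)))⁻¹, by simp [ha, h1.ne'], fun v => ?_⟩
  have hb : b = -(a * f G (p (lev G + 1))) / f G' (p (lev G + 1)) := by
    field_simp
    linarith
  simp only [crossTime, ← hlev]
  rw [hab]
  simp only [LinearMap.add_apply, LinearMap.smul_apply, smul_eq_mul]
  rw [hb]
  field_simp
  ring

theorem exists_crossTime_sub (D : FlagData A f lev p) {G G' : Submodule ℝ V} (hG : G ∈ A)
    (hG' : G' ∈ A) (hne : G ≠ G') (hlev : lev G = lev G') :
    ∃ M ∈ A, lev G < lev M ∧ G ⊓ G' ≤ M ∧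
      ∃ κ : ℝ, κ ≠ 0 ∧ ∀ v, crossTime f lev p G v - crossTime f lev p G' v = κ * f M v := by
  obtain ⟨M, hM, h1, h2⟩ := D.modular G hG G' hG' hne hlev
  exact ⟨M, hM, h1, h2, D.crossTime_sub_of_le hG hG' hM hlev h1 h2⟩

theorem crossTime_ne (D : FlagData A f lev p) {G G' : Submodule ℝ V} (hG : G ∈ A)
    (hG' : G' ∈ A) (hne : G ≠ G') (hlev : lev G = lev G') {q : V} (hq : ∀ M ∈ A, f M q ≠ 0) :
    crossTime f lev p G q ≠ crossTime f lev p G' q := by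
  obtain ⟨M, hM, -, -, κ, hκ, h⟩ := D.exists_crossTime_sub hG hG' hne hlev
  rw [← sub_ne_zero, h]
  exact mul_ne_zero hκ (hq M hM)

/-- The crossing order of two hyperplanes of the same level depends only on the position with
respect to the hyperplanes of higher level through their intersection. -/
theorem crossTime_lt_iff (D : FlagData A f lev p) {G G' : Submodule ℝ V} (hG : G ∈ A)
    (hG' : G' ∈ A) (hne : G ≠ G') (hlev : lev G = lev G') {q q' : V} (hq : ∀ M ∈ A, f M q ≠ 0)
    (hq' : ∀ M ∈ A, f M q' ≠ 0)
    (h : ∀ M ∈ A, lev G < lev M → G ⊓ G' ≤ M → (f M q < 0 ↔ f M q' < 0)) :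
    crossTime f lev p G' q < crossTime f lev p G q ↔
      crossTime f lev p G' q' < crossTime f lev p G q' := by
  obtain ⟨M, hM, h1, h2, κ, hκ, h3⟩ := D.exists_crossTime_sub hG hG' hne hlev
  have h4 := h M hM h1 h2
  rw [← sub_pos, h3, ← sub_pos (b := crossTime f lev p G' q'), h3]
  rcases (hq M hM).lt_or_gt with a | a <;> rcases (hq' M hM).lt_or_gt with b | b
  · rw [← neg_mul_neg, ← neg_mul_neg κ (f M q'), mul_pos_iff_of_pos_right (neg_pos.2 a),
      mul_pos_iff_of_pos_right (neg_pos.2 b)]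
  · exact absurd (h4.1 a) b.not_gt
  · exact absurd (h4.2 b) a.not_gt
  · rw [mul_pos_iff_of_pos_right a, mul_pos_iff_of_pos_right b]

/-- The difference of crossing times is a fixed nonzero multiple of `f K`, so passing through `K`
exchanges the order. -/
theorem crossTime_lt_iff_gt (D : FlagData A f lev p) {G G' K : Submodule ℝ V} (hG : G ∈ A)
    (hG' : G' ∈ A) (hK : K ∈ A) (hlev : lev G = lev G') (hGK : lev G < lev K) (h : G ⊓ G' ≤ K)
    {q q' : V} (hq : 0 < f K q) (hq' : f K q' < 0) :
    crossTime f lev p G' q < crossTime f lev p G q ↔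
      crossTime f lev p G q' < crossTime f lev p G' q' := by
  obtain ⟨κ, hκ, h3⟩ := D.crossTime_sub_of_le hG hG' hK hlev hGK h
  rw [← sub_pos, h3, ← sub_neg (b := crossTime f lev p G' q'), h3]
  rcases hκ.lt_or_gt with a | a
  · exact iff_of_false (mul_neg_of_neg_of_pos a hq).not_gt (mul_pos_of_neg_of_neg a hq').not_gt
  · exact iff_of_true (mul_pos a hq) (mul_neg_of_pos_of_neg a hq')

/-- The order in which the gallery incident to the flag crosses the hyperplanes. -/
noncomputable def key (f : Submodule ℝ V → V →ₗ[ℝ] ℝ) (lev : Submodule ℝ V → ℕ) (p : ℕ → V) (q : V)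
    (G : Submodule ℝ V) : ℕᵒᵈ ×ₗ ℝ :=
  toLex (OrderDual.toDual (lev G), - crossTime f lev p G q)

theorem key_lt_iff {q : V} {G M : Submodule ℝ V} :
    key f lev p q G < key f lev p q M ↔ lev M < lev G ∨
      (lev G = lev M ∧ crossTime f lev p M q < crossTime f lev p G q) := by
  simp [key, Prod.Lex.toLex_lt_toLex]

theorem key_injOn (D : FlagData A f lev p) {q : V} (hq : ∀ M ∈ A, f M q ≠ 0) :
    Set.InjOn (key f lev p q) A := by
  intro G hG M hM h
  by_contra hne
  have h' : lev G = lev M ∧ crossTime f lev p G q = crossTime f lev p M q := by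
    simpa [key] using h
  exact D.crossTime_ne hG hM hne h'.1 hq h'.2

/-- Start from `q`, move along `p (lev M + 1)` until just after `M` is crossed, then move far along
`p (lev M)`. The second move makes all hyperplanes of lower level positive and leaves the other
levels alone; the first decides the level of `M` and leaves higher levels as they are at `q`. The
point reached is the one just before `M` on the gallery ordered by `key`. -/
theorem exists_point (D : FlagData A f lev p) {q : V} (hq : ∀ M ∈ A, f M q ≠ 0)
    {M : Submodule ℝ V} (hM : M ∈ A) (hMq : f M q < 0) :
    (cell A f {G | f G q < 0 ∧ key f lev p q G < key f lev p q M}).Nonempty := by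
  have ht0 : 0 < crossTime f lev p M q := (D.crossTime_neg_iff hM).2 hMq
  set t₀ := crossTime f lev p M q
  -- The time `t` must lie after `t₀` but before every later crossing time.
  have ht : ∀ᶠ t in nhdsWithin t₀ (Set.Ioi t₀), ∀ G ∈ A, t₀ < crossTime f lev p G q →
      t < crossTime f lev p G q := by
    rw [Filter.eventually_all_finite D.arr.finite]
    intro G hG
    by_cases h : t₀ < crossTime f lev p G q
    · exact nhdsWithin_le_nhds ((eventually_lt_nhds h).mono fun t ht _ => ht)
    · exact Filter.Eventually.of_forall fun t h' => absurd h' h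
  obtain ⟨t, ht1, ht2⟩ := (ht.and self_mem_nhdsWithin).exists
  have ht2 : t₀ < t := ht2
  -- The coefficient `s` must be large enough to overcome the values of all lower-level functionals
  -- at the intermediate point.
  have hs : ∀ᶠ s : ℝ in Filter.atTop, ∀ G ∈ A, lev G < lev M →
      0 < f G (q + t • p (lev M + 1)) + s * f G (p (lev M)) := by
    rw [Filter.eventually_all_finite D.arr.finite]
    intro G hG
    by_cases h : lev G < lev M
    · have := (Filter.tendsto_atTop_add_const_left _ (f G (q + t • p (lev M + 1)))
        (Filter.tendsto_id.atTop_mul_const (D.pos _ G hG h))).eventually_gt_atTop 0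
      exact this.mono fun s hs _ => hs
    · exact Filter.Eventually.of_forall fun t h' => absurd h' h
  obtain ⟨s, hs⟩ := hs.exists
  refine ⟨q + t • p (lev M + 1) + s • p (lev M), fun G hG => ?_⟩
  have hval : f G (q + t • p (lev M + 1) + s • p (lev M)) =
      f G q + t * f G (p (lev M + 1)) + s * f G (p (lev M)) := by simp
  rw [hval]
  simp only [Set.mem_ofPred_eq, key_lt_iff]
  rcases lt_trichotomy (lev G) (lev M) with h | h | h
  · have h1 := hs G hG h
    simp only [map_add, map_smul, smul_eq_mul] at h1
    exact ⟨fun h2 => by omega, fun _ => h1⟩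
  · have h1 := D.vanish (lev M) G hG h.ge
    have h2 := D.pos (lev M + 1) G hG (by omega)
    have h3 : crossTime f lev p G q = - f G q / f G (p (lev M + 1)) := by rw [crossTime, h]
    rw [h1, mul_zero, add_zero]
    constructor
    · rintro ⟨-, h4⟩
      have h5 := ht1 G hG (by rcases h4 with h4 | h4; · omega
                              · exact h4.2)
      rw [h3, lt_div_iff₀ h2] at h5
      linarith
    · intro h4
      have h5 : crossTime f lev p G q ≤ t₀ := by
        by_contra h5
        rw [not_le] at h5
        exact h4 ⟨(D.crossTime_neg_iff hG).1 (ht0.trans h5), Or.inr ⟨h, h5⟩⟩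
      have h6 := h5.trans_lt ht2
      rw [h3, div_lt_iff₀ h2] at h6
      linarith
  · rw [D.vanish _ G hG h, D.vanish _ G hG h.le]
    simp only [mul_zero, add_zero]
    exact ⟨fun h1 => h1.1, fun h1 => lt_of_le_of_ne
      (not_lt.1 fun h2 => h1 ⟨h2, Or.inl h⟩) (hq G hG).symm⟩

theorem nonempty_cell_take {l : List (Submodule ℝ V)} (h : (cell A f {H | H ∈ l}).Nonempty)
    (h' : ∀ u M v, l = u ++ M :: v → (cell A f {H | H ∈ u}).Nonempty) (k : ℕ) :
    (cell A f {H | H ∈ l.take k}).Nonempty := by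
  by_cases hk : k < l.length
  · exact h' _ l[k] (l.drop (k + 1)) (by simp)
  · rwa [List.take_of_length_le (not_lt.1 hk)]

/-- Existence of a gallery crossing the hyperplanes in decreasing order of level. -/
theorem exists_sorted (D : FlagData A f lev p) {q : V} (hq : ∀ M ∈ A, f M q ≠ 0) :
    ∃ l, IsGalleryList A f l ∧ (∀ H, H ∈ l ↔ H ∈ A ∧ f H q < 0) ∧
      l.Pairwise fun G M => key f lev p q G < key f lev p q M := by
  classical
  have hfin : {H | H ∈ A ∧ f H q < 0}.Finite := D.arr.finite.subset fun H h => h.1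
  let r : Submodule ℝ V → Submodule ℝ V → Prop := fun G M => key f lev p q G ≤ key f lev p q M
  have : IsTrans _ r := ⟨fun _ _ _ => le_trans⟩
  have : Std.Total r := ⟨fun _ _ => le_total _ _⟩
  let l := hfin.toFinset.toList.insertionSort r
  have hmem : ∀ H, H ∈ l ↔ H ∈ A ∧ f H q < 0 := by
    intro H
    simp [l]
  have hnd : l.Nodup := (List.perm_insertionSort r _).nodup_iff.2 (Finset.nodup_toList _)
  have hsort : l.Pairwise fun G M => key f lev p q G < key f lev p q M := by
    have h1 : l.Pairwise r := List.pairwise_insertionSort r _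
    refine (h1.and hnd).imp_of_mem fun {G M} hG hM h => lt_of_le_of_ne h.1 fun h' => h.2 ?_
    exact D.key_injOn hq ((hmem G).1 hG).1 ((hmem M).1 hM).1 h'
  refine ⟨l, ⟨hnd, fun H hH => ((hmem H).1 hH).1, nonempty_cell_take ?_ ?_⟩, hmem, hsort⟩
  · exact ⟨q, by simpa [hmem] using mem_cell_of_ne_zero hq⟩
  · intro u M v hl
    have hM := (hmem M).1 (by simp [hl])
    rw [hl, List.pairwise_append, List.pairwise_cons] at hsort
    convert D.exists_point hq hM.1 hM.2 using 1
    refine cell_congr fun G hG => ?_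
    simp only [Set.mem_ofPred_eq]
    constructor
    · intro h
      exact ⟨((hmem G).1 (by simp [hl, h])).2, hsort.2.2 G h M (by simp)⟩
    · rintro ⟨h1, h2⟩
      have h3 := (hmem G).2 ⟨hG, h1⟩
      simp only [hl, List.mem_append, List.mem_cons] at h3
      rcases h3 with h3 | rfl | h3
      · exact h3
      · exact absurd h2 (lt_irrefl _)
      · exact absurd (hsort.2.1.1 G h3) h2.not_gt

/-- At a point reached just before `G'`, the crossed `G` has positive crossing time and the
uncrossed `G'` a negative one. The order is the same at `q`, because `q` lies on the same side of
every hyperplane of higher level. -/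
theorem crossTime_lt_of_append (D : FlagData A f lev p) {l₁ l₂ : List (Submodule ℝ V)}
    {G G' : Submodule ℝ V} (hl : IsGalleryList A f (l₁ ++ G' :: l₂)) (hG : G ∈ l₁)
    (hlev : lev G = lev G') {q : V} (hq : ∀ M ∈ A, f M q ≠ 0)
    (h : ∀ M ∈ A, lev G < lev M → (M ∈ l₁ ↔ f M q < 0)) :
    crossTime f lev p G' q < crossTime f lev p G q := by
  obtain ⟨z, hz⟩ := hl.nonempty_of_append
  have hGA := hl.subset G (by simp [hG])
  have hGA' := hl.subset G' (by simp)
  have hG' : G' ∉ l₁ := fun h' => (List.nodup_append.1 hl.nodup).2.2 G' h' G' (by simp) rfl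
  have hne : G ≠ G' := by
    rintro rfl
    exact hG' hG
  rw [D.crossTime_lt_iff hGA hGA' hne hlev hq (fun M hM => ne_zero_of_mem_cell hz hM)
    fun M hM h1 _ => (h M hM h1).symm.trans (mem_iff_neg_of_mem_cell hz hM)]
  have h1 := (D.crossTime_neg_iff hGA).2 ((hz G hGA).1 hG)
  have h2 := (D.crossTime_pos_iff hGA').2 ((hz G' hGA').2 hG')
  exact h2.trans h1

/-- When levels decrease weakly, every higher hyperplane of the list has been crossed before a given
level starts. So the order inside the level must be that of the crossing times at the target point.
-/
theorem pairwise_key (D : FlagData A f lev p) {l : List (Submodule ℝ V)}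
    (hl : IsGalleryList A f l) {q : V} (hq : ∀ M ∈ A, f M q ≠ 0)
    (hlq : ∀ H, H ∈ l ↔ H ∈ A ∧ f H q < 0) (hs : l.Pairwise fun G M => lev M ≤ lev G) :
    l.Pairwise fun G M => key f lev p q G < key f lev p q M := by
  rw [List.pairwise_iff_forall_sublist] at hs ⊢
  intro G M hGM
  rw [key_lt_iff]
  rcases (hs hGM).lt_or_eq with h | h
  · exact Or.inl h
  refine Or.inr ⟨h.symm, ?_⟩
  obtain ⟨s, t, rfl, hG⟩ := pair_sublist_iff.1 hGM
  refine D.crossTime_lt_of_append hl hG h.symm hq fun K hK hGK => ?_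
  rw [← and_iff_right (b := f K q < 0) hK, ← hlq, List.mem_append]
  refine (or_iff_left fun hK' => ?_).symm
  rcases List.mem_cons.1 hK' with rfl | hK'
  · omega
  · have : [M, K].Sublist (s ++ M :: t) :=
      ((List.singleton_sublist.2 hK').cons_cons M).trans (List.sublist_append_right _ _)
    have := hs this
    omega

theorem sorted_unique {l l' : List (Submodule ℝ V)} {q : V}
    (hlq : ∀ H, H ∈ l ↔ H ∈ A ∧ f H q < 0) (hlq' : ∀ H, H ∈ l' ↔ H ∈ A ∧ f H q < 0)
    (hl : l.Pairwise fun G M => key f lev p q G < key f lev p q M)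
    (hl' : l'.Pairwise fun G M => key f lev p q G < key f lev p q M) : l = l' := by
  have hnd : l.Nodup := hl.imp fun h h' => by rw [h'] at h; exact lt_irrefl _ h
  have hnd' : l'.Nodup := hl'.imp fun h h' => by rw [h'] at h; exact lt_irrefl _ h
  have hperm : l.Perm l' := (List.perm_ext_iff_of_nodup hnd hnd').2 fun H => by rw [hlq, hlq']
  exact hperm.eq_of_pairwise (fun a b _ _ h1 h2 => absurd h1 h2.not_gt) hl hl'

end FlagData

end Core

end GalleryGraph

namespace GalleryGraph

/-! ### Reversing a pencil at the first ascent of levels. -/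

section Flip

variable {V : Type*} [NormedAddCommGroup V] [NormedSpace ℝ V]

variable {A : Set (Submodule ℝ V)} {f : Submodule ℝ V → V →ₗ[ℝ] ℝ} {lev : Submodule ℝ V → ℕ}
  {p : ℕ → V}

namespace FlagData

/-- At the flag point `p (lev H)` both `f H` and `f K` vanish, hence so does `f G`; a lower level
for `G` would make it positive there. -/
theorem lev_le_of_inf_le (D : FlagData A f lev p) {G H K : Submodule ℝ V} (hG : G ∈ A)
    (hH : H ∈ A) (hK : K ∈ A) (hHK : lev H ≤ lev K) (h : H ⊓ K ≤ G) : lev H ≤ lev G := by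
  by_contra hlt
  obtain ⟨a, b, hab⟩ := D.combination hG hH hK h
  have h1 := D.pos (lev H) G hG (not_le.1 hlt)
  rw [hab] at h1
  simp [D.vanish (lev H) H hH le_rfl, D.vanish (lev H) K hK hHK] at h1

/-- Two distinct members of the pencil of level above `lev H` would express `f H` as a combination
vanishing at `p (lev H + 1)`. -/
theorem eq_of_lev_lt [FiniteDimensional ℝ V] (D : FlagData A f lev p) {G H K : Submodule ℝ V} (hG : G ∈ A)
    (hH : H ∈ A) (hK : K ∈ A) (hHK : lev H < lev K) (hHG : lev H < lev G) (h : H ⊓ K ≤ G) :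
    G = K := by
  by_contra hne
  have h1 := inf_eq_inf_of_le (D.arr.hyperplane G hG) (D.arr.hyperplane K hK)
    (D.arr.hyperplane H hH) (D.arr.hyperplane K hK) hne (by rintro rfl; omega) h inf_le_right
  obtain ⟨a, b, hab⟩ := D.combination hH hG hK (h1 ▸ inf_le_left)
  have h1 := D.pos (lev H + 1) H hH (Nat.lt_succ_self _)
  rw [hab] at h1
  simp [D.vanish _ G hG hHG, D.vanish _ K hK hHK] at h1

/-- A gallery that does not cross the hyperplanes in decreasing order of level can be modified
along a codimension two subspace `X`, whose hyperplanes it crosses consecutively, the one of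
highest level last. -/
theorem exists_flip [FiniteDimensional ℝ V] (D : FlagData A f lev p) {l : List (Submodule ℝ V)}
    (hl : IsGalleryList A f l) (hns : ¬ l.Pairwise fun G M => lev M ≤ lev G) :
    ∃ (u w v : List (Submodule ℝ V)) (H K : Submodule ℝ V),
      l = u ++ (w ++ [K]) ++ v ∧ H ∈ w ∧ IsGalleryList A f (u ++ (K :: w.reverse) ++ v) ∧
      (∀ G ∈ A, H ⊓ K ≤ G ↔ G ∈ w ∨ G = K) ∧ (∀ G ∈ w, lev G = lev H) ∧ lev H < lev K ∧
      ∀ q, f K q < 0 →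
        (K :: w.reverse).Pairwise fun G M => key f lev p q G < key f lev p q M := by
  obtain ⟨u₁, u₂, K, v, i, rfl, hu₂, hlu₁, hlu₂, hiK⟩ := exists_first_ascent lev l hns
  obtain ⟨u₂', H, hu₂'⟩ := (List.eq_nil_or_concat u₂).resolve_left hu₂
  rw [List.concat_eq_append] at hu₂'
  have hHu₂ : H ∈ u₂ := by simp [hu₂']
  have hHi : lev H = i := hlu₂ H hHu₂
  have hu₂A : ∀ G ∈ u₂, G ∈ A := fun G hG => hl.subset G (by simp [hG])
  have hHA := hu₂A H hHu₂
  have hKA : K ∈ A := hl.subset K (by simp)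
  have hco := D.arr.hyperplane
  have hnd := hl.nodup
  have hKu : K ∉ u₁ ++ u₂ := fun h => (List.nodup_append.1 hnd).2.2 K h K (by simp) rfl
  obtain ⟨x, hx⟩ := hl.nonempty_of_append
  have hl' : IsGalleryList A f ((u₁ ++ u₂ ++ [K]) ++ v) := by simpa using hl
  obtain ⟨y, hy⟩ := hl'.nonempty_of_append
  have hx0 : ∀ M ∈ A, f M x ≠ 0 := fun M hM => ne_zero_of_mem_cell hx hM
  have hy0 : ∀ M ∈ A, f M y ≠ 0 := fun M hM => ne_zero_of_mem_cell hy hM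
  have hKx : 0 < f K x := (hx K hKA).2 hKu
  have hKy : f K y < 0 := (hy K hKA).1 (by simp)
  have hxy : ∀ M ∈ A, M ≠ K → (f M x < 0 ↔ f M y < 0) := fun M hM hMK => by
    rw [← mem_iff_neg_of_mem_cell hx hM, ← mem_iff_neg_of_mem_cell hy hM]
    simp [hMK]
  -- the hyperplanes of level `i` are crossed in decreasing order of the crossing time at `x`
  have hsort : u₂.Pairwise fun G G' => crossTime f lev p G' x < crossTime f lev p G x := by
    rw [List.pairwise_iff_forall_sublist]
    intro G G' hGG'
    obtain ⟨s, t, rfl, hG⟩ := pair_sublist_iff.1 hGG'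
    have hG1 := hlu₂ G (by simp [hG])
    have hG2 := hlu₂ G' (by simp)
    refine D.crossTime_lt_of_append (l₁ := u₁ ++ s) (l₂ := t ++ K :: v) (by simpa using hl)
      (by simp [hG]) (hG1.trans hG2.symm) hx0 fun M hM hGM => ?_
    rw [← mem_iff_neg_of_mem_cell hx hM, Set.mem_ofPred_eq, ← List.append_assoc]
    rw [List.mem_append (s := u₁ ++ s)]
    refine (or_iff_left fun hM' => ?_).symm
    have := hlu₂ M (List.mem_append_right _ hM')
    omega
  have hXK : ∀ G ∈ A, lev G = i → H ⊓ K ≤ G → H ⊓ K = G ⊓ K := fun G hG hGi h =>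
    inf_eq_inf_of_le (hco G hG) (hco K hKA) (hco H hHA) (hco K hKA)
      (by rintro rfl; omega) (by rintro rfl; omega) h inf_le_right
  -- pairs inside the pencil are swapped between `x` and `y`
  have hflip : ∀ G ∈ A, ∀ G' ∈ A, lev G = i → lev G' = i → H ⊓ K ≤ G → H ⊓ K ≤ G' → G ≠ G' →
      G ⊓ G' ≤ K := fun G hG G' hG' _ _ h1 h2 hne =>
    (inf_eq_inf_of_le (hco G hG) (hco G' hG') (hco H hHA) (hco K hKA) hne
      (by rintro rfl; omega) h1 h2).symm.le.trans inf_le_right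
  -- the other pairs keep their order
  have hkeep : ∀ G ∈ A, ∀ G' ∈ A, lev G = i → lev G' = i → H ⊓ K ≤ G → ¬ H ⊓ K ≤ G' →
      ¬ G ⊓ G' ≤ K := by
    intro G hG G' hG' hGi hGi' h1 h2 h3
    have h4 := inf_eq_inf_of_le (hco G hG) (hco K hKA) (hco G hG) (hco G' hG')
      (by rintro rfl; omega) (by rintro rfl; exact h2 h1) inf_le_left h3
    exact h2 (((hXK G hG hGi h1).trans h4.symm).le.trans inf_le_right)
  have hkeep_iff : ∀ G ∈ A, ∀ G' ∈ A, lev G = i → lev G' = i → ¬ G ⊓ G' ≤ K → G ≠ G' →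
      (crossTime f lev p G' x < crossTime f lev p G x ↔
        crossTime f lev p G' y < crossTime f lev p G y) :=
    fun G hG G' hG' hGi hGi' h hne => D.crossTime_lt_iff hG hG' hne (hGi.trans hGi'.symm) hx0 hy0
      fun M hM _ h1 => hxy M hM (by rintro rfl; exact h h1)
  have hflip_iff : ∀ G ∈ A, ∀ G' ∈ A, lev G = i → lev G' = i → G ⊓ G' ≤ K →
      (crossTime f lev p G' x < crossTime f lev p G x ↔
        crossTime f lev p G y < crossTime f lev p G' y) :=
    fun G hG G' hG' hGi hGi' h => D.crossTime_lt_iff_gt hG hG' hKA (hGi.trans hGi'.symm)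
      (by omega) h hKx hKy
  have hlast : ∀ G ∈ u₂, G ≠ H → crossTime f lev p H x < crossTime f lev p G x := by
    intro G hG hne
    rw [hu₂', List.pairwise_append] at hsort
    rw [hu₂'] at hG
    rcases List.mem_append.1 hG with hG | hG
    · exact hsort.2.2 G hG H (by simp)
    · exact absurd (by simpa using hG) hne
  -- Suppose `G` is in the pencil of `H ⊓ K` and a later `G'` is not. At `x` the crossing times
  -- satisfy `G > G' > H`. Both comparisons with `G'` survive crossing `K`, whereas the comparison
  -- of `G` with `H` is reversed: a contradiction at `y`.
  have hpen : u₂.Pairwise fun G G' => H ⊓ K ≤ G → H ⊓ K ≤ G' := by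
    refine hsort.imp_of_mem fun {G G'} hG hG' hlt hXG => ?_
    by_contra hXG'
    have hG'H : G' ≠ H := by
      rintro rfl
      exact hXG' inf_le_left
    have hGG' : G ≠ G' := by
      rintro rfl
      exact hXG' hXG
    have hHlt := hlast G' hG' hG'H
    have hGH : G ≠ H := by
      rintro rfl
      exact lt_asymm hlt hHlt
    have e1 := (hkeep_iff G (hu₂A G hG) G' (hu₂A G' hG') (hlu₂ G hG) (hlu₂ G' hG')
      (hkeep G (hu₂A G hG) G' (hu₂A G' hG') (hlu₂ G hG) (hlu₂ G' hG') hXG hXG') hGG').1 hlt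
    have e2 := (hkeep_iff G' (hu₂A G' hG') H hHA (hlu₂ G' hG') hHi
      (by rw [inf_comm]; exact hkeep H hHA G' (hu₂A G' hG') hHi (hlu₂ G' hG') inf_le_left hXG')
      hG'H).1 hHlt
    have e3 := (hflip_iff G (hu₂A G hG) H hHA (hlu₂ G hG) hHi
      (hflip G (hu₂A G hG) H hHA (hlu₂ G hG) hHi hXG inf_le_left hGH)).1 (hHlt.trans hlt)
    exact lt_asymm e3 (e2.trans e1)
  obtain ⟨u₃, w, rfl, hu₃, hw⟩ := exists_suffix_of_pairwise hpen
  have hHw : H ∈ w := by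
    rcases List.mem_append.1 hHu₂ with h | h
    · exact absurd inf_le_left (hu₃ H h)
    · exact h
  have hwA : ∀ G ∈ w, G ∈ A := fun G hG => hu₂A G (by simp [hG])
  have hwi : ∀ G ∈ w, lev G = i := fun G hG => hlu₂ G (by simp [hG])
  -- No member of the pencil can be missing. A missing `G` of level `i` would be uncrossed at both
  -- `x` and `y`, so its crossing time would be below that of `H` at both, although crossing `K`
  -- reverses the two.
  have hAX : ∀ G ∈ A, H ⊓ K ≤ G ↔ G ∈ w ∨ G = K := by
    intro G hG
    refine ⟨fun hXG => ?_, ?_⟩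
    · rcases (D.lev_le_of_inf_le hG hHA hKA (by omega) hXG).lt_or_eq with h | h
      · exact Or.inr (D.eq_of_lev_lt hG hHA hKA (by omega) h hXG)
      left
      have hGi : lev G = i := by omega
      by_contra hGw
      have hGu : G ∉ u₁ ++ (u₃ ++ w) := by
        simp only [List.mem_append, hGw, or_false, not_or]
        exact ⟨fun h => by have := hlu₁ G h; omega, fun h => hu₃ G h hXG⟩
      have hGK : G ≠ K := by
        rintro rfl
        omega
      have hGH : H ≠ G := by
        rintro rfl
        exact hGw hHw
      have a1 : crossTime f lev p G x < crossTime f lev p H x :=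
        ((D.crossTime_pos_iff hG).2 ((hx G hG).2 hGu)).trans
          ((D.crossTime_neg_iff hHA).2 ((hx H hHA).1 (by simp [hHw])))
      have a2 : crossTime f lev p G y < crossTime f lev p H y :=
        ((D.crossTime_pos_iff hG).2 ((hy G hG).2 (by
          rw [Set.mem_ofPred_eq, List.mem_append]; simpa [hGK] using hGu))).trans
          ((D.crossTime_neg_iff hHA).2 ((hy H hHA).1 (by simp [hHw])))
      exact lt_asymm a2 ((hflip_iff H hHA G hG hHi hGi
        (hflip H hHA G hG hHi hGi inf_le_left hXG hGH)).1 a1)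
    · rintro (h | rfl)
      · exact hw G h
      · exact inf_le_right
  rw [List.pairwise_append] at hsort
  have hrev : ∀ q, f K q < 0 →
      w.reverse.Pairwise fun G G' => crossTime f lev p G' q < crossTime f lev p G q := by
    intro q hKq
    rw [List.pairwise_reverse]
    refine hsort.2.1.imp_of_mem fun {G G'} hG hG' h => ?_
    have hne : G ≠ G' := by
      rintro rfl
      exact lt_irrefl _ h
    exact (D.crossTime_lt_iff_gt (hwA G hG) (hwA G' hG') hKA ((hwi G hG).trans (hwi G' hG').symm)
      (by rw [hwi G hG]; exact hiK) (hflip G (hwA G hG) G' (hwA G' hG') (hwi G hG) (hwi G' hG')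
        (hw G hG) (hw G' hG') hne) hKx hKq).1 h
  have hu₃w : ∀ G ∈ u₃, ∀ G' ∈ w, crossTime f lev p G' y < crossTime f lev p G y := by
    intro G hG G' hG'
    have hGA := hu₂A G (by simp [hG])
    have hGi := hlu₂ G (by simp [hG])
    refine (hkeep_iff G hGA G' (hwA G' hG') hGi (hwi G' hG') ?_ ?_).1
      (hsort.2.2 G hG G' hG')
    · rw [inf_comm]
      exact hkeep G' (hwA G' hG') G hGA (hwi G' hG') hGi (hw G' hG') (hu₃ G hG)
    · rintro rfl
      exact hu₃ G hG (hw G hG')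
  have hKrev : ∀ q, f K q < 0 →
      (K :: w.reverse).Pairwise fun G M => key f lev p q G < key f lev p q M := by
    intro q hKq
    rw [List.pairwise_cons]
    refine ⟨fun G hG => key_lt_iff.2 (Or.inl ?_), (hrev q hKq).imp_of_mem fun {G G'} hG hG' h =>
      key_lt_iff.2 (Or.inr ⟨?_, h⟩)⟩
    · rw [hwi G (by simpa using hG)]
      exact hiK
    · rw [hwi G (by simpa using hG), hwi G' (by simpa using hG')]
  refine ⟨u₁ ++ u₃, w, v, H, K, by simp, hHw, ⟨?_, ?_, ?_⟩, hAX,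
    fun G hG => (hwi G hG).trans hHi.symm, by omega, hKrev⟩
  · refine (List.Perm.nodup_iff ?_).1 hnd
    have : (w ++ [K]).Perm (K :: w.reverse) :=
      (List.perm_append_comm).trans ((List.reverse_perm w).symm.cons K)
    have := (this.append_left (u₁ ++ u₃)).append_right v
    simpa using this
  · intro G hG
    refine hl.subset G ?_
    simp only [List.mem_append, List.mem_cons, List.mem_reverse] at hG ⊢
    tauto
  · intro k
    rw [List.take_append, List.take_append]
    rcases le_or_gt k (u₁ ++ u₃).length with hk | hk
    · have h0 : k - (u₁ ++ u₃).length = 0 := by omega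
      have h1 : k - (u₁ ++ u₃ ++ K :: w.reverse).length = 0 := by
        rw [List.length_append]; omega
      rw [h0, h1]
      have := hl.nonempty k
      rw [show u₁ ++ (u₃ ++ w) ++ K :: v = (u₁ ++ u₃) ++ (w ++ K :: v) by simp,
        List.take_append, h0] at this
      simpa using this
    · obtain ⟨j, hj⟩ := Nat.exists_eq_add_of_lt hk
      have h0 : k - (u₁ ++ u₃).length = j + 1 := by omega
      rw [List.take_of_length_le hk.le, h0, List.take_succ_cons]
      rcases lt_or_ge j w.length with hjw | hjw
      · have h1 : k - (u₁ ++ u₃ ++ K :: w.reverse).length = 0 := by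
          simp only [List.length_append, List.length_cons, List.length_reverse] at hj ⊢; omega
        rw [h1, List.take_zero, List.append_nil]
        have hjr : j < w.reverse.length := by simpa using hjw
        have hsplit : w.reverse = w.reverse.take j ++ w.reverse[j] :: w.reverse.drop (j + 1) := by
          rw [List.getElem_cons_drop, List.take_append_drop]
        set M := w.reverse[j]
        set a := w.reverse.take j
        set b := w.reverse.drop (j + 1)
        have hMw : M ∈ w := List.mem_reverse.1 (List.getElem_mem hjr)
        have hmw : ∀ G, G ∈ w ↔ G ∈ a ∨ G = M ∨ G ∈ b := fun G => by
          rw [← List.mem_reverse, hsplit]; simp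
        have hr := hrev y hKy
        rw [hsplit, List.pairwise_append, List.pairwise_cons] at hr
        -- The new intermediate prefixes are nonempty cells because each is the set of hyperplanes
        -- negative at `y` that precede `M` in the `key` order of `y`.
        convert D.exists_point hy0 (hwA M hMw) ((hy M (hwA M hMw)).1 (by simp [hMw])) using 1
        refine cell_congr fun G hG => ?_
        simp only [Set.mem_ofPred_eq]
        rw [← mem_iff_neg_of_mem_cell hy hG, key_lt_iff, hwi M hMw]
        simp only [List.mem_append, List.mem_cons, Set.mem_ofPred_eq, List.not_mem_nil, or_false,
          hmw G]
        constructor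
        · rintro ((h | h) | rfl | h)
          · exact ⟨by tauto, Or.inl (hlu₁ G h)⟩
          · exact ⟨by tauto, Or.inr ⟨hlu₂ G (by simp [h]), hu₃w G h M hMw⟩⟩
          · exact ⟨by tauto, Or.inl hiK⟩
          · exact ⟨by tauto, Or.inr ⟨hwi G ((hmw G).2 (Or.inl h)), hr.2.2 G h M (by simp)⟩⟩
        · rintro ⟨(h | h | h | h | h) | rfl, h'⟩
          · tauto
          · tauto
          · tauto
          · rcases h' with h' | h'
            · rw [h, hwi M hMw] at h'
              omega
            · exact absurd (h ▸ h'.2) (lt_irrefl _)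
          · rcases h' with h' | h'
            · rw [hwi G ((hmw G).2 (by tauto))] at h'
              omega
            · exact absurd h'.2 (hr.2.1.1 G h).not_gt
          · tauto
      -- Once the whole pencil is crossed, the old and new prefixes contain the same hyperplanes.
      · have := hl.nonempty k
        rw [show u₁ ++ (u₃ ++ w) ++ K :: v = (u₁ ++ u₃) ++ (w ++ [K]) ++ v by simp,
          List.take_append, List.take_append, h0, List.take_of_length_le hk.le,
          List.take_of_length_le (l := w ++ [K]) (by simpa using hjw)] at this
        rw [List.take_of_length_le (by simpa using hjw)]
        convert this using 1
        refine cell_congr fun G _ => ?_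
        simp only [List.mem_append, List.mem_cons, List.mem_reverse, Set.mem_ofPred_eq,
          List.length_append, List.length_cons, List.length_reverse, List.not_mem_nil, or_false,
          List.length_nil]
        tauto

end FlagData

end Flip

end GalleryGraph

namespace GalleryGraph

/-! ### Distance bounds from separating sets; walks from sequences. -/

section GraphBounds

/-- Distance bounds in a graph whose vertices are separated by sets, given a vertex `r₀` towards
which one can always move while shrinking the separating set. -/
theorem edist_bounds {α β : Type*} (G : SimpleGraph α) (s : α → α → Set β) (S : Set β)
    (hS : S.Finite) (hsub : ∀ r r', s r r' ⊆ S) (hself : ∀ r, s r r = ∅)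
    (htri : ∀ r r' r'', s r r'' ⊆ s r r' ∪ s r' r'')
    (hadj : ∀ r r', G.Adj r r' → (s r r').encard ≤ 1) (r₀ : α)
    (hacc : ∀ r, r ≠ r₀ → ∃ r', G.Adj r r' ∧ s r₀ r' ⊂ s r₀ r) :
    (∀ r r', (s r r').encard ≤ G.edist r r' ∧
      G.edist r r' ≤ (s r₀ r).encard + (s r₀ r').encard ∧
      (s r₀ r).encard + (s r₀ r').encard ≤ 2 * S.encard) ∧ G.ediam ≤ 2 * S.encard := by
  -- Lower bound: each edge contributes at most one element to the separating set.
  have h1 : ∀ r r', ∀ w : G.Walk r r', (s r r').encard ≤ w.length := by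
    intro r r' w
    induction w with
    | nil => simp [hself]
    | @cons a b c h w ih =>
      refine (Set.encard_le_encard (htri a b c)).trans ((Set.encard_union_le _ _).trans ?_)
      rw [SimpleGraph.Walk.length_cons, add_comm]
      push_cast
      exact add_le_add ih (hadj _ _ h)
  -- Upper bound: a move towards `r₀` costs one edge and removes at least one element. The induction
  -- runs over a natural number bounding the cardinality.
  have h2 : ∀ n : ℕ, ∀ r, (s r₀ r).encard ≤ n → G.edist r₀ r ≤ (s r₀ r).encard := by
    intro n
    induction n with
    | zero =>
      intro r hr
      by_cases h : r = r₀
      · simp [h]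
      obtain ⟨r', -, h'⟩ := hacc r h
      have := Set.encard_eq_zero.1 (nonpos_iff_eq_zero.1 (by simpa using hr))
      exact absurd (Set.subset_empty_iff.1 (this ▸ h'.1)) fun h'' =>
        h'.2 (by rw [this]; exact Set.empty_subset _)
    | succ n ih =>
      intro r hr
      by_cases h : r = r₀
      · simp [h]
      obtain ⟨r', h3, h4⟩ := hacc r h
      have hlt : (s r₀ r').encard < (s r₀ r).encard :=
        (hS.subset (hsub _ _)).encard_lt_encard h4
      have hle : (s r₀ r').encard + 1 ≤ (s r₀ r).encard := Order.add_one_le_of_lt hlt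
      have hr' : (s r₀ r').encard ≤ n := by
        have := hle.trans hr
        push_cast at this
        exact (ENat.add_le_add_iff_right (by simp)).1 this
      calc G.edist r₀ r ≤ G.edist r₀ r' + G.edist r' r := G.edist_triangle
        _ ≤ (s r₀ r').encard + 1 :=
          add_le_add (ih r' hr') (SimpleGraph.edist_eq_one_iff_adj.2 h3.symm).le
        _ ≤ _ := hle
  have h3 : ∀ r, G.edist r₀ r ≤ (s r₀ r).encard := fun r =>
    h2 (s r₀ r).ncard r (by rw [(hS.subset (hsub _ _)).cast_ncard_eq])
  have h4 : ∀ r r', G.edist r r' ≤ (s r₀ r).encard + (s r₀ r').encard := fun r r' => by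
    refine G.edist_triangle.trans (add_le_add ?_ (h3 r'))
    rw [SimpleGraph.edist_comm]
    exact h3 r
  have h5 : ∀ r r', (s r₀ r).encard + (s r₀ r').encard ≤ 2 * S.encard := fun r r' => by
    rw [two_mul]
    exact add_le_add (Set.encard_le_encard (hsub _ _)) (Set.encard_le_encard (hsub _ _))
  exact ⟨fun r r' => ⟨le_iInf fun w => h1 r r' w, h4 r r', h5 r r'⟩,
    SimpleGraph.ediam_le_of_edist_le fun r r' => (h4 r r').trans (h5 r r')⟩

theorem exists_walk_of_adj {α : Type*} {G : SimpleGraph α} (n : ℕ) (g : ℕ → α)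
    (hg : ∀ k < n, G.Adj (g k) (g (k + 1))) {a b : α} (ha : g 0 = a) (hb : g n = b) :
    ∃ w : G.Walk a b, w.length = n ∧ ∀ k, w.getVert k = g (min k n) := by
  induction n generalizing g a with
  | zero =>
    subst ha hb
    exact ⟨.nil, rfl, by simp⟩
  | succ n ih =>
    obtain ⟨w, hw, hk⟩ := ih (fun k => g (k + 1)) (fun k hk => hg (k + 1) (by omega)) rfl hb
    subst ha
    refine ⟨.cons (hg 0 (by omega)) w, by simp [hw], fun k => ?_⟩
    cases k with
    | zero => simp
    | succ k => simp [hk, Nat.succ_min_succ]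

end GraphBounds

/-! ### Crossing orders and separating sets in terms of lists. -/

section ListSep

variable {V : Type*} [NormedAddCommGroup V] [NormedSpace ℝ V]

variable {A : Set (Submodule ℝ V)} {f : Submodule ℝ V → V →ₗ[ℝ] ℝ}

/-- The sequence of chambers `γ` crosses the hyperplanes in the list `l`, in this order. -/
def Traces (A : Set (Submodule ℝ V)) (f : Submodule ℝ V → V →ₗ[ℝ] ℝ) (l : List (Submodule ℝ V))
    (γ : ℕ → Set V) : Prop :=
  ∀ k, γ k = cell A f {H | H ∈ l.take k}

theorem mem_sep₁_iff_getElem (hf : ∀ H ∈ A, LinearMap.ker (f H) = H) {l : List (Submodule ℝ V)}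
    (hl : IsGalleryList A f l) {γ : ℕ → Set V} (hγ : Traces A f l γ) {H : Submodule ℝ V} {i : ℕ} :
    H ∈ sep₁ A (γ i) (γ (i + 1)) ↔ ∃ h : i < l.length, l[i] = H := by
  rw [hγ i, hγ (i + 1), sep₁_cell hf (hl.nonempty _) (hl.nonempty _)]
  simp only [Set.mem_ofPred_eq]
  by_cases h : i < l.length
  · have hsplit : l = l.take i ++ l[i] :: l.drop (i + 1) := by simp
    have hni : l[i] ∉ l.take i := fun h' => by
      have := hl.nodup
      rw [hsplit] at this
      exact (List.nodup_append.1 this).2.2 _ h' _ List.mem_cons_self rfl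
    rw [List.take_succ_eq_append_getElem h]
    simp only [List.mem_append, List.mem_singleton, h, exists_true_left]
    constructor
    · rintro ⟨-, h1⟩
      by_contra h2
      exact h1 ⟨fun h3 => Or.inl h3, fun h3 => h3.resolve_right fun h4 => h2 h4.symm⟩
    · rintro rfl
      exact ⟨hl.subset _ (List.getElem_mem h), fun h1 => hni (h1.2 (Or.inr rfl))⟩
  · rw [List.take_of_length_le (not_lt.1 h), List.take_of_length_le (by omega)]
    simp [h]

theorem crossesBefore_iff (hf : ∀ H ∈ A, LinearMap.ker (f H) = H) {l : List (Submodule ℝ V)}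
    (hl : IsGalleryList A f l) {γ : ℕ → Set V} (hγ : Traces A f l γ) {H K : Submodule ℝ V} :
    CrossesBefore A γ H K ↔ [H, K].Sublist l := by
  simp only [CrossesBefore, mem_sep₁_iff_getElem hf hl hγ]
  rw [pair_sublist_iff]
  constructor
  · rintro ⟨i, j, hij, ⟨hi, rfl⟩, ⟨hj, rfl⟩⟩
    refine ⟨l.take j, l.drop (j + 1), by simp, ?_⟩
    rw [List.mem_take_iff_getElem]
    exact ⟨i, by omega, rfl⟩
  · rintro ⟨s, t, rfl, hH⟩
    obtain ⟨i, hi, rfl⟩ := List.getElem_of_mem hH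
    exact ⟨i, s.length, hi, ⟨by simp; omega, by simp [List.getElem_append_left, hi]⟩,
      ⟨by simp, by simp⟩⟩

/-- `L_2` for galleries given as lists of crossed hyperplanes. -/
def listSep (A : Set (Submodule ℝ V)) (c c' : Set V) (l l' : List (Submodule ℝ V)) :
    Set (Submodule ℝ V) :=
  {X ∈ sep₂ A c c' | ¬ ∀ H ∈ A, ∀ K ∈ A, X ≤ H → X ≤ K →
    ([H, K].Sublist l ↔ [H, K].Sublist l')}

theorem pathSep_eq_listSep (hf : ∀ H ∈ A, LinearMap.ker (f H) = H) {c c' : Set V}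
    {l l' : List (Submodule ℝ V)} (hl : IsGalleryList A f l) (hl' : IsGalleryList A f l')
    {γ γ' : ℕ → Set V} (hγ : Traces A f l γ) (hγ' : Traces A f l' γ') :
    pathSep A c c' γ γ' = listSep A c c' l l' := by
  simp only [pathSep, listSep, crossesBefore_iff hf hl hγ, crossesBefore_iff hf hl' hγ']

theorem pathSep_triangle {c c' : Set V} (γ γ' γ'' : ℕ → Set V) :
    pathSep A c c' γ γ'' ⊆ pathSep A c c' γ γ' ∪ pathSep A c c' γ' γ'' := by
  rintro X ⟨h1, h2⟩
  by_contra h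
  simp only [Set.mem_union, not_or] at h
  refine h2 fun H hH K hK hXH hXK => ?_
  have h3 := not_not.1 fun h' => h.1 ⟨h1, h'⟩
  have h4 := not_not.1 fun h' => h.2 ⟨h1, h'⟩
  exact (h3 H hH K hK hXH hXK).trans (h4 H hH K hK hXH hXK)

theorem listSep_triangle {c c' : Set V} (l l' l'' : List (Submodule ℝ V)) :
    listSep A c c' l l'' ⊆ listSep A c c' l l' ∪ listSep A c c' l' l'' := by
  rintro X ⟨h1, h2⟩
  by_contra h
  simp only [Set.mem_union, not_or] at h
  refine h2 fun H hH K hK hXH hXK => ?_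
  have h3 := not_not.1 fun h' => h.1 ⟨h1, h'⟩
  have h4 := not_not.1 fun h' => h.2 ⟨h1, h'⟩
  exact (h3 H hH K hK hXH hXK).trans (h4 H hH K hK hXH hXK)

theorem not_pair_self_sublist {α : Type*} {l : List α} (hl : l.Nodup) (a : α) :
    ¬ [a, a].Sublist l := fun h => by
  simpa using h.nodup hl

/-- Rearranging a factor consisting of hyperplanes through `X` changes the crossing order at most
along `X`. -/
theorem listSep_subset_singleton [FiniteDimensional ℝ V] (hA : IsArrangement A) {c c' : Set V}
    {u x x' v : List (Submodule ℝ V)} {X : Submodule ℝ V}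
    (hX : Module.finrank ℝ X + 2 = Module.finrank ℝ V) (hx : ∀ G ∈ x, X ≤ G)
    (hxx' : ∀ G, G ∈ x ↔ G ∈ x') (hl : (u ++ x ++ v).Nodup) (hl' : (u ++ x' ++ v).Nodup) :
    listSep A c c' (u ++ x ++ v) (u ++ x' ++ v) ⊆ {X} := by
  rintro Y ⟨hY, h⟩
  push Not at h
  obtain ⟨H, hH, K, hK, hYH, hYK, h⟩ := h
  have hne : H ≠ K := by
    rintro rfl
    have h1 := not_pair_self_sublist hl H
    have h2 := not_pair_self_sublist hl' H
    tauto
  have hHK : H ∈ x ∧ K ∈ x := by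
    by_contra h'
    have := pair_sublist_congr (u := u) (v := v) hxx' h'
    tauto
  have h1 := inf_eq_of_finrank (hA.hyperplane H hH) (hA.hyperplane K hK) hne hX
    (hx H hHK.1) (hx K hHK.2)
  have h2 := inf_eq_of_finrank (hA.hyperplane H hH) (hA.hyperplane K hK) hne hY.1.2 hYH hYK
  exact h2.trans h1.symm

theorem sep₂_finite (hA : IsArrangement A) (c c' : Set V) : (sep₂ A c c').Finite := by
  refine (hA.finite.finite_subsets.image sInf).subset ?_
  rintro X ⟨⟨⟨S, hS, rfl⟩, -⟩, -⟩
  exact ⟨S, hS, rfl⟩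

/-- Rearranging the factor affects only orders along `H ⊓ K`. Before the move, `H` precedes `K`,
contrary to `l₀`. Afterwards the pencil is sorted by the same key as `l₀`, so the two agree along
it. Thus exactly this one subspace leaves the separating set. -/
theorem listSep_flip [FiniteDimensional ℝ V] {lev : Submodule ℝ V → ℕ} {p : ℕ → V}
    (D : FlagData A f lev p) {q : V}
    {l₀ u w v : List (Submodule ℝ V)} {H K : Submodule ℝ V} {c c' : Set V}
    (hc : ∀ G, G ∈ sep₁ A c c' ↔ G ∈ A ∧ f G q < 0)
    (hl₀ : l₀.Pairwise fun G M => FlagData.key f lev p q G < FlagData.key f lev p q M)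
    (hl₀q : ∀ G, G ∈ l₀ ↔ G ∈ A ∧ f G q < 0)
    (hlq : ∀ G, G ∈ u ++ (w ++ [K]) ++ v ↔ G ∈ A ∧ f G q < 0) (hH : H ∈ w)
    (hl : IsGalleryList A f (u ++ (w ++ [K]) ++ v))
    (hl' : IsGalleryList A f (u ++ (K :: w.reverse) ++ v))
    (hX : ∀ G ∈ A, H ⊓ K ≤ G ↔ G ∈ w ∨ G = K) (hlev : lev H < lev K)
    (hKw : (K :: w.reverse).Pairwise fun G M =>
      FlagData.key f lev p q G < FlagData.key f lev p q M) :
    listSep A c c' (u ++ (w ++ [K]) ++ v) (u ++ (K :: w.reverse) ++ v) = {H ⊓ K} ∧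
    listSep A c c' l₀ (u ++ (K :: w.reverse) ++ v) ⊂
      listSep A c c' l₀ (u ++ (w ++ [K]) ++ v) := by
  have hHA : H ∈ A := hl.subset H (by simp [hH])
  have hKA : K ∈ A := hl.subset K (by simp)
  have hHK : H ≠ K := by rintro rfl; omega
  have hrank := finrank_inf_add_two (D.arr.hyperplane H hHA) (D.arr.hyperplane K hKA) hHK
  have hsub : listSep A c c' (u ++ (w ++ [K]) ++ v) (u ++ (K :: w.reverse) ++ v) ⊆ {H ⊓ K} := by
    refine listSep_subset_singleton D.arr hrank (fun G hG => ?_) (fun G => ?_) hl.nodup hl'.nodup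
    · refine (hX G (hl.subset G (by simp at hG; simp; tauto))).2 (by simpa using hG)
    · simp [or_comm]
  have hXsep : H ⊓ K ∈ sep₂ A c c' := by
    refine ⟨⟨⟨{H, K}, ?_, by simp⟩, hrank⟩, fun G hG hXG => ?_⟩
    · rintro G (rfl | rfl)
      · exact hHA
      · exact hKA
    · rw [hc, ← hlq]
      rcases (hX G hG).1 hXG with h | rfl
      · simp [h]
      · simp
  have hlt : ∀ {G M : Submodule ℝ V}, [G, M].Sublist l₀ →
      FlagData.key f lev p q G < FlagData.key f lev p q M :=
    fun h => List.pairwise_iff_forall_sublist.1 hl₀ h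
  have hlt' : ∀ {G M : Submodule ℝ V}, [G, M].Sublist (K :: w.reverse) →
      FlagData.key f lev p q G < FlagData.key f lev p q M :=
    fun h => List.pairwise_iff_forall_sublist.1 hKw h
  have hnd₀ : l₀.Nodup := hl₀.imp fun h h' => by rw [h'] at h; exact lt_irrefl _ h
  have hsl : (K :: w.reverse).Sublist (u ++ (K :: w.reverse) ++ v) :=
    (List.sublist_append_right u _).trans (List.sublist_append_left _ v)
  have hmem₀ : ∀ G ∈ w ++ [K], G ∈ l₀ := fun G hG => by
    rw [hl₀q, ← hlq, List.mem_append, List.mem_append]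
    exact Or.inl (Or.inr hG)
  have hnot : ¬ [H, K].Sublist l₀ := fun h => by
    have h1 := hlt h
    rw [FlagData.key_lt_iff] at h1
    omega
  have h1 : H ⊓ K ∈ listSep A c c' l₀ (u ++ (w ++ [K]) ++ v) := by
    refine ⟨hXsep, fun h => hnot ((h H hHA K hKA inf_le_left inf_le_right).2 ?_)⟩
    have : [H, K].Sublist (w ++ [K]) := pair_sublist_append.2 (Or.inr (Or.inr ⟨hH, by simp⟩))
    exact this.trans ((List.sublist_append_right u _).trans (List.sublist_append_left _ v))
  have h2 : H ⊓ K ∉ listSep A c c' l₀ (u ++ (K :: w.reverse) ++ v) := by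
    rintro ⟨-, h⟩
    refine h fun G hG M hM hXG hXM => ?_
    have hG' : G ∈ K :: w.reverse := by simpa [or_comm] using (hX G hG).1 hXG
    have hM' : M ∈ K :: w.reverse := by simpa [or_comm] using (hX M hM).1 hXM
    by_cases hGM : G = M
    · subst hGM
      simp only [not_pair_self_sublist hnd₀, not_pair_self_sublist hl'.nodup]
    constructor
    · intro h1
      rcases pair_sublist_total hG' hM' hGM with h2 | h2
      · exact h2.trans hsl
      · exact absurd (hlt h1) (hlt' h2).not_gt
    · intro h1
      have hG₀ := hmem₀ G (by simpa [or_comm] using hG')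
      have hM₀ := hmem₀ M (by simpa [or_comm] using hM')
      rcases pair_sublist_total hG₀ hM₀ hGM with h2 | h2
      · exact h2
      · rcases pair_sublist_total hG' hM' hGM with h3 | h3
        · exact absurd (hlt h2) (hlt' h3).not_gt
        · exact absurd (h3.trans hsl) (pair_sublist_asymm hl'.nodup h1)
  constructor
  · refine hsub.antisymm ?_
    rintro _ rfl
    rcases listSep_triangle _ (u ++ (K :: w.reverse) ++ v) _ h1 with h3 | h3
    · exact absurd h3 h2
    · obtain ⟨h4, h5⟩ := h3
      exact ⟨h4, fun h6 => h5 fun G hG M hM a b => (h6 G hG M hM a b).symm⟩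
  · refine ⟨fun Y hY => ?_, fun h => h2 (h h1)⟩
    rcases listSep_triangle _ (u ++ (w ++ [K]) ++ v) _ hY with h3 | h3
    · exact h3
    · have := hsub h3
      rw [Set.mem_singleton_iff] at this
      exact absurd (this ▸ hY) h2

end ListSep

end GalleryGraph

namespace GalleryGraph

/-! ### From a modular flag to levels and points. -/

section FlagToData

variable {V : Type*} [NormedAddCommGroup V] [NormedSpace ℝ V] [FiniteDimensional ℝ V]

variable {A : Set (Submodule ℝ V)} {f : Submodule ℝ V → V →ₗ[ℝ] ℝ}

theorem nonneg_of_mem_closure {v : V} (hv : v ∈ closure (cell A f ∅)) {H : Submodule ℝ V}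
    (hH : H ∈ A) : 0 ≤ f H v := by
  have hcl : IsClosed {x | 0 ≤ f H x} :=
    isClosed_le continuous_const (f H).continuous_of_finiteDimensional
  exact closure_minimal (fun x hx => ((hx H hH).2 (by simp)).le) hcl hv

theorem Incident.span_eq {c : Set V} {X : Submodule ℝ V} (h : Incident c X) :
    Submodule.span ℝ (closure c ∩ (X : Set V)) = X :=
  Submodule.eq_of_le_of_finrank_eq (Submodule.span_le.2 Set.inter_subset_right) h

/-- A subspace incident to the base chamber contains a point of the closed base chamber which is
strictly on the positive side of all hyperplanes not containing the subspace. -/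
theorem Incident.exists_point (hA : IsArrangement A) (hf : ∀ H ∈ A, LinearMap.ker (f H) = H)
    {X : Submodule ℝ V} (h : Incident (cell A f ∅) X) :
    ∃ v ∈ X, ∀ H ∈ A, (X ≤ H → f H v = 0) ∧ (¬ X ≤ H → 0 < f H v) := by
  have key : ∀ H, ∃ v ∈ X, (∀ G ∈ A, 0 ≤ f G v) ∧ (H ∈ A → ¬ X ≤ H → 0 < f H v) := by
    intro H
    by_cases hH : H ∈ A ∧ ¬ X ≤ H
    · obtain ⟨hHA, hXH⟩ := hH
      -- Without a positive value, `f H` would vanish on all of `closure (cell A f ∅) ∩ X`, hence on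
      -- its span, which is `X`.
      by_contra hcon
      push Not at hcon
      refine hXH ?_
      rw [← h.span_eq, Submodule.span_le]
      rintro v ⟨hv, hvX⟩
      have h1 := (hcon v hvX fun G hG => nonneg_of_mem_closure hv hG).2.2
      have h2 := le_antisymm h1 (nonneg_of_mem_closure hv hHA)
      rw [← hf H hHA]
      exact h2
    · exact ⟨0, X.zero_mem, by simp, fun h1 h2 => absurd ⟨h1, h2⟩ hH⟩
  choose v hvX hv0 hv using key
  -- Summing the witnesses for the single hyperplanes makes all required values positive at once, as
  -- no summand is negative on any functional.
  refine ⟨∑ H ∈ hA.finite.toFinset, v H, X.sum_mem fun H _ => hvX H, fun H hH => ⟨fun h => ?_,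
    fun h => ?_⟩⟩
  · have : ∑ H ∈ hA.finite.toFinset, v H ∈ LinearMap.ker (f H) := by
      rw [hf H hH]
      exact h (X.sum_mem fun H _ => hvX H)
    exact this
  · rw [map_sum]
    exact Finset.sum_pos' (fun G _ => hv0 G H hH) ⟨H, by simpa using hH, hv H hH h⟩

/-- The modularity condition of `FlagData` is that of the localization at the flag member of index
`lev H`, pulled back along the quotient map. -/
theorem exists_flagData (hA : IsArrangement A) (hf : ∀ H ∈ A, LinearMap.ker (f H) = H)
    {F : Fin (Module.finrank ℝ V + 1) → Submodule ℝ V} (hF : IsModularFlag A F)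
    (hinc : ∀ i, Incident (cell A f ∅) (F i)) :
    ∃ (lev : Submodule ℝ V → ℕ) (p : ℕ → V), FlagData A f lev p ∧
      (∀ i, ∀ H ∈ A, F i ≤ H ↔ (i : ℕ) ≤ lev H) ∧ ∀ H ∈ A, lev H < Module.finrank ℝ V := by
  classical
  -- Beyond the dimension the flag is continued by the whole space, so that points `p k` exist for
  -- every natural number `k`.
  let F' : ℕ → Submodule ℝ V := fun k => F ⟨min k (Module.finrank ℝ V), by omega⟩
  have hF' : ∀ i : Fin (Module.finrank ℝ V + 1), F i = F' i := fun i => by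
    simp only [F']
    congr
    exact Fin.ext (min_eq_left (Nat.lt_succ_iff.1 i.2)).symm
  have hmono : Monotone F' := fun a b hab => hF.mono (by
    rw [Fin.mk_le_mk]
    exact min_le_min_right _ hab)
  have htop : F' (Module.finrank ℝ V) = ⊤ := by
    apply Submodule.eq_top_of_finrank_eq
    simp only [F', hF.dim]
    simp
  have hbot : F' 0 = ⊥ := by
    apply Submodule.finrank_eq_zero.1
    simp only [F', hF.dim]
    simp
  let lev : Submodule ℝ V → ℕ := fun H => Nat.findGreatest (fun k => F' k ≤ H) (Module.finrank ℝ V)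
  have hlev : ∀ k, ∀ H ∈ A, F' k ≤ H ↔ k ≤ lev H := by
    intro k H hH
    constructor
    · intro h
      refine Nat.le_findGreatest ?_ h
      by_contra hk
      have := htop ▸ (hmono (not_le.1 hk).le).trans h
      exact (hA.hyperplane H hH).1 (top_le_iff.1 this)
    · intro h
      have : F' (lev H) ≤ H :=
        Nat.findGreatest_spec (P := fun k => F' k ≤ H) (Nat.zero_le _) (hbot ▸ bot_le)
      exact (hmono h).trans this
  have hlt : ∀ H ∈ A, lev H < Module.finrank ℝ V := by
    intro H hH
    by_contra h
    have := (hlev (Module.finrank ℝ V) H hH).2 (not_lt.1 h)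
    rw [htop] at this
    exact (hA.hyperplane H hH).1 (top_le_iff.1 this)
  have hp : ∀ k, ∃ v ∈ F' k, ∀ H ∈ A, (F' k ≤ H → f H v = 0) ∧ (¬ F' k ≤ H → 0 < f H v) :=
    fun k => (hinc _).exists_point hA hf
  choose p _ hp using hp
  refine ⟨lev, p, ⟨hA, hf, fun k H hH h => (hp k H hH).1 ((hlev k H hH).2 h),
    fun k H hH h => (hp k H hH).2 fun h' => by rw [hlev k H hH] at h'; omega, ?_⟩,
    fun i H hH => by rw [hF', hlev _ H hH], hlt⟩
  intro H hH H' hH' hne hHH'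
  have hi : lev H < Module.finrank ℝ V := hlt H hH
  have hmod := (hF.modular ⟨lev H, hi⟩).modular
  have e1 : F (Fin.castSucc ⟨lev H, hi⟩) = F' (lev H) := hF' _
  have e2 : F (Fin.succ ⟨lev H, hi⟩) = F' (lev H + 1) := hF' _
  rw [e1, e2] at hmod
  have hFH : F' (lev H) ≤ H := (hlev _ H hH).2 le_rfl
  have hFH' : F' (lev H) ≤ H' := (hlev _ H' hH').2 hHH'.le
  have hcm : ∀ K : Submodule ℝ V, F' (lev H) ≤ K →
      (K.map (F' (lev H)).mkQ).comap (F' (lev H)).mkQ = K := fun K hK => by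
    rw [Submodule.comap_map_mkQ, sup_eq_right.2 hK]
  have hle : ∀ K L : Submodule ℝ V, F' (lev H) ≤ K →
      (L.map (F' (lev H)).mkQ ≤ K.map (F' (lev H)).mkQ ↔ L ≤ K) := fun K L hK => by
    rw [Submodule.map_le_iff_le_comap, hcm K hK]
  obtain ⟨M', ⟨M, hM, hFM, rfl⟩, h1, h2⟩ := hmod (H.map (F' (lev H)).mkQ) ⟨H, hH, hFH, rfl⟩
    (H'.map (F' (lev H)).mkQ) ⟨H', hH', hFH', rfl⟩
    (fun h => hne (by rw [← hcm H hFH, h, hcm H' hFH']))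
    (by rw [hle _ _ hFH, hlev _ H hH]; omega) (by rw [hle _ _ hFH', hlev _ H' hH']; omega)
  refine ⟨M, hM, ?_, ?_⟩
  · rw [hle _ _ hFM, hlev _ M hM] at h1
    omega
  · have := Submodule.comap_mono (f := (F' (lev H)).mkQ) h2
    rwa [Submodule.comap_inf, hcm H hFH, hcm H' hFH', hcm M hFM] at this

end FlagToData

/-! ### Minimal galleries and gallery lists. -/

section GalleryLists

theorem MinGallery.ext_seq {V : Type*} [NormedAddCommGroup V] [NormedSpace ℝ V]
    {A : Set (Submodule ℝ V)} {c₀ c : Chamber A} {r r' : MinGallery A c₀ c} (h : r.seq = r'.seq) :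
    r = r' := by
  apply Subtype.ext
  refine SimpleGraph.Walk.ext_getVert fun k => Subtype.ext ?_
  exact congrFun h k

variable {V : Type*} [NormedAddCommGroup V] [NormedSpace ℝ V] [FiniteDimensional ℝ V]

variable {A : Set (Submodule ℝ V)} {f : Submodule ℝ V → V →ₗ[ℝ] ℝ} {c₀ : Chamber A}

theorem chamber_eq_cell (hf : ∀ H ∈ A, LinearMap.ker (f H) = H) (hc₀ : c₀.1 = cell A f ∅)
    (c : Chamber A) : c.1 = cell A f (sep₁ A c₀.1 c.1) := by
  obtain ⟨x, hx⟩ := c.nonempty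
  have h := c.eq_cell hf hx
  have h0 : (cell A f ∅).Nonempty := hc₀ ▸ c₀.nonempty
  conv_lhs => rw [h]
  refine cell_congr fun H hH => ?_
  rw [hc₀, h, sep₁_cell hf h0 (h ▸ c.nonempty)]
  simp [hH]

theorem mem_sep₁_iff_neg (hf : ∀ H ∈ A, LinearMap.ker (f H) = H) (hc₀ : c₀.1 = cell A f ∅)
    (c : Chamber A) {q : V} (hq : q ∈ c.1) (H : Submodule ℝ V) :
    H ∈ sep₁ A c₀.1 c.1 ↔ H ∈ A ∧ f H q < 0 := by
  refine ⟨fun h => ⟨h.1, ?_⟩, fun h => ?_⟩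
  · rw [chamber_eq_cell hf hc₀ c] at hq
    exact (hq H h.1).1 h
  · rw [chamber_eq_cell hf hc₀ c] at hq
    exact (mem_iff_neg_of_mem_cell hq h.1).2 h.2

theorem sep₁_eq (hf : ∀ H ∈ A, LinearMap.ker (f H) = H) (hc₀ : c₀.1 = cell A f ∅)
    (c c' : Chamber A) : sep₁ A c.1 c'.1 =
      {H | H ∈ A ∧ ¬ (H ∈ sep₁ A c₀.1 c.1 ↔ H ∈ sep₁ A c₀.1 c'.1)} := by
  conv_lhs => rw [chamber_eq_cell hf hc₀ c, chamber_eq_cell hf hc₀ c']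
  exact sep₁_cell hf (chamber_eq_cell hf hc₀ c ▸ c.nonempty) (chamber_eq_cell hf hc₀ c' ▸ c'.nonempty)

/-- Along a path of adjacent chambers, the distance from the base chamber is at most the number of
steps, and in case of equality the path is given by a list of crossed hyperplanes. -/
theorem exists_prefix_list (hf : ∀ H ∈ A, LinearMap.ker (f H) = H) (hc₀ : c₀.1 = cell A f ∅)
    {γ : ℕ → Chamber A} (h0 : γ 0 = c₀) (n : ℕ) (hadj : ∀ k < n, (G₁ A).Adj (γ k) (γ (k + 1))) :
    (sep₁ A c₀.1 (γ n).1).encard ≤ n ∧ (n ≤ (sep₁ A c₀.1 (γ n).1).encard →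
      ∃ l : List (Submodule ℝ V), l.length = n ∧ l.Nodup ∧ (∀ H ∈ l, H ∈ A) ∧
        ∀ k ≤ n, (γ k).1 = cell A f {H | H ∈ l.take k}) := by
  induction n with
  | zero =>
    refine ⟨by simp [h0, sep₁_self A c₀.nonempty], fun _ => ⟨[], by simp, by simp, by simp, ?_⟩⟩
    intro k hk
    obtain rfl : k = 0 := by omega
    rw [h0, hc₀]
    exact cell_congr fun H _ => by simp
  | succ n ih =>
    obtain ⟨ih1, ih2⟩ := ih fun k hk => hadj k (by omega)
    obtain ⟨H, hH⟩ := Set.encard_eq_one.1 (hadj n (by omega))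
    have hsep := sep₁_eq hf hc₀ (γ n) (γ (n + 1))
    rw [hH] at hsep
    obtain ⟨hHA, hHn⟩ := hsep.subset (Set.mem_singleton H)
    have hiff : ∀ K, K ≠ H → (K ∈ sep₁ A c₀.1 (γ n).1 ↔ K ∈ sep₁ A c₀.1 (γ (n + 1)).1) := by
      intro K hK
      by_contra h
      have hKA : K ∈ A := by
        by_contra h'
        exact h (iff_of_false (fun h => h' h.1) (fun h => h' h.1))
      have : K ∈ ({H} : Set (Submodule ℝ V)) := by
        rw [hsep]
        exact ⟨hKA, h⟩
      exact hK this
    have hsub : sep₁ A c₀.1 (γ (n + 1)).1 ⊆ insert H (sep₁ A c₀.1 (γ n).1) := by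
      intro K hK
      by_cases hKH : K = H
      · exact Or.inl hKH
      · exact Or.inr ((hiff K hKH).2 hK)
    have hle := (Set.encard_le_encard hsub).trans (Set.encard_insert_le _ _)
    refine ⟨?_, fun hn => ?_⟩
    · push_cast
      exact hle.trans (by gcongr)
    · have hn' : (n : ℕ∞) ≤ (sep₁ A c₀.1 (γ n).1).encard := by
        have := hn.trans hle
        push_cast at this
        exact (ENat.add_le_add_iff_right (by simp)).1 this
      -- Crossing `H` back would leave at most `n` separating hyperplanes after `n + 1` steps.
      have hHnot : H ∉ sep₁ A c₀.1 (γ n).1 := by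
        intro h
        rw [Set.insert_eq_of_mem h] at hsub
        have := hn.trans ((Set.encard_le_encard hsub).trans ih1)
        have : n + 1 ≤ n := by exact_mod_cast this
        omega
      have hHin : H ∈ sep₁ A c₀.1 (γ (n + 1)).1 := by
        by_contra h
        exact hHn (iff_of_false hHnot h)
      obtain ⟨l, hl1, hl2, hl3, hl4⟩ := ih2 hn'
      have hln : ∀ K ∈ A, K ∈ l ↔ K ∈ sep₁ A c₀.1 (γ n).1 := by
        intro K hK
        have h1 := hl4 n le_rfl
        rw [List.take_of_length_le hl1.le] at h1
        have h2 := chamber_eq_cell hf hc₀ (γ n)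
        rw [h1] at h2
        have := (cell_congr_iff (h1 ▸ (γ n).nonempty)).1 h2 K hK
        rw [← h1] at this
        exact this
      refine ⟨l ++ [H], by simp [hl1], ?_, ?_, fun k hk => ?_⟩
      · rw [List.nodup_append]
        refine ⟨hl2, by simp, fun a ha b hb => ?_⟩
        rw [List.mem_singleton] at hb
        subst hb
        rintro rfl
        exact hHnot ((hln a hHA).1 ha)
      · intro K hK
        rcases List.mem_append.1 hK with h | h
        · exact hl3 K h
        · rw [List.mem_singleton] at h
          exact h ▸ hHA
      · rcases Nat.lt_or_ge n k with h | h
        · obtain rfl : k = n + 1 := by omega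
          rw [List.take_of_length_le (by simp [hl1]), chamber_eq_cell hf hc₀ (γ (n + 1))]
          refine cell_congr fun K hK => ?_
          simp only [List.mem_append, List.mem_singleton, Set.mem_ofPred_eq, hln K hK]
          by_cases hKH : K = H
          · simp [hKH, hHin]
          · simp [hKH, hiff K hKH]
        · rw [hl4 k h, List.take_append_of_le_length (by omega)]

theorem exists_list_of_path (hf : ∀ H ∈ A, LinearMap.ker (f H) = H) (hc₀ : c₀.1 = cell A f ∅)
    {γ : ℕ → Chamber A} (h0 : γ 0 = c₀) {n : ℕ} (hadj : ∀ k < n, (G₁ A).Adj (γ k) (γ (k + 1)))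
    (hn : n ≤ (sep₁ A c₀.1 (γ n).1).encard) (hconst : ∀ k, n ≤ k → γ k = γ n) :
    ∃ l : List (Submodule ℝ V), l.length = n ∧ IsGalleryList A f l ∧
      Traces A f l (fun k => (γ k).1) := by
  obtain ⟨l, hl1, hl2, hl3, hl4⟩ := (exists_prefix_list hf hc₀ h0 n hadj).2 hn
  have htr : Traces A f l (fun k => (γ k).1) := by
    intro k
    rcases le_total k n with h | h
    · exact hl4 k h
    · simp only
      rw [hconst k h, hl4 n le_rfl, List.take_of_length_le (by omega),
        List.take_of_length_le (by omega)]
  exact ⟨l, hl1, ⟨hl2, hl3, fun k => by rw [← htr k]; exact (γ k).nonempty⟩, htr⟩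

/-- The target of a gallery list. -/
theorem mem_list_iff (hf : ∀ H ∈ A, LinearMap.ker (f H) = H) (hc₀ : c₀.1 = cell A f ∅)
    {l : List (Submodule ℝ V)} (hl : IsGalleryList A f l) {c : Chamber A}
    (h : c.1 = cell A f {H | H ∈ l}) (H : Submodule ℝ V) : H ∈ l ↔ H ∈ sep₁ A c₀.1 c.1 := by
  have h1 := (cell_congr_iff (h ▸ c.nonempty)).1 (h.symm.trans (chamber_eq_cell hf hc₀ c))
  exact ⟨fun h => (h1 H (hl.subset H h)).1 h, fun h => (h1 H h.1).2 h⟩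

theorem adj_cellChamber (hf : ∀ H ∈ A, LinearMap.ker (f H) = H) {l : List (Submodule ℝ V)}
    (hl : IsGalleryList A f l) {k : ℕ} (hk : k < l.length) :
    (G₁ A).Adj (cellChamber hf (hl.nonempty k)) (cellChamber hf (hl.nonempty (k + 1))) := by
  refine Set.encard_eq_one.2 ⟨l[k], ?_⟩
  ext H
  refine (mem_sep₁_iff_getElem (γ := fun k => cell A f {H | H ∈ l.take k}) hf hl
    (fun _ => rfl)).trans ?_
  simp [hk, eq_comm]

theorem encard_setOf_mem {α : Type*} {l : List α} (hl : l.Nodup) :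
    {a | a ∈ l}.encard = l.length := by
  classical
  rw [← List.toFinset_card_of_nodup hl, ← Set.encard_coe_eq_coe_finsetCard]
  congr 1
  ext a
  simp

/-- A gallery list crosses each separating hyperplane once, and no walk can use fewer steps. So the
mere existence of such a list computes the distance in `G₁`. -/
theorem exists_minGallery (hf : ∀ H ∈ A, LinearMap.ker (f H) = H) (hc₀ : c₀.1 = cell A f ∅)
    {l : List (Submodule ℝ V)} (hl : IsGalleryList A f l) {c : Chamber A}
    (h : c.1 = cell A f {H | H ∈ l}) :
    (G₁ A).dist c₀ c = l.length ∧ ∃ r : MinGallery A c₀ c, Traces A f l r.seq := by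
  obtain ⟨w, hw, hk⟩ := exists_walk_of_adj l.length (fun k => cellChamber hf (hl.nonempty k))
    (fun k hk => adj_cellChamber hf hl hk) (a := c₀) (b := c)
    (Subtype.ext (by rw [hc₀]; exact cell_congr fun H _ => by simp))
    (Subtype.ext (by rw [h]; exact cell_congr fun H _ => by simp))
  obtain ⟨w', hw'⟩ := w.reachable.exists_walk_length_eq_dist
  have h1 := (exists_prefix_list hf hc₀ (γ := w'.getVert) (by simp) w'.length
    fun k hk => w'.adj_getVert_succ hk).1
  have hS : sep₁ A c₀.1 c.1 = {H | H ∈ l} := by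
    ext H
    exact (mem_list_iff hf hc₀ hl h H).symm
  rw [w'.getVert_length, hS, encard_setOf_mem hl.nodup] at h1
  have h2 : l.length ≤ w'.length := by exact_mod_cast h1
  have h3 := (G₁ A).dist_le w
  have h4 : (G₁ A).dist c₀ c = l.length := by omega
  refine ⟨h4, ⟨w, by omega⟩, fun k => ?_⟩
  simp only [MinGallery.seq, hk]
  refine cell_congr fun H _ => ?_
  simp only [Set.mem_ofPred_eq]
  rcases le_total k l.length with hkl | hkl
  · rw [min_eq_left hkl]
  · rw [min_eq_right hkl, List.take_of_length_le le_rfl, List.take_of_length_le hkl]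

/-- The bound `hdist` says that a shortest path has no more steps than there are separating
hyperplanes; it therefore repeats none. The bound is later read off from the base list. -/
theorem MinGallery.exists_list (hf : ∀ H ∈ A, LinearMap.ker (f H) = H)
    (hc₀ : c₀.1 = cell A f ∅) {c : Chamber A}
    (hdist : ((G₁ A).dist c₀ c : ℕ∞) ≤ (sep₁ A c₀.1 c.1).encard) (r : MinGallery A c₀ c) :
    ∃ l, IsGalleryList A f l ∧ c.1 = cell A f {H | H ∈ l} ∧ Traces A f l r.seq := by
  obtain ⟨l, h1, h2, h3⟩ := exists_list_of_path hf hc₀ (γ := r.1.getVert) (by simp)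
    (n := r.1.length) (fun k hk => r.1.adj_getVert_succ hk)
    (by rw [r.1.getVert_length, r.2]; exact hdist)
    (fun k hk => by rw [r.1.getVert_of_length_le hk, r.1.getVert_length])
  refine ⟨l, h2, ?_, h3⟩
  have := h3 r.1.length
  simpa [← h1, r.1.getVert_of_length_le h1.ge] using this

/-- For hyperplanes with `lev G < lev M`, testing incidence at the flag members of index `lev G` and
`lev M` forces `M` to come first. -/
theorem pathIncident_iff (hf : ∀ H ∈ A, LinearMap.ker (f H) = H) (hc₀ : c₀.1 = cell A f ∅)
    {l : List (Submodule ℝ V)} (hl : IsGalleryList A f l) {c : Chamber A}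
    (h : c.1 = cell A f {H | H ∈ l}) {γ : ℕ → Set V} (hγ : Traces A f l γ)
    {F : Fin (Module.finrank ℝ V + 1) → Submodule ℝ V} {lev : Submodule ℝ V → ℕ}
    (hlev : ∀ i, ∀ H ∈ A, F i ≤ H ↔ (i : ℕ) ≤ lev H)
    (hlt : ∀ H ∈ A, lev H < Module.finrank ℝ V) :
    PathIncident A F c₀.1 c.1 γ ↔ l.Pairwise fun G M => lev M ≤ lev G := by
  simp only [PathIncident, crossesBefore_iff hf hl hγ, ← mem_list_iff hf hc₀ hl h]
  constructor
  · intro hp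
    rw [List.pairwise_iff_forall_sublist]
    intro G M hGM
    by_contra hcon
    have hG := (mem_of_pair_sublist hGM).1
    have hM := (mem_of_pair_sublist hGM).2
    have hGA := hl.subset G hG
    have hMA := hl.subset M hM
    refine pair_sublist_asymm hl.nodup hGM (hp ⟨lev G, (hlt G hGA).trans (Nat.lt_succ_self _)⟩
      ⟨lev M, (hlt M hMA).trans (Nat.lt_succ_self _)⟩ (not_le.1 hcon) M hM G hG ?_ ?_ ?_)
    · rw [hlev _ M hMA]
    · rw [hlev _ G hGA]
    · rw [hlev _ G hGA]
      exact hcon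
  · intro hp i j _ H hH K hK h1 _ h3
    rw [hlev _ H (hl.subset H hH)] at h1
    rw [hlev _ K (hl.subset K hK)] at h3
    rcases pair_sublist_total hH hK (by rintro rfl; exact h3 h1) with h4 | h4
    · exact h4
    · have := List.pairwise_iff_forall_sublist.1 hp h4
      omega

/-- The combinatorial content of the theorem on supersolvable arrangements, in terms of lists of
crossed hyperplanes. -/
theorem exists_base_list (hA : IsArrangement A) (hf : ∀ H ∈ A, LinearMap.ker (f H) = H)
    (hc₀ : c₀.1 = cell A f ∅) {F : Fin (Module.finrank ℝ V + 1) → Submodule ℝ V}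
    (hF : IsModularFlag A F) (hinc : ∀ i, Incident c₀.1 (F i)) (c : Chamber A) :
    ∃ l₀ : List (Submodule ℝ V), IsGalleryList A f l₀ ∧ c.1 = cell A f {H | H ∈ l₀} ∧
      (∀ l γ, IsGalleryList A f l → c.1 = cell A f {H | H ∈ l} → Traces A f l γ →
        (PathIncident A F c₀.1 c.1 γ ↔ l = l₀)) ∧
      ∀ l, IsGalleryList A f l → c.1 = cell A f {H | H ∈ l} → l ≠ l₀ →
        ∃ (u x x' v : List (Submodule ℝ V)) (X : Submodule ℝ V),
          l = u ++ x ++ v ∧ IsGalleryList A f (u ++ x' ++ v) ∧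
          c.1 = cell A f {H | H ∈ u ++ x' ++ v} ∧ x'.length = x.length ∧
          (∀ H ∈ A, H ∈ x ↔ X ≤ H) ∧ (∀ H ∈ A, H ∈ x' ↔ X ≤ H) ∧ x.head? ≠ x'.head? ∧
          listSep A c₀.1 c.1 l (u ++ x' ++ v) = {X} ∧
          listSep A c₀.1 c.1 l₀ (u ++ x' ++ v) ⊂ listSep A c₀.1 c.1 l₀ l := by
  obtain ⟨lev, p, D, hlev, hlt⟩ := exists_flagData hA hf hF (hc₀ ▸ hinc)
  obtain ⟨q, hqc⟩ := c.nonempty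
  have hq : ∀ M ∈ A, f M q ≠ 0 := fun M hM =>
    ne_zero_of_mem_cell (chamber_eq_cell hf hc₀ c ▸ hqc) hM
  obtain ⟨l₀, hl₀, hl₀q, hl₀s⟩ := D.exists_sorted hq
  have hsep := mem_sep₁_iff_neg hf hc₀ c hqc
  have hcl : ∀ {l : List (Submodule ℝ V)}, (∀ H, H ∈ l ↔ H ∈ A ∧ f H q < 0) →
      c.1 = cell A f {H | H ∈ l} := fun {l} h => by
    rw [chamber_eq_cell hf hc₀ c]
    exact cell_congr fun H _ => by rw [hsep, ← h]; rfl
  have hmem : ∀ {l : List (Submodule ℝ V)}, IsGalleryList A f l → c.1 = cell A f {H | H ∈ l} →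
      ∀ H, H ∈ l ↔ H ∈ A ∧ f H q < 0 := fun hl h H => by
    rw [mem_list_iff hf hc₀ hl h, hsep]
  have hsorted : ∀ {l : List (Submodule ℝ V)}, IsGalleryList A f l →
      c.1 = cell A f {H | H ∈ l} → ((l.Pairwise fun G M => lev M ≤ lev G) ↔ l = l₀) := by
    intro l hl hlc
    constructor
    · intro h
      exact FlagData.sorted_unique (hmem hl hlc) hl₀q
        (D.pairwise_key hl hq (hmem hl hlc) h) hl₀s
    · rintro rfl
      refine hl₀s.imp fun h => ?_
      rw [FlagData.key_lt_iff] at h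
      omega
  refine ⟨l₀, hl₀, hcl hl₀q, fun l γ hl hlc hγ => ?_, fun l hl hlc hne => ?_⟩
  · rw [pathIncident_iff hf hc₀ hl hlc hγ hlev hlt, hsorted hl hlc]
  · obtain ⟨u, w, v, H, K, rfl, hHw, hl', hX, -, hHK, hkey⟩ :=
      D.exists_flip hl (fun h => hne ((hsorted hl hlc).1 h))
    have hlq := hmem hl hlc
    have hKq : f K q < 0 := ((hlq K).1 (by simp)).2
    obtain ⟨h1, h2⟩ := listSep_flip D hsep hl₀s hl₀q hlq hHw hl hl' hX hHK (hkey q hKq)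
    refine ⟨u, w ++ [K], K :: w.reverse, v, H ⊓ K, rfl, hl', hcl fun G => ?_, by simp,
      fun G hG => by rw [hX G hG]; simp, fun G hG => by rw [hX G hG]; simp [or_comm], ?_, h1, h2⟩
    · rw [← hlq]
      simp only [List.mem_append, List.mem_cons, List.mem_reverse, List.not_mem_nil, or_false]
      tauto
    -- The old factor starts in `w` and the new one with `K`, which is not in `w`. The differing
    -- heads later yield different first letters of words.
    · cases w with
      | nil => simp at hHw
      | cons G w =>
        simp only [List.cons_append, List.head?_cons, ne_eq, Option.some.injEq]
        rintro rfl
        have := hl.nodup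
        simp [List.nodup_append] at this

end GalleryLists

/-! ### The bounds for supersolvable arrangements. -/

section Supersolvable

variable {V : Type*} [NormedAddCommGroup V] [NormedSpace ℝ V] [FiniteDimensional ℝ V]

/-- The base list realises the distance from `c₀` to `c`, so every minimal gallery is a gallery
list. A flip changes `L_2` by exactly one subspace and is therefore an edge of `G₂`. -/
theorem supersolvable_bounds {A : Set (Submodule ℝ V)} (hA : IsArrangement A) (c₀ : Chamber A)
    (F : Fin (Module.finrank ℝ V + 1) → Submodule ℝ V) (hF : IsModularFlag A F)
    (hinc : ∀ i, Incident c₀.1 (F i)) (c : Chamber A) :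
    (∃ r₀ : MinGallery A c₀ c, r₀.IncidentTo F ∧
      (∀ r : MinGallery A c₀ c, r.IncidentTo F → r = r₀) ∧
      ∀ r r' : MinGallery A c₀ c,
        (r.sep r').encard ≤ (G₂ A c₀ c).edist r r' ∧
        (G₂ A c₀ c).edist r r' ≤ (r₀.sep r).encard + (r₀.sep r').encard ∧
        (r₀.sep r).encard + (r₀.sep r').encard ≤ 2 * (sep₂ A c₀.1 c.1).encard) ∧
    (G₂ A c₀ c).ediam ≤ 2 * (sep₂ A c₀.1 c.1).encard := by
  obtain ⟨f, hf, hc₀⟩ := c₀.exists_functionals hA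
  obtain ⟨l₀, hl₀, hl₀c, hinc, hacc⟩ := exists_base_list hA hf hc₀ hF hinc c
  obtain ⟨hdist, r₀, hr₀⟩ := exists_minGallery hf hc₀ hl₀ hl₀c
  have hdist' : ((G₁ A).dist c₀ c : ℕ∞) ≤ (sep₁ A c₀.1 c.1).encard := by
    rw [hdist, ← encard_setOf_mem hl₀.nodup]
    exact Set.encard_le_encard fun H h => (mem_list_iff hf hc₀ hl₀ hl₀c H).1 h
  have heq : ∀ r : MinGallery A c₀ c, Traces A f l₀ r.seq → r = r₀ := fun r hr =>
    MinGallery.ext_seq (funext fun k => (hr k).trans (hr₀ k).symm)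
  have key := edist_bounds (G₂ A c₀ c) MinGallery.sep (sep₂ A c₀.1 c.1) (sep₂_finite hA _ _)
    (fun r r' X h => h.1) (fun r => pathSep_self _ _ _ _) (fun r r' r'' => pathSep_triangle _ _ _)
    (fun r r' h => le_of_eq h) r₀ fun r hr => by
      obtain ⟨l, hl, hlc, htr⟩ := r.exists_list hf hc₀ hdist'
      obtain ⟨u, x, x', v, X, rfl, hl', hlc', -, -, -, -, h1, h2⟩ := hacc l hl hlc
        (by rintro rfl; exact hr (heq r htr))
      obtain ⟨-, r', hr'⟩ := exists_minGallery hf hc₀ hl' hlc'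
      refine ⟨r', ?_, ?_⟩
      · change (pathSep _ _ _ _ _).encard = 1
        rw [pathSep_eq_listSep hf hl hl' htr hr', h1, Set.encard_singleton]
      · change pathSep _ _ _ _ _ ⊂ pathSep _ _ _ _ _
        rwa [pathSep_eq_listSep hf hl₀ hl' hr₀ hr', pathSep_eq_listSep hf hl₀ hl hr₀ htr]
  refine ⟨⟨r₀, (hinc l₀ _ hl₀ hl₀c hr₀).2 rfl, fun r hr => ?_, key.1⟩, key.2⟩
  obtain ⟨l, hl, hlc, htr⟩ := r.exists_list hf hc₀ hdist'
  obtain rfl := (hinc l _ hl hlc htr).1 hr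
  exact heq r htr

end Supersolvable

end GalleryGraph

namespace GalleryGraph

/-! ### Isometries acting on subspaces, chambers and separating sets. -/

section Action

variable {V : Type*} [NormedAddCommGroup V] [InnerProductSpace ℝ V]

/-- The image of a subspace under an isometry. -/
def act (g : V ≃ₗᵢ[ℝ] V) (K : Submodule ℝ V) : Submodule ℝ V :=
  K.map (g.toLinearEquiv : V →ₗ[ℝ] V)

theorem mem_act {g : V ≃ₗᵢ[ℝ] V} {K : Submodule ℝ V} {v : V} : v ∈ act g K ↔ g⁻¹ v ∈ K := by
  simp only [act, Submodule.mem_map]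
  constructor
  · rintro ⟨y, hy, rfl⟩
    simpa using hy
  · exact fun h => ⟨_, h, by simp⟩

theorem act_one (K : Submodule ℝ V) : act 1 K = K := by
  ext v
  simp [mem_act]

theorem act_mul (g h : V ≃ₗᵢ[ℝ] V) (K : Submodule ℝ V) : act (g * h) K = act g (act h K) := by
  ext v
  simp [mem_act]

theorem act_inv_act (g : V ≃ₗᵢ[ℝ] V) (K : Submodule ℝ V) : act g⁻¹ (act g K) = K := by
  rw [← act_mul, inv_mul_cancel, act_one]

theorem act_act_inv (g : V ≃ₗᵢ[ℝ] V) (K : Submodule ℝ V) : act g (act g⁻¹ K) = K := by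
  rw [← act_mul, mul_inv_cancel, act_one]

theorem act_injective (g : V ≃ₗᵢ[ℝ] V) : Function.Injective (act g) := fun K L h => by
  rw [← act_inv_act g K, h, act_inv_act]

theorem act_le_act_iff {g : V ≃ₗᵢ[ℝ] V} {K L : Submodule ℝ V} : act g K ≤ act g L ↔ K ≤ L := by
  refine ⟨fun h => ?_, Submodule.map_mono⟩
  have := Submodule.map_mono (f := (g⁻¹.toLinearEquiv : V →ₗ[ℝ] V)) h
  change act g⁻¹ (act g K) ≤ act g⁻¹ (act g L) at this
  rwa [act_inv_act, act_inv_act] at this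

theorem finrank_act (g : V ≃ₗᵢ[ℝ] V) (K : Submodule ℝ V) :
    Module.finrank ℝ (act g K) = Module.finrank ℝ K :=
  LinearEquiv.finrank_map_eq g.toLinearEquiv K

/-- `A` is stable under the isometry `g`. -/
def Preserves (A : Set (Submodule ℝ V)) (g : V ≃ₗᵢ[ℝ] V) : Prop :=
  ∀ K, act g K ∈ A ↔ K ∈ A

variable {A : Set (Submodule ℝ V)}

theorem Preserves.one : Preserves A 1 := fun K => by rw [act_one]

theorem Preserves.mul {g h : V ≃ₗᵢ[ℝ] V} (hg : Preserves A g) (hh : Preserves A h) :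
    Preserves A (g * h) := fun K => by rw [act_mul, hg, hh]

theorem Preserves.inv {g : V ≃ₗᵢ[ℝ] V} (hg : Preserves A g) : Preserves A g⁻¹ := fun K => by
  rw [← hg, act_act_inv]

theorem Preserves.image_complement {g : V ≃ₗᵢ[ℝ] V} (hg : Preserves A g) :
    g '' complement A = complement A := by
  have key : ∀ h : V ≃ₗᵢ[ℝ] V, Preserves A h → ∀ x ∈ complement A, h x ∈ complement A := by
    intro h hh x hx H hH hxH
    refine hx (act h⁻¹ H) ((hh.inv H).2 hH) ?_
    rw [mem_act]
    simpa using hxH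
  apply Set.Subset.antisymm
  · rintro _ ⟨x, hx, rfl⟩
    exact key g hg x hx
  · intro x hx
    exact ⟨g⁻¹ x, key _ hg.inv x hx, by simp⟩

/-- The image of a chamber under an isometry preserving the arrangement. -/
def Preserves.chamber {g : V ≃ₗᵢ[ℝ] V} (hg : Preserves A g) (c : Chamber A) : Chamber A :=
  ⟨g '' c.1, by
    obtain ⟨x, hx, h⟩ := c.2
    refine ⟨g x, hg.image_complement ▸ Set.mem_image_of_mem g hx, ?_⟩
    have := g.toHomeomorph.image_connectedComponentIn hx
    simp only [LinearIsometryEquiv.coe_toHomeomorph] at this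
    rw [h, this, hg.image_complement]⟩

theorem Preserves.act_mem_sep₁ {g : V ≃ₗᵢ[ℝ] V} (hg : Preserves A g) {c c' : Set V}
    {H : Submodule ℝ V} (h : H ∈ sep₁ A c c') : act g H ∈ sep₁ A (g '' c) (g '' c') := by
  obtain ⟨hH, k, hk, h1, h2⟩ := h
  refine ⟨(hg H).2 hH, k ∘ₗ (g⁻¹.toLinearEquiv : V →ₗ[ℝ] V), ?_, ?_, ?_⟩
  · ext v
    rw [mem_act, ← hk]
    simp
  · rintro _ ⟨x, hx, rfl⟩
    simpa using h1 x hx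
  · rintro _ ⟨x, hx, rfl⟩
    simpa using h2 x hx

theorem Preserves.sep₁_image {g : V ≃ₗᵢ[ℝ] V} (hg : Preserves A g) (c c' : Set V) :
    sep₁ A (g '' c) (g '' c') = act g '' sep₁ A c c' := by
  apply Set.Subset.antisymm
  · intro H hH
    refine ⟨act g⁻¹ H, ?_, act_act_inv g H⟩
    have := hg.inv.act_mem_sep₁ hH
    simpa [Set.image_image] using this
  · rintro _ ⟨H, hH, rfl⟩
    exact hg.act_mem_sep₁ hH

theorem not_le_of_ne (hA : IsArrangement A) {H K : Submodule ℝ V} (hH : H ∈ A) (hK : K ∈ A)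
    (h : H ≠ K) : ¬ H ≤ K := fun h' =>
  ((hA.hyperplane H hH).le_iff.1 h').elim (hA.hyperplane K hK).1 fun h'' => h h''.symm

end Action

/-! ### Walls of the base chamber and their reflections. -/

section Walls

variable {V : Type*} [NormedAddCommGroup V] [InnerProductSpace ℝ V] [FiniteDimensional ℝ V]

variable {A : Set (Submodule ℝ V)} {f : Submodule ℝ V → V →ₗ[ℝ] ℝ} {c₀ : Chamber A}

theorem reflection_act (g : V ≃ₗᵢ[ℝ] V) (K : Submodule ℝ V) :
    (act g K).reflection = g * K.reflection * g⁻¹ :=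
  Submodule.reflection_map g K

theorem reflection_injective {H K : Submodule ℝ V} (h : H.reflection = K.reflection) : H = K := by
  ext v
  rw [← Submodule.reflection_eq_self_iff, ← Submodule.reflection_eq_self_iff, h]

theorem add_reflection_mem (H : Submodule ℝ V) (x : V) : x + H.reflection x ∈ H := by
  rw [Submodule.reflection_apply, add_sub_cancel]
  exact nsmul_mem (Submodule.starProjection_apply_mem H x) 2

theorem chamber_eq_of_sep₁ (hA : IsArrangement A) {c c' : Chamber A}
    (h : sep₁ A c₀.1 c.1 = sep₁ A c₀.1 c'.1) : c = c' := by
  obtain ⟨f, hf, hc₀⟩ := c₀.exists_functionals hA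
  apply Subtype.ext
  rw [chamber_eq_cell hf hc₀ c, chamber_eq_cell hf hc₀ c', h]

/-- The reflection in a wall of the base chamber crosses exactly this wall. -/
theorem sep₁_reflection (hA : IsArrangement A) {H : Submodule ℝ V} (hH : H ∈ A)
    (hs : Preserves A H.reflection) (hinc : Incident c₀.1 H) :
    sep₁ A c₀.1 (H.reflection '' c₀.1) = {H} := by
  obtain ⟨f, hf, hc₀⟩ := c₀.exists_functionals hA
  obtain ⟨x, hx⟩ := c₀.nonempty
  obtain ⟨v, hvH, hv⟩ := (hc₀ ▸ hinc).exists_point hA hf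
  have hpos : ∀ K ∈ A, 0 < f K x := fun K hK => ((hc₀ ▸ hx : x ∈ cell A f ∅) K hK).2 (by simp)
  -- The test point is `v + ε • x`, inside `c₀` and close to the interior of the wall. For small `ε`
  -- its reflection stays on the positive side of every hyperplane other than `H`.
  have hε : ∀ᶠ ε in nhdsWithin (0 : ℝ) (Set.Ioi 0), ∀ K ∈ A, K ≠ H →
      0 < f K v + ε * f K (H.reflection x) := by
    rw [Filter.eventually_all_finite hA.finite]
    intro K hK
    by_cases h : K = H
    · exact Filter.Eventually.of_forall fun _ h' => absurd h h'
    · have h1 := (hv K hK).2 (not_le_of_ne hA hH hK fun h' => h h'.symm)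
      have h2 : Filter.Tendsto (fun ε : ℝ => f K v + ε * f K (H.reflection x)) (nhds 0)
          (nhds (f K v + 0 * f K (H.reflection x))) := by
        apply Continuous.tendsto
        fun_prop
      rw [zero_mul, add_zero] at h2
      exact nhdsWithin_le_nhds ((h2.eventually_const_lt h1).mono fun _ h _ => h)
  obtain ⟨ε, hε1, hε0⟩ := (hε.and self_mem_nhdsWithin).exists
  have hε0 : 0 < ε := hε0
  have hz : v + ε • x ∈ c₀.1 := by
    rw [hc₀]
    intro K hK
    refine ⟨by simp, fun _ => ?_⟩
    have h1 : 0 ≤ f K v := by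
      by_cases h : H ≤ K
      · exact ((hv K hK).1 h).ge
      · exact ((hv K hK).2 h).le
    have h2 := mul_pos hε0 (hpos K hK)
    simp only [map_add, map_smul, smul_eq_mul]
    linarith
  have hsz : H.reflection (v + ε • x) = v + ε • H.reflection x := by
    rw [map_add, map_smul, Submodule.reflection_mem_subspace_eq_self hvH]
  ext K
  rw [Set.mem_singleton_iff]
  have := mem_sep₁_iff_neg hf hc₀ (hs.chamber c₀) (Set.mem_image_of_mem _ hz) K
  refine this.trans ?_
  rw [hsz]
  constructor
  · rintro ⟨hK, h⟩
    by_contra hne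
    have := hε1 K hK hne
    simp only [map_add, map_smul, smul_eq_mul] at h
    linarith
  · rintro rfl
    refine ⟨hH, ?_⟩
    have h1 : f K (x + K.reflection x) = 0 := by
      rw [← LinearMap.mem_ker, hf K hH]
      exact add_reflection_mem K x
    have h2 := hpos K hH
    have h3 := (hv K hH).1 le_rfl
    simp only [map_add, map_smul, smul_eq_mul] at h1 ⊢
    rw [h3]
    have : f K (K.reflection x) < 0 := by linarith
    nlinarith

/-- A hyperplane that separates the base chamber from an adjacent chamber is a wall. -/
theorem incident_of_sep₁_eq (hA : IsArrangement A) {H : Submodule ℝ V} {c : Chamber A}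
    (h : sep₁ A c₀.1 c.1 = {H}) : Incident c₀.1 H := by
  obtain ⟨f, hf, hc₀⟩ := c₀.exists_functionals hA
  obtain ⟨x, hx⟩ := c₀.nonempty
  obtain ⟨y, hy⟩ := c.nonempty
  have hpos : ∀ K ∈ A, 0 < f K x := fun K hK => ((hc₀ ▸ hx : x ∈ cell A f ∅) K hK).2 (by simp)
  have hH : H ∈ A ∧ f H y < 0 := by
    rw [← mem_sep₁_iff_neg hf hc₀ c hy, h]
    rfl
  have hypos : ∀ K ∈ A, K ≠ H → 0 < f K y := by
    intro K hK hne
    rw [chamber_eq_cell hf hc₀ c, h] at hy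
    exact (hy K hK).2 hne
  -- Up to a positive factor, this is where the segment from `x` to `y` meets `H`; it lies strictly
  -- inside the common facet.
  set z := (-(f H y)) • x + (f H x) • y
  have hzH : f H z = 0 := by
    simp only [z, map_add, map_smul, smul_eq_mul]
    ring
  have hz : ∀ K ∈ A, K ≠ H → 0 < f K z := by
    intro K hK hne
    simp only [z, map_add, map_smul, smul_eq_mul]
    have h1 := mul_pos (neg_pos.2 hH.2) (hpos K hK)
    have h2 := mul_pos (hpos H hH.1) (hypos K hK hne)
    linarith
  have hclos : ∀ v : V, (∀ K ∈ A, 0 ≤ f K v) → v ∈ closure c₀.1 := fun v hv => by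
    rw [hc₀] at hx ⊢
    exact mem_closure_of_nonneg hx hv
  have hspan : Submodule.span ℝ (closure c₀.1 ∩ (H : Set V)) = H := by
    apply le_antisymm (Submodule.span_le.2 Set.inter_subset_right)
    intro v hv
    have hvH : f H v = 0 := by rwa [← LinearMap.mem_ker, hf H hH.1]
    have hε : ∀ᶠ ε in nhdsWithin (0 : ℝ) (Set.Ioi 0), ∀ K ∈ A, K ≠ H →
        0 < f K z + ε * f K v := by
      rw [Filter.eventually_all_finite hA.finite]
      intro K hK
      by_cases h : K = H
      · exact Filter.Eventually.of_forall fun _ h' => absurd h h'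
      · have h2 : Filter.Tendsto (fun ε : ℝ => f K z + ε * f K v) (nhds 0)
            (nhds (f K z + 0 * f K v)) := by
          apply Continuous.tendsto
          fun_prop
        rw [zero_mul, add_zero] at h2
        exact nhdsWithin_le_nhds ((h2.eventually_const_lt (hz K hK h)).mono fun _ h _ => h)
    obtain ⟨ε, hε1, hε0⟩ := (hε.and self_mem_nhdsWithin).exists
    have hε0 : 0 < ε := hε0
    have hmem : ∀ u : V, f H u = 0 → u ∈ H := fun u hu => by
      rw [← hf H hH.1]
      exact hu
    have hz1 : z ∈ closure c₀.1 ∩ (H : Set V) := by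
      refine ⟨hclos z fun K hK => ?_, hmem z hzH⟩
      by_cases hKH : K = H
      · rw [hKH, hzH]
      · exact (hz K hK hKH).le
    have hz2 : z + ε • v ∈ closure c₀.1 ∩ (H : Set V) := by
      refine ⟨hclos _ fun K hK => ?_, hmem _ (by simp [hzH, hvH])⟩
      by_cases hKH : K = H
      · simp [hKH, hzH, hvH]
      · simpa using (hε1 K hK hKH).le
    -- A small neighbourhood of `z` in `H` lies in the closed chamber, so differences of its points
    -- span `H`.
    have h3 : v = ε⁻¹ • ((z + ε • v) - z) := by
      rw [add_sub_cancel_left, smul_smul, inv_mul_cancel₀ hε0.ne', one_smul]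
    rw [h3]
    exact Submodule.smul_mem _ _ (Submodule.sub_mem _ (Submodule.subset_span hz2)
      (Submodule.subset_span hz1))
  rw [Incident, hspan]

/-- Only two walls of a chamber contain a given subspace of codimension two. -/
theorem wall_eq_or_eq (hA : IsArrangement A) {R S T : Submodule ℝ V} (hR : R ∈ A) (hS : S ∈ A)
    (hT : T ∈ A) (hRc : Incident c₀.1 R) (hSc : Incident c₀.1 S) (hTc : Incident c₀.1 T)
    (h : S ⊓ T ≤ R) : R = S ∨ R = T := by
  obtain ⟨f, hf, hc₀⟩ := c₀.exists_functionals hA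
  by_contra hne
  push Not at hne
  by_cases hST : S = T
  · subst hST
    rw [inf_idem] at h
    exact not_le_of_ne hA hS hR hne.1.symm h
  rw [hc₀] at hRc hSc hTc
  obtain ⟨r, -, hr⟩ := hRc.exists_point hA hf
  obtain ⟨s, -, hs⟩ := hSc.exists_point hA hf
  obtain ⟨t, -, ht⟩ := hTc.exists_point hA hf
  obtain ⟨a, b, hab⟩ := exists_combination (g := f S) (h := f T) (k := f R)
    (by rwa [hf R hR, hf S hS, hf T hT])
  have hval : ∀ v, f R v = a * f S v + b * f T v := fun v => by rw [hab]; simp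
  have r0 := (hr R hR).1 le_rfl
  have r1 := (hr S hS).2 (not_le_of_ne hA hR hS hne.1)
  have r2 := (hr T hT).2 (not_le_of_ne hA hR hT hne.2)
  have s0 := (hs S hS).1 le_rfl
  have s1 := (hs R hR).2 (not_le_of_ne hA hS hR hne.1.symm)
  have s2 := (hs T hT).2 (not_le_of_ne hA hS hT hST)
  have t0 := (ht T hT).1 le_rfl
  have t1 := (ht R hR).2 (not_le_of_ne hA hT hR hne.2.symm)
  have t2 := (ht S hS).2 (not_le_of_ne hA hT hS fun h => hST h.symm)
  have e1 := hval r
  have e2 := hval s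
  have e3 := hval t
  rw [s0, mul_zero, zero_add] at e2
  rw [t0, mul_zero, add_zero] at e3
  -- Points in the interiors of the walls `T` and `S` force both coefficients of `f R` to be
  -- positive; then `f R` cannot vanish at the point `r` of the wall `R`.
  have ha : 0 < a := pos_of_mul_pos_left (e3 ▸ t1) t2.le
  have hb : 0 < b := pos_of_mul_pos_left (e2 ▸ s1) s2.le
  nlinarith [mul_pos ha r1, mul_pos hb r2]

end Walls

end GalleryGraph

namespace GalleryGraph

/-! ### Words in the generators and the hyperplanes they cross. -/

section Words

theorem image_mul {V : Type*} [NormedAddCommGroup V] [InnerProductSpace ℝ V] (g h : V ≃ₗᵢ[ℝ] V)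
    (s : Set V) : (g * h : V ≃ₗᵢ[ℝ] V) '' s = g '' (h '' s) := by
  rw [Set.image_image]
  rfl

theorem image_inv_image {V : Type*} [NormedAddCommGroup V] [InnerProductSpace ℝ V]
    (g : V ≃ₗᵢ[ℝ] V) (s : Set V) : (g⁻¹ : V ≃ₗᵢ[ℝ] V) '' (g '' s) = s := by
  rw [← image_mul]
  simp

theorem image_image_inv {V : Type*} [NormedAddCommGroup V] [InnerProductSpace ℝ V]
    (g : V ≃ₗᵢ[ℝ] V) (s : Set V) : g '' ((g⁻¹ : V ≃ₗᵢ[ℝ] V) '' s) = s := by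
  rw [← image_mul]
  simp

variable {V : Type*} [NormedAddCommGroup V] [InnerProductSpace ℝ V] [FiniteDimensional ℝ V]

variable {A : Set (Submodule ℝ V)} {f : Submodule ℝ V → V →ₗ[ℝ] ℝ} {c₀ : Chamber A}

theorem preserves_of_mem_reflGroup (hinv : ∀ H ∈ A, Preserves A H.reflection) {g : V ≃ₗᵢ[ℝ] V}
    (hg : g ∈ reflGroup A) : Preserves A g := by
  induction hg using Subgroup.closure_induction with
  | mem x hx =>
    obtain ⟨H, hH, rfl⟩ := hx
    exact hinv H hH
  | one => exact .one
  | mul x y _ _ hx hy => exact hx.mul hy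
  | inv x _ hx => exact hx.inv

/-- The wall of the base chamber fixed by a Coxeter generator. -/
noncomputable def wall (s : simpleRefl A c₀) : Submodule ℝ V := s.2.choose

theorem wall_mem (s : simpleRefl A c₀) : wall s ∈ A := s.2.choose_spec.1

theorem incident_wall (s : simpleRefl A c₀) : Incident c₀.1 (wall s) := s.2.choose_spec.2.1

theorem reflection_wall (s : simpleRefl A c₀) : s.1 = (wall s).reflection := s.2.choose_spec.2.2

theorem wall_injective : Function.Injective (wall : simpleRefl A c₀ → Submodule ℝ V) :=
  fun s t h => Subtype.ext (by rw [reflection_wall, reflection_wall, h])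

theorem simple_mul_self (s : simpleRefl A c₀) : s.1 * s.1 = 1 := by
  rw [reflection_wall]
  exact Submodule.reflection_mul_reflection _

theorem simple_mem_reflGroup (s : simpleRefl A c₀) : s.1 ∈ reflGroup A :=
  Subgroup.subset_closure ⟨wall s, wall_mem s, reflection_wall s⟩

theorem wordProd_nil : wordProd ([] : List (simpleRefl A c₀)) = 1 := rfl

theorem wordProd_cons (s : simpleRefl A c₀) (l : List (simpleRefl A c₀)) :
    wordProd (s :: l) = s.1 * wordProd l := by
  simp [wordProd]

theorem wordProd_append (l l' : List (simpleRefl A c₀)) :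
    wordProd (l ++ l') = wordProd l * wordProd l' := by
  simp [wordProd]

theorem wordProd_singleton (s : simpleRefl A c₀) : wordProd [s] = s.1 := by
  simp [wordProd]

theorem wordProd_reverse (l : List (simpleRefl A c₀)) :
    wordProd l.reverse = (wordProd l)⁻¹ := by
  induction l with
  | nil => simp [wordProd_nil]
  | cons s l ih =>
    rw [List.reverse_cons, wordProd_append, wordProd_singleton, wordProd_cons, mul_inv_rev, ih,
      inv_eq_of_mul_eq_one_left (simple_mul_self s)]

theorem wordProd_mem_reflGroup (l : List (simpleRefl A c₀)) : wordProd l ∈ reflGroup A :=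
  Subgroup.list_prod_mem _ (by
    simp only [List.mem_map]
    rintro _ ⟨s, -, rfl⟩
    exact simple_mem_reflGroup s)

/-- The hyperplanes crossed by the gallery of a word starting at the chamber `g c₀`. -/
noncomputable def crossed (g : V ≃ₗᵢ[ℝ] V) : List (simpleRefl A c₀) → List (Submodule ℝ V)
  | [] => []
  | s :: l => act g (wall s) :: crossed (g * s.1) l

theorem crossed_append (g : V ≃ₗᵢ[ℝ] V) (l l' : List (simpleRefl A c₀)) :
    crossed g (l ++ l') = crossed g l ++ crossed (g * wordProd l) l' := by
  induction l generalizing g with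
  | nil => simp [crossed, wordProd_nil]
  | cons s l ih => simp [crossed, ih, wordProd_cons, mul_assoc]

theorem length_crossed (g : V ≃ₗᵢ[ℝ] V) (l : List (simpleRefl A c₀)) :
    (crossed g l).length = l.length := by
  induction l generalizing g with
  | nil => rfl
  | cons s l ih => simp [crossed, ih]

theorem crossed_injective (g : V ≃ₗᵢ[ℝ] V) :
    Function.Injective (crossed g : List (simpleRefl A c₀) → List (Submodule ℝ V)) := by
  intro l
  induction l generalizing g with
  | nil =>
    intro l' h
    cases l' with
    | nil => rfl
    | cons => simp [crossed] at h
  | cons s l ih =>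
    intro l' h
    cases l' with
    | nil => simp [crossed] at h
    | cons t l' =>
      simp only [crossed, List.cons.injEq] at h
      obtain rfl := wall_injective (act_injective g h.1)
      rw [ih _ h.2]

theorem crossed_eq_append {g : V ≃ₗᵢ[ℝ] V} {l : List (simpleRefl A c₀)}
    {u v : List (Submodule ℝ V)} (h : crossed g l = u ++ v) :
    ∃ a b, l = a ++ b ∧ crossed g a = u ∧ crossed (g * wordProd a) b = v := by
  have h1 := crossed_append g (l.take u.length) (l.drop u.length)
  rw [List.take_append_drop, h] at h1
  have hlen : u.length ≤ l.length := by
    rw [← length_crossed g l, h, List.length_append]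
    omega
  obtain ⟨h2, h3⟩ := List.append_inj h1 (by rw [length_crossed, List.length_take]; omega)
  exact ⟨_, _, (List.take_append_drop _ _).symm, h2.symm, h3.symm⟩

theorem mem_crossed {g : V ≃ₗᵢ[ℝ] V} {l : List (simpleRefl A c₀)} {H : Submodule ℝ V}
    (h : H ∈ crossed g l) : ∃ a s b, l = a ++ s :: b ∧ H = act (g * wordProd a) (wall s) := by
  obtain ⟨u, v, huv⟩ := List.append_of_mem h
  obtain ⟨a, b, rfl, -, h2⟩ := crossed_eq_append huv
  cases b with
  | nil => simp [crossed] at h2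
  | cons s b =>
    simp only [crossed, List.cons.injEq] at h2
    exact ⟨a, s, b, rfl, h2.1.symm⟩

theorem crossed_subset (hinv : ∀ H ∈ A, Preserves A H.reflection) {g : V ≃ₗᵢ[ℝ] V}
    (hg : g ∈ reflGroup A) (l : List (simpleRefl A c₀)) : ∀ H ∈ crossed g l, H ∈ A := by
  intro H hH
  obtain ⟨a, s, b, -, rfl⟩ := mem_crossed hH
  exact (preserves_of_mem_reflGroup hinv (mul_mem hg (wordProd_mem_reflGroup a)) _).2 (wall_mem s)

/-- Translate by `g` the fact that a simple reflection crosses only its own wall. -/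
theorem sep₁_mul_simple (hA : IsArrangement A) (hinv : ∀ H ∈ A, Preserves A H.reflection)
    {g : V ≃ₗᵢ[ℝ] V} (hg : g ∈ reflGroup A) (s : simpleRefl A c₀) :
    sep₁ A (g '' c₀.1) ((g * s.1 : V ≃ₗᵢ[ℝ] V) '' c₀.1) = {act g (wall s)} := by
  rw [image_mul, reflection_wall, (preserves_of_mem_reflGroup hinv hg).sep₁_image,
    sep₁_reflection hA (wall_mem s) (hinv _ (wall_mem s)) (incident_wall s), Set.image_singleton]

/-- A word of minimal length among the words with the same product. -/
def Reduced (l : List (simpleRefl A c₀)) : Prop :=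
  ∀ l' : List (simpleRefl A c₀), wordProd l' = wordProd l → l.length ≤ l'.length

theorem Reduced.of_append {l l' : List (simpleRefl A c₀)} (h : Reduced (l ++ l')) : Reduced l := by
  intro m hm
  have := h (m ++ l') (by rw [wordProd_append, wordProd_append, hm])
  simpa using this

/-- The exchange argument: a reduced word does not cross a hyperplane twice. -/
theorem Reduced.notMem_crossed {l : List (simpleRefl A c₀)} {s : simpleRefl A c₀}
    (h : Reduced (l ++ [s])) : act (wordProd l) (wall s) ∉ crossed 1 l := by
  intro hmem
  obtain ⟨a, t, b, rfl, hst⟩ := mem_crossed hmem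
  have h1 := congrArg (fun K : Submodule ℝ V => K.reflection) hst
  simp only [one_mul, reflection_act, ← reflection_wall] at h1
  -- Crossing a hyperplane twice makes two conjugates of generators equal, so the two letters `t`
  -- and `s` can be deleted, contradicting minimal length.
  have h2 : wordProd (a ++ t :: b ++ [s]) = wordProd (a ++ b) := by
    have h3 : wordProd (a ++ t :: b) * s.1 = wordProd a * t.1 * (wordProd a)⁻¹ *
        wordProd (a ++ t :: b) := by
      rw [← h1]
      group
    rw [wordProd_append _ [s], wordProd_singleton, h3, wordProd_append, wordProd_append,
      wordProd_cons]
    have h4 := simple_mul_self t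
    calc wordProd a * t.1 * (wordProd a)⁻¹ * (wordProd a * (t.1 * wordProd b))
        = wordProd a * (t.1 * t.1) * wordProd b := by group
      _ = _ := by rw [h4, mul_one]
  have := h _ h2.symm
  simp at this

/-- By the exchange argument each new letter crosses a hyperplane not met before, so the separating
set grows by exactly that hyperplane. -/
theorem Reduced.isGalleryList (hA : IsArrangement A) (hinv : ∀ H ∈ A, Preserves A H.reflection)
    (hf : ∀ H ∈ A, LinearMap.ker (f H) = H) (hc₀ : c₀.1 = cell A f ∅)
    {l : List (simpleRefl A c₀)} (h : Reduced l) : IsGalleryList A f (crossed 1 l) ∧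
      Traces A f (crossed 1 l) (fun k => wordProd (l.take k) '' c₀.1) := by
  suffices hs : (crossed 1 l).Nodup ∧
      Traces A f (crossed 1 l) (fun k => wordProd (l.take k) '' c₀.1) by
    refine ⟨⟨hs.1, crossed_subset hinv (one_mem _) l, fun k => ?_⟩, hs.2⟩
    rw [← hs.2 k]
    exact c₀.nonempty.image _
  induction l using List.reverseRecOn with
  | nil =>
    refine ⟨by simp [crossed], fun k => ?_⟩
    simp only [List.take_nil, wordProd_nil, crossed, hc₀]
    simp only [LinearIsometryEquiv.coe_one, Set.image_id]
    exact cell_congr fun H _ => by simp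
  | append_singleton l s ih =>
    obtain ⟨ih1, ih2⟩ := ih h.of_append
    have hn := h.notMem_crossed
    have hcr : crossed 1 (l ++ [s]) = crossed 1 l ++ [act (wordProd l) (wall s)] := by
      rw [crossed_append, one_mul]
      rfl
    have hg := wordProd_mem_reflGroup l
    refine ⟨?_, fun k => ?_⟩
    · rw [hcr, List.nodup_append]
      refine ⟨ih1, by simp, fun a ha b hb => ?_⟩
      rw [List.mem_singleton] at hb
      rintro rfl
      exact hn (hb ▸ ha)
    · rw [hcr]
      change wordProd (List.take k (l ++ [s])) '' c₀.1 = _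
      rcases le_or_gt k l.length with hk | hk
      · rw [List.take_append_of_le_length hk,
          List.take_append_of_le_length (by rwa [length_crossed])]
        exact ih2 k
      · rw [List.take_of_length_le (by simpa using Nat.succ_le_of_lt hk),
          List.take_of_length_le (by simpa [length_crossed] using Nat.succ_le_of_lt hk)]
        set c := (preserves_of_mem_reflGroup hinv hg).chamber c₀
        set c' := (preserves_of_mem_reflGroup hinv
          (wordProd_mem_reflGroup (l ++ [s]))).chamber c₀
        have h1 : c.1 = cell A f {H | H ∈ crossed 1 l} := by
          have : wordProd (l.take l.length) '' c₀.1 = _ := ih2 l.length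
          rw [List.take_of_length_le le_rfl,
            List.take_of_length_le (length_crossed _ _).le] at this
          exact this
        have h2 : sep₁ A c.1 c'.1 = {act (wordProd l) (wall s)} := by
          have := sep₁_mul_simple hA hinv hg s
          rwa [← wordProd_singleton s, ← wordProd_append] at this
        have h3 := sep₁_eq hf hc₀ c c'
        rw [h2] at h3
        change c'.1 = _
        rw [chamber_eq_cell hf hc₀ c']
        refine cell_congr fun H hH => ?_
        have h4 : H ∈ crossed 1 l ↔ H ∈ sep₁ A c₀.1 c.1 := by
          have := (cell_congr_iff (h1 ▸ c.nonempty)).1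
            (h1.symm.trans (chamber_eq_cell hf hc₀ c)) H hH
          exact this
        have h5 : H = act (wordProd l) (wall s) ↔
            ¬ (H ∈ sep₁ A c₀.1 c.1 ↔ H ∈ sep₁ A c₀.1 c'.1) := by
          have := Set.ext_iff.1 h3 H
          simpa [hH] using this
        simp only [Set.mem_ofPred_eq, List.mem_append, List.mem_singleton, h5, h4]
        by_cases h6 : H = act (wordProd l) (wall s)
        · have h7 := h4.not.1 (h6 ▸ hn)
          tauto
        · tauto

/-- Every gallery list is the list of hyperplanes crossed by a word. -/
theorem exists_word (hA : IsArrangement A) (hinv : ∀ H ∈ A, Preserves A H.reflection)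
    (hf : ∀ H ∈ A, LinearMap.ker (f H) = H)
    (hc₀ : c₀.1 = cell A f ∅) {l : List (Submodule ℝ V)} (hl : IsGalleryList A f l) :
    ∃ m : List (simpleRefl A c₀), crossed 1 m = l ∧
      wordProd m '' c₀.1 = cell A f {H | H ∈ l} := by
  induction l using List.reverseRecOn with
  | nil =>
    refine ⟨[], rfl, ?_⟩
    simp only [wordProd_nil, hc₀, LinearIsometryEquiv.coe_one, Set.image_id]
    exact cell_congr fun H _ => by simp
  | append_singleton l H ih =>
    have hl' : IsGalleryList A f l := by
      refine ⟨(List.nodup_append.1 hl.nodup).1, fun K hK => hl.subset K (by simp [hK]),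
        fun k => ?_⟩
      rcases le_total k l.length with hk | hk
      · have := hl.nonempty k
        rwa [List.take_append_of_le_length hk] at this
      · rw [List.take_of_length_le hk]
        exact hl.nonempty_of_append
    obtain ⟨m, hm1, hm2⟩ := ih hl'
    have hHl : H ∉ l := fun h => (List.nodup_append.1 hl.nodup).2.2 H h H (by simp) rfl
    have hHA : H ∈ A := hl.subset H (by simp)
    set g := wordProd m
    have hg : Preserves A g := preserves_of_mem_reflGroup hinv (wordProd_mem_reflGroup m)
    have hne : (cell A f {K | K ∈ l ++ [H]}).Nonempty := by
      have h' : IsGalleryList A f ((l ++ [H]) ++ []) := by simpa using hl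
      exact h'.nonempty_of_append
    let c' : Chamber A := cellChamber hf hne
    have h1 : sep₁ A (g '' c₀.1) c'.1 = {H} := by
      rw [hm2]
      refine (sep₁_cell hf (hm2 ▸ c₀.nonempty.image _) hne).trans ?_
      ext K
      simp only [List.mem_append, List.mem_singleton, Set.mem_ofPred_eq, Set.mem_singleton_iff]
      constructor
      · rintro ⟨-, h⟩
        tauto
      · rintro rfl
        exact ⟨hHA, by tauto⟩
    -- Pulled back by `g⁻¹`, the last step starts at `c₀`. The hyperplane crossed there is a wall,
    -- and its reflection is the missing letter.
    let c : Chamber A := hg.inv.chamber c'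
    have hgc : g '' c.1 = c'.1 := by
      exact image_image_inv g c'.1
    have h2 : sep₁ A c₀.1 c.1 = {act g⁻¹ H} := by
      have := hg.inv.sep₁_image (g '' c₀.1) c'.1
      rwa [h1, Set.image_singleton, image_inv_image] at this
    have hinc := incident_of_sep₁_eq hA h2
    have hKA : act g⁻¹ H ∈ A := (hg.inv H).2 hHA
    let s : simpleRefl A c₀ := ⟨(act g⁻¹ H).reflection, act g⁻¹ H, hKA, hinc, rfl⟩
    have hws : wall s = act g⁻¹ H := reflection_injective (reflection_wall s).symm
    have hsc : (hinv _ hKA).chamber c₀ = c := by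
      apply chamber_eq_of_sep₁ (c₀ := c₀) hA
      rw [h2]
      exact sep₁_reflection hA hKA (hinv _ hKA) hinc
    refine ⟨m ++ [s], ?_, ?_⟩
    · rw [crossed_append, hm1, one_mul, crossed, crossed, hws, act_act_inv]
    · rw [wordProd_append, wordProd_singleton]
      have h3 : (s.1 : V ≃ₗᵢ[ℝ] V) '' c₀.1 = c.1 := congrArg Subtype.val hsc
      rw [image_mul, h3, hgc]
      rfl

/-- A gallery from `c₀` to the opposite chamber crosses every hyperplane. So each hyperplane is a
translate of a wall by a word, and its reflection is a conjugate of a generator. -/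
theorem reflection_eq_wordProd (hA : IsArrangement A)
    (hinv : ∀ H ∈ A, Preserves A H.reflection) (hf : ∀ H ∈ A, LinearMap.ker (f H) = H)
    (hc₀ : c₀.1 = cell A f ∅)
    (hconn : ∀ c : Chamber A, ∃ l, IsGalleryList A f l ∧ c.1 = cell A f {H | H ∈ l})
    {H : Submodule ℝ V} (hH : H ∈ A) :
    ∃ m : List (simpleRefl A c₀), wordProd m = H.reflection := by
  obtain ⟨x, hx⟩ := c₀.nonempty
  have hneg : (cell A f A).Nonempty := by
    refine ⟨-x, fun K hK => ⟨fun _ => ?_, fun h => absurd hK h⟩⟩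
    rw [map_neg, neg_lt_zero]
    exact ((hc₀ ▸ hx : x ∈ cell A f ∅) K hK).2 (by simp)
  obtain ⟨l, hl, hlc⟩ := hconn (cellChamber hf hneg)
  obtain ⟨m, hm, -⟩ := exists_word hA hinv hf hc₀ hl
  have hHl : H ∈ crossed 1 m := by
    rw [hm]
    exact ((cell_congr_iff hneg).1 hlc H hH).1 hH
  obtain ⟨a, s, b, -, hs⟩ := mem_crossed hHl
  refine ⟨a ++ s :: a.reverse, ?_⟩
  rw [hs, reflection_act, wordProd_append, wordProd_cons, wordProd_reverse, reflection_wall]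
  group

theorem exists_reduced (hgen : ∀ H ∈ A, ∃ m : List (simpleRefl A c₀), wordProd m = H.reflection)
    {g : V ≃ₗᵢ[ℝ] V} (hg : g ∈ reflGroup A) :
    ∃ m : List (simpleRefl A c₀), wordProd m = g ∧ Reduced m := by
  classical
  have hex : ∃ m : List (simpleRefl A c₀), wordProd m = g := by
    induction hg using Subgroup.closure_induction with
    | mem x hx =>
      obtain ⟨H, hH, rfl⟩ := hx
      exact hgen H hH
    | one => exact ⟨[], rfl⟩
    | mul x y _ _ hx hy =>
      obtain ⟨m, rfl⟩ := hx
      obtain ⟨m', rfl⟩ := hy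
      exact ⟨m ++ m', wordProd_append _ _⟩
    | inv x _ hx =>
      obtain ⟨m, rfl⟩ := hx
      exact ⟨m.reverse, wordProd_reverse _⟩
  have hex' : ∃ n, ∃ m : List (simpleRefl A c₀), wordProd m = g ∧ m.length = n := by
    obtain ⟨m, hm⟩ := hex
    exact ⟨_, m, hm, rfl⟩
  obtain ⟨m, hm, hlen⟩ := Nat.find_spec hex'
  refine ⟨m, hm, fun m' hm' => ?_⟩
  rw [hlen]
  exact Nat.find_min' hex' ⟨m', hm'.trans hm, rfl⟩

/-- The reflection group acts freely on the chambers. -/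
theorem eq_of_image_eq (hA : IsArrangement A) (hinv : ∀ H ∈ A, Preserves A H.reflection)
    (hf : ∀ H ∈ A, LinearMap.ker (f H) = H) (hc₀ : c₀.1 = cell A f ∅)
    (hgen : ∀ H ∈ A, ∃ m : List (simpleRefl A c₀), wordProd m = H.reflection)
    {g h : V ≃ₗᵢ[ℝ] V} (hg : g ∈ reflGroup A) (hh : h ∈ reflGroup A)
    (heq : g '' c₀.1 = h '' c₀.1) : g = h := by
  -- A reduced word for `h⁻¹ * g` returns to `c₀`, so it crosses nothing and must be empty.
  obtain ⟨m, hm, hred⟩ := exists_reduced hgen (mul_mem (inv_mem hh) hg)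
  obtain ⟨h1, h2⟩ := hred.isGalleryList hA hinv hf hc₀
  have h3 : wordProd m '' c₀.1 = c₀.1 := by
    rw [hm, image_mul, heq, image_inv_image]
  have h4 := h2 m.length
  simp only [List.take_length] at h4
  rw [List.take_of_length_le (length_crossed _ _).le, h3, hc₀] at h4
  have h5 := (cell_congr_iff (hc₀ ▸ c₀.nonempty)).1 h4
  have h6 : crossed 1 m = [] := by
    rw [List.eq_nil_iff_forall_not_mem]
    intro H hH
    exact (h5 H (h1.subset H hH)).2 hH
  have h7 : m = [] := by
    rw [← List.length_eq_zero_iff, ← length_crossed 1 m, h6]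
    rfl
  rw [h7, wordProd_nil] at hm
  exact (inv_mul_eq_one.1 hm.symm).symm

end Words

end GalleryGraph

namespace GalleryGraph

/-! ### Alternating words and orders of products of two generators. -/

section Alternating

open CoxeterSystem

/-- Two letters without equal neighbours leave only the choice of the last letter; `alternatingWord
s t` ends in `t`. -/
theorem eq_alternatingWord {α : Type*} {s t : α} {l : List α} (hl : ∀ r ∈ l, r = s ∨ r = t)
    (hc : l.IsChain (· ≠ ·)) :
    l = alternatingWord s t l.length ∨ l = alternatingWord t s l.length := by
  have key : ∀ (l : List α) (s t : α), (∀ r ∈ l ++ [t], r = s ∨ r = t) →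
      (l ++ [t]).IsChain (· ≠ ·) → l ++ [t] = alternatingWord s t (l.length + 1) := by
    intro l
    induction l using List.reverseRecOn with
    | nil =>
      intro s t _ _
      simp [alternatingWord]
    | append_singleton l r ih =>
      intro s t h1 h2
      have hr : r ≠ t := by
        rw [List.append_assoc, List.isChain_append] at h2
        simpa using h2.2.1
      have hrs : r = s := (h1 r (by simp)).resolve_right hr
      subst hrs
      rw [alternatingWord_succ, List.concat_eq_append, List.length_append, List.length_singleton,
        ← ih t r (fun q hq => (h1 q (by simp at hq ⊢; tauto)).symm)
          (List.isChain_append.1 h2).1]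
  rcases List.eq_nil_or_concat l with rfl | ⟨l', r, rfl⟩
  · left; rfl
  · rw [List.concat_eq_append] at hl hc ⊢
    rw [List.length_append, List.length_singleton]
    rcases hl r (by simp) with rfl | rfl
    · exact Or.inr (key l' _ _ (fun q hq => (hl q hq).symm) hc)
    · exact Or.inl (key l' _ _ hl hc)

theorem mem_alternatingWord {α : Type*} {s t r : α} {m : ℕ} (h : r ∈ alternatingWord s t m) :
    r = s ∨ r = t := by
  induction m generalizing s t with
  | zero => simp [alternatingWord] at h
  | succ m ih =>
    rw [alternatingWord_succ, List.concat_eq_append, List.mem_append, List.mem_singleton] at h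
    rcases h with h | h
    · exact (ih h).symm
    · exact Or.inr h

theorem exists_append_alternatingWord {α : Type*} (s t : α) {k m : ℕ} (h : k ≤ m) :
    ∃ z, alternatingWord s t m = z ++ alternatingWord s t k := by
  induction m, h using Nat.le_induction with
  | base => exact ⟨[], rfl⟩
  | succ m _ ih =>
    obtain ⟨z, hz⟩ := ih
    exact ⟨_ :: z, by rw [alternatingWord_succ', hz]; rfl⟩

variable {V : Type*} [NormedAddCommGroup V] [InnerProductSpace ℝ V] [FiniteDimensional ℝ V]

variable {A : Set (Submodule ℝ V)} {c₀ : Chamber A}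

theorem wordProd_alternatingWord_succ (s t : simpleRefl A c₀) (m : ℕ) :
    wordProd (alternatingWord s t (m + 1)) = wordProd (alternatingWord t s m) * t.1 := by
  rw [alternatingWord_succ, List.concat_eq_append, wordProd_append, wordProd_singleton]

theorem inv_mul_wordProd_alternatingWord (s t : simpleRefl A c₀) (m : ℕ) :
    (wordProd (alternatingWord s t m))⁻¹ * wordProd (alternatingWord t s m) =
      (t.1 * s.1) ^ m := by
  induction m generalizing s t with
  | zero => simp [alternatingWord, wordProd_nil]
  | succ m ih =>
    rw [wordProd_alternatingWord_succ, wordProd_alternatingWord_succ, mul_inv_rev,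
      inv_eq_of_mul_eq_one_left (simple_mul_self t)]
    calc t.1 * (wordProd (alternatingWord t s m))⁻¹ * (wordProd (alternatingWord s t m) * s.1)
        = t.1 * ((wordProd (alternatingWord t s m))⁻¹ * wordProd (alternatingWord s t m)) *
          s.1 := by group
      _ = t.1 * (s.1 * t.1) ^ m * s.1 := by rw [ih]
      _ = (t.1 * s.1) ^ (m + 1) := by
        rw [pow_succ, ← mul_assoc]
        congr 1
        exact (SemiconjBy.pow_right (show SemiconjBy t.1 (s.1 * t.1) (t.1 * s.1) from
          (mul_assoc _ _ _).symm) m)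

/-- If a reduced word contains an alternating factor that can be replaced by the other alternating
word of the same length, then this length is the order of the product of the two generators. -/
theorem orderOf_eq_of_reduced {a e : List (simpleRefl A c₀)} {s t : simpleRefl A c₀} {m : ℕ}
    (hm : 0 < m) (hred : Reduced (a ++ alternatingWord s t m ++ e))
    (h : wordProd (alternatingWord s t m) = wordProd (alternatingWord t s m)) :
    orderOf (t.1 * s.1) = m := by
  have h1 : (t.1 * s.1) ^ m = 1 := by
    rw [← inv_mul_wordProd_alternatingWord, h, inv_mul_cancel]
  have hle := orderOf_le_of_pow_eq_one hm h1
  have hpos : 0 < orderOf (t.1 * s.1) :=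
    orderOf_pos_iff.2 (isOfFinOrder_iff_pow_eq_one.2 ⟨m, hm, h1⟩)
  by_contra hne
  obtain ⟨k, hk⟩ := Nat.exists_eq_succ_of_ne_zero hpos.ne'
  have h2 : (t.1 * s.1) ^ (k + 1) = 1 := by
    rw [← Nat.succ_eq_add_one, ← hk, pow_orderOf_eq_one]
  rw [← inv_mul_wordProd_alternatingWord, inv_mul_eq_one] at h2
  -- If the order were `k + 1 < m`, the factor would end in an alternating word of length `k + 2`
  -- whose product is also represented by one of length `k`, contradicting reducedness.
  obtain ⟨z, hz⟩ := exists_append_alternatingWord s t (k := k + 2) (m := m) (by omega)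
  have h3 : wordProd (alternatingWord s t (k + 2)) = wordProd (alternatingWord t s k) := by
    rw [wordProd_alternatingWord_succ, ← h2, wordProd_alternatingWord_succ, mul_assoc,
      simple_mul_self, mul_one]
  have h4 := hred (a ++ (z ++ alternatingWord t s k) ++ e) (by
    rw [hz]
    simp only [wordProd_append, h3])
  rw [hz] at h4
  simp only [List.length_append, length_alternatingWord] at h4
  omega

end Alternating

/-! ### Pencil rearrangements and braid moves. -/

section Braids

open CoxeterSystem

variable {V : Type*} [NormedAddCommGroup V] [InnerProductSpace ℝ V] [FiniteDimensional ℝ V]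

variable {A : Set (Submodule ℝ V)} {f : Submodule ℝ V → V →ₗ[ℝ] ℝ} {c₀ : Chamber A}

/-- The reflection in a wall whose translate contains `X` fixes the corresponding translate of `X`
pointwise. -/
theorem le_act_mul_simple_iff {g : V ≃ₗᵢ[ℝ] V} {s : simpleRefl A c₀} {X K : Submodule ℝ V}
    (h : X ≤ act g (wall s)) : X ≤ act (g * s.1) K ↔ X ≤ act g K := by
  refine forall₂_congr fun v hv => ?_
  rw [mem_act, mem_act, mul_inv_rev, LinearIsometryEquiv.coe_mul, Function.comp_apply,
    inv_eq_of_mul_eq_one_left (simple_mul_self s), reflection_wall,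
    Submodule.reflection_mem_subspace_eq_self (mem_act.1 (h hv))]

/-- If all hyperplanes crossed by a word contain `X`, then so do the walls of its letters. -/
theorem le_crossed_iff {g : V ≃ₗᵢ[ℝ] V} {X : Submodule ℝ V} {l : List (simpleRefl A c₀)} :
    (∀ H ∈ crossed g l, X ≤ H) ↔ ∀ s ∈ l, X ≤ act g (wall s) := by
  induction l generalizing g with
  | nil => simp [crossed]
  | cons s l ih =>
    simp only [crossed, List.forall_mem_cons]
    refine and_congr_right fun h => ?_
    rw [ih]
    exact forall₂_congr fun t _ => le_act_mul_simple_iff h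

/-- Repeating a letter would cross the same wall back immediately. -/
theorem isChain_of_nodup_crossed {g : V ≃ₗᵢ[ℝ] V} {l : List (simpleRefl A c₀)}
    (h : (crossed g l).Nodup) : l.IsChain (· ≠ ·) := by
  induction l generalizing g with
  | nil => simp
  | cons s l ih =>
    cases l with
    | nil => simp
    | cons t l =>
      rw [List.isChain_cons_cons]
      simp only [crossed, List.nodup_cons] at h
      refine ⟨?_, ih (g := g * s.1) (by simp only [crossed, List.nodup_cons]; exact h.2)⟩
      rintro rfl
      refine h.1 (List.mem_cons.2 (Or.inl ?_))
      rw [act_mul]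
      congr 1
      ext v
      rw [mem_act, inv_eq_of_mul_eq_one_left (simple_mul_self s), reflection_wall]
      constructor
      · intro hv
        rwa [Submodule.reflection_mem_subspace_eq_self hv]
      · intro hv
        have := Submodule.reflection_mem_subspace_eq_self hv
        rw [Submodule.reflection_reflection] at this
        exact this ▸ hv

/-- Two reduced words of the same element whose crossing lists differ by rearranging the
hyperplanes through a codimension two subspace are related by a braid move. -/
theorem braidMove_of_crossed (hA : IsArrangement A)
    (hinv : ∀ H ∈ A, Preserves A H.reflection) (hf : ∀ H ∈ A, LinearMap.ker (f H) = H)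
    (hc₀ : c₀.1 = cell A f ∅)
    (hgen : ∀ H ∈ A, ∃ m : List (simpleRefl A c₀), wordProd m = H.reflection)
    {l l' : List (simpleRefl A c₀)} (hl : Reduced l) (hl' : Reduced l')
    {u x x' v : List (Submodule ℝ V)} {X : Submodule ℝ V}
    (hX : Module.finrank ℝ X + 2 = Module.finrank ℝ V)
    (h : crossed 1 l = u ++ x ++ v) (h' : crossed 1 l' = u ++ x' ++ v)
    (hlen : x'.length = x.length) (hx : ∀ H ∈ A, H ∈ x ↔ X ≤ H) (hx' : ∀ H ∈ A, H ∈ x' ↔ X ≤ H)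
    (hhead : x.head? ≠ x'.head?) : BraidMove l l' := by
  have hg1 := hl.isGalleryList hA hinv hf hc₀
  have hg2 := hl'.isGalleryList hA hinv hf hc₀
  obtain ⟨ab, e, rfl, hab, he⟩ := crossed_eq_append h
  obtain ⟨a, b, rfl, ha, hb⟩ := crossed_eq_append hab
  obtain ⟨ab', e', rfl, hab', he'⟩ := crossed_eq_append h'
  obtain ⟨a', b', rfl, ha', hb'⟩ := crossed_eq_append hab'
  obtain rfl := crossed_injective _ (ha.trans ha'.symm)
  -- Both prefixes have crossed the same hyperplanes, so they end in the same chamber, and the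
  -- action is free.
  have hwin : wordProd (a ++ b) = wordProd (a ++ b') := by
    refine eq_of_image_eq hA hinv hf hc₀ hgen (wordProd_mem_reflGroup _)
      (wordProd_mem_reflGroup _) ?_
    have h1 : wordProd ((a ++ b ++ e).take (a ++ b).length) '' c₀.1 = _ := hg1.2 (a ++ b).length
    have h2 : wordProd ((a ++ b' ++ e').take (a ++ b').length) '' c₀.1 = _ :=
      hg2.2 (a ++ b').length
    rw [List.take_left, h, List.take_left' (by rw [← hab, length_crossed])] at h1
    rw [List.take_left, h', List.take_left' (by rw [← hab', length_crossed])] at h2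
    rw [h1, h2]
    refine cell_congr fun H hH => ?_
    simp [hx H hH, hx' H hH]
  obtain rfl : e = e' := crossed_injective _ (he.trans (by rw [← he', hwin]))
  have hprod : wordProd b = wordProd b' := by
    rw [wordProd_append, wordProd_append] at hwin
    exact mul_left_cancel hwin
  rw [one_mul] at hb hb'
  set g := wordProd a
  have hg : Preserves A g := preserves_of_mem_reflGroup hinv (wordProd_mem_reflGroup a)
  have hxA : ∀ H ∈ x, H ∈ A := fun H hH => hg1.1.subset H (by rw [h]; simp [hH])
  have hxA' : ∀ H ∈ x', H ∈ A := fun H hH => hg2.1.subset H (by rw [h']; simp [hH])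
  have hbX : ∀ s ∈ b, X ≤ act g (wall s) :=
    le_crossed_iff.1 fun H hH => by rw [hb] at hH; exact (hx H (hxA H hH)).1 hH
  have hbX' : ∀ s ∈ b', X ≤ act g (wall s) :=
    le_crossed_iff.1 fun H hH => by rw [hb'] at hH; exact (hx' H (hxA' H hH)).1 hH
  have hlb : b'.length = b.length := by
    rw [← length_crossed g b, ← length_crossed g b', hb, hb', hlen]
  have hndx : x.Nodup := by
    have := hg1.1.nodup
    rw [h] at this
    exact (List.nodup_append.1 (List.nodup_append.1 this).1).2.1
  have hndx' : x'.Nodup := by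
    have := hg2.1.nodup
    rw [h'] at this
    exact (List.nodup_append.1 (List.nodup_append.1 this).1).2.1
  have hchain : b.IsChain (· ≠ ·) := isChain_of_nodup_crossed (hb ▸ hndx)
  have hchain' : b'.IsChain (· ≠ ·) := isChain_of_nodup_crossed (hb' ▸ hndx')
  cases b with
  | nil =>
    have : b' = [] := List.length_eq_zero_iff.1 (by simpa using hlb)
    subst this
    simp only [crossed] at hb hb'
    exact absurd (by rw [← hb, ← hb']) hhead
  | cons s b₁ =>
  cases b' with
  | nil => simp at hlb
  | cons t b₁' =>
  have hst : s ≠ t := by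
    rintro rfl
    refine hhead ?_
    rw [← hb, ← hb']
    simp [crossed]
  have hco : ∀ r : simpleRefl A c₀, IsCoatom (act g (wall r)) := fun r =>
    hA.hyperplane _ ((hg _).2 (wall_mem r))
  have hXst : X = act g (wall s) ⊓ act g (wall t) :=
    inf_eq_of_finrank (hco s) (hco t) (fun h => hst (wall_injective (act_injective g h))) hX
      (hbX s (by simp)) (hbX' t (by simp))
  -- Pulled back by `g`, the walls of all letters in the factor contain one codimension two
  -- subspace, and a chamber has only two such walls once two are known.
  have hletter : ∀ r : simpleRefl A c₀, X ≤ act g (wall r) → r = s ∨ r = t := by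
    intro r hr
    have h1 : wall s ⊓ wall t ≤ wall r := by
      rw [← act_le_act_iff (g := g)]
      refine le_trans ?_ hr
      rw [hXst]
      exact le_inf (act_le_act_iff.2 inf_le_left) (act_le_act_iff.2 inf_le_right)
    rcases wall_eq_or_eq hA (wall_mem r) (wall_mem s) (wall_mem t) (incident_wall r)
      (incident_wall s) (incident_wall t) h1 with h | h
    · exact Or.inl (wall_injective h)
    · exact Or.inr (wall_injective h)
  have e1 := eq_alternatingWord (fun r hr => hletter r (hbX r hr)) hchain
  have e2 := eq_alternatingWord (fun r hr => hletter r (hbX' r hr)) hchain'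
  rw [hlb] at e2
  have hpos : 0 < (s :: b₁).length := by simp
  have hneq : s :: b₁ ≠ t :: b₁' := fun h => hst (List.cons.inj h).1
  set m := (s :: b₁).length
  rcases e1 with e1 | e1 <;> rcases e2 with e2 | e2
  · exact absurd (e1.trans e2.symm) hneq
  · rw [e1, e2] at hprod
    rw [e1] at hl
    rw [e2] at hl'
    -- The second word is used here because its alternating factor yields the order of the product
    -- in the sequence required by `BraidMove`.
    have ho := orderOf_eq_of_reduced hpos hl' hprod.symm
    exact ⟨a, e, s, t, hst, by rw [ho, e1], by rw [ho, e2]⟩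
  · rw [e1, e2] at hprod
    rw [e1] at hl
    rw [e2] at hl'
    have ho := orderOf_eq_of_reduced hpos hl' hprod.symm
    exact ⟨a, e, t, s, hst.symm, by rw [ho, e1], by rw [ho, e2]⟩
  · exact absurd (e1.trans e2.symm) hneq

/-- A braid move changes the crossing order along at most one codimension two subspace. -/
theorem listSep_subset_of_braidMove (hA : IsArrangement A)
    (hinv : ∀ H ∈ A, Preserves A H.reflection) (hf : ∀ H ∈ A, LinearMap.ker (f H) = H)
    (hc₀ : c₀.1 = cell A f ∅) {l l' : List (simpleRefl A c₀)} (hl : Reduced l) (hl' : Reduced l')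
    (heq : wordProd l = wordProd l') (h : BraidMove l l') (c c' : Set V) :
    ∃ X, listSep A c c' (crossed 1 l) (crossed 1 l') ⊆ {X} := by
  have hg1 := hl.isGalleryList hA hinv hf hc₀
  have hg2 := hl'.isGalleryList hA hinv hf hc₀
  have hmem : ∀ H, H ∈ crossed 1 l ↔ H ∈ crossed 1 l' := by
    have h1 : wordProd (l.take l.length) '' c₀.1 = _ := hg1.2 l.length
    have h2 : wordProd (l'.take l'.length) '' c₀.1 = _ := hg2.2 l'.length
    rw [List.take_length, List.take_of_length_le (length_crossed _ _).le] at h1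
    rw [List.take_length, List.take_of_length_le (length_crossed _ _).le, ← heq] at h2
    have h3 := (cell_congr_iff (h1 ▸ c₀.nonempty.image _)).1 (h1.symm.trans h2)
    exact fun H => ⟨fun h => (h3 H (hg1.1.subset H h)).1 h, fun h => (h3 H (hg2.1.subset H h)).2 h⟩
  obtain ⟨a, e, s, t, hst, rfl, rfl⟩ := h
  set m := orderOf (s.1 * t.1)
  set g := wordProd a
  have hg : Preserves A g := preserves_of_mem_reflGroup hinv (wordProd_mem_reflGroup a)
  have hprod : wordProd (alternatingWord s t m) = wordProd (alternatingWord t s m) := by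
    simpa [wordProd_append] using heq
  have hX : ∀ {s t : simpleRefl A c₀}, ∀ H ∈ crossed g (alternatingWord s t m),
      act g (wall s ⊓ wall t) ≤ H := by
    intro s t
    refine le_crossed_iff.2 fun r hr => act_le_act_iff.2 ?_
    rcases mem_alternatingWord hr with rfl | rfl
    · exact inf_le_left
    · exact inf_le_right
  have hcr : ∀ b : List (simpleRefl A c₀), crossed 1 (a ++ b ++ e) =
      crossed 1 a ++ crossed g b ++ crossed (g * wordProd b) e := fun b => by
    simp only [crossed_append, wordProd_append, one_mul, g]
  have nd1 := hg1.1.nodup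
  have nd2 := hg2.1.nodup
  rw [hcr] at nd1 nd2
  rw [hcr, hcr, ← hprod] at hmem
  rw [hcr, hcr, ← hprod]
  rw [← hprod] at nd2
  refine ⟨act g (wall s ⊓ wall t), listSep_subset_singleton hA ?_ hX (fun G => ?_) nd1 nd2⟩
  · rw [finrank_act]
    exact finrank_inf_add_two (hA.hyperplane _ (wall_mem s)) (hA.hyperplane _ (wall_mem t))
      fun h => hst (wall_injective h)
  · have h1 := hmem G
    simp only [List.mem_append] at h1
    simp only [List.nodup_append, List.mem_append] at nd1 nd2
    constructor
    · intro hG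
      have h2 : G ∉ crossed 1 a := fun h' => nd1.1.2.2 G h' G hG rfl
      have h3 : G ∉ crossed (g * wordProd (alternatingWord s t m)) e :=
        fun h' => nd1.2.2 G (Or.inr hG) G h' rfl
      tauto
    · intro hG
      have h2 : G ∉ crossed 1 a := fun h' => nd2.1.2.2 G h' G hG rfl
      have h3 : G ∉ crossed (g * wordProd (alternatingWord s t m)) e :=
        fun h' => nd2.2.2 G (Or.inr hG) G h' rfl
      tauto

end Braids

/-! ### The bounds for reduced words. -/

section ReflectionBounds

variable {V : Type*} [NormedAddCommGroup V] [InnerProductSpace ℝ V] [FiniteDimensional ℝ V]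

/-- Reduced words of `w` correspond to gallery lists from `c₀` to `w c₀`, so the list argument
carries over. Flips become braid moves, and each braid move changes the crossing order along at most
one subspace. -/
theorem reflection_bounds {A : Set (Submodule ℝ V)} (hA : IsArrangement A) (c₀ : Chamber A)
    (hinv : ∀ H ∈ A, Preserves A H.reflection) {w : V ≃ₗᵢ[ℝ] V} (hw : w ∈ reflGroup A)
    (F : Fin (Module.finrank ℝ V + 1) → Submodule ℝ V) (hF : IsModularFlag A F)
    (hinc : ∀ i, Incident c₀.1 (F i)) :
    (∃ r₀ : ReducedWord A c₀ w, r₀.IncidentTo F ∧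
      (∀ r : ReducedWord A c₀ w, r.IncidentTo F → r = r₀) ∧
      ∀ r r' : ReducedWord A c₀ w,
        (r.sep r').encard ≤ (wordGraph A c₀ w).edist r r' ∧
        (wordGraph A c₀ w).edist r r' ≤ (r₀.sep r).encard + (r₀.sep r').encard ∧
        (r₀.sep r).encard + (r₀.sep r').encard ≤ 2 * (elemSep₂ A c₀ w).encard) ∧
    (wordGraph A c₀ w).ediam ≤ 2 * (elemSep₂ A c₀ w).encard := by
  obtain ⟨f, hf, hc₀⟩ := c₀.exists_functionals hA
  have hconn : ∀ c : Chamber A, ∃ l, IsGalleryList A f l ∧ c.1 = cell A f {H | H ∈ l} := by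
    intro c
    obtain ⟨l, h1, h2, -⟩ := exists_base_list hA hf hc₀ hF hinc c
    exact ⟨l, h1, h2⟩
  have hgen : ∀ H ∈ A, ∃ m : List (simpleRefl A c₀), wordProd m = H.reflection :=
    fun H hH => reflection_eq_wordProd hA hinv hf hc₀ hconn hH
  let c : Chamber A := (preserves_of_mem_reflGroup hinv hw).chamber c₀
  obtain ⟨l₀, hl₀, hl₀c, hinc, hacc⟩ := exists_base_list hA hf hc₀ hF hinc c
  have hred : ∀ r : ReducedWord A c₀ w, Reduced r.1 := fun r l' h =>
    r.2.2 l' (h.trans r.2.1)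
  have hlist : ∀ r : ReducedWord A c₀ w, IsGalleryList A f (crossed 1 r.1) ∧
      Traces A f (crossed 1 r.1) r.seq := fun r => (hred r).isGalleryList hA hinv hf hc₀
  have hend : ∀ m : List (simpleRefl A c₀), Reduced m → wordProd m = w →
      c.1 = cell A f {H | H ∈ crossed 1 m} := by
    intro m hm hmw
    have h1 : wordProd (m.take m.length) '' c₀.1 = _ :=
      (hm.isGalleryList hA hinv hf hc₀).2 m.length
    rw [List.take_length, List.take_of_length_le (length_crossed _ _).le, hmw] at h1
    exact h1
  have hword : ∀ l, IsGalleryList A f l → c.1 = cell A f {H | H ∈ l} →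
      ∃ r : ReducedWord A c₀ w, crossed 1 r.1 = l := by
    intro l hl hlc
    obtain ⟨m, hm, hmc⟩ := exists_word hA hinv hf hc₀ hl
    have hmw : wordProd m = w := eq_of_image_eq hA hinv hf hc₀ hgen (wordProd_mem_reflGroup m) hw
      (hmc.trans hlc.symm)
    refine ⟨⟨m, hmw, fun m' hm' => ?_⟩, hm⟩
    obtain ⟨m₀, hm₀w, hm₀⟩ := exists_reduced hgen hw
    have h1 := mem_list_iff hf hc₀ (hm₀.isGalleryList hA hinv hf hc₀).1 (hend m₀ hm₀ hm₀w)
    have h2 := mem_list_iff hf hc₀ hl hlc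
    -- Both lists enumerate the hyperplanes separating `c₀` from `c`, so the word found has the
    -- minimal length.
    have h3 : l.Perm (crossed 1 m₀) :=
      (List.perm_ext_iff_of_nodup hl.nodup (hm₀.isGalleryList hA hinv hf hc₀).1.nodup).2
        fun H => by rw [h1, h2]
    have h4 := h3.length_eq
    rw [← hm, length_crossed, length_crossed] at h4
    rw [h4]
    exact hm₀ m' (hm'.trans hm₀w.symm)
  obtain ⟨r₀, hr₀⟩ := hword l₀ hl₀ hl₀c
  have heq : ∀ r : ReducedWord A c₀ w, crossed 1 r.1 = l₀ → r = r₀ := fun r hr =>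
    Subtype.ext (crossed_injective 1 (hr.trans hr₀.symm))
  have hsep : ∀ r r' : ReducedWord A c₀ w,
      r.sep r' = listSep A c₀.1 c.1 (crossed 1 r.1) (crossed 1 r'.1) := fun r r' =>
    pathSep_eq_listSep hf (hlist r).1 (hlist r').1 (hlist r).2 (hlist r').2
  have key := edist_bounds (wordGraph A c₀ w) ReducedWord.sep (elemSep₂ A c₀ w)
    (sep₂_finite hA _ _)
    (fun r r' X h => h.1) (fun r => pathSep_self _ _ _ _) (fun r r' r'' => pathSep_triangle _ _ _)
    (fun r r' h => by
      have hbraid : ∀ r r' : ReducedWord A c₀ w, BraidMove r.1 r'.1 →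
          (r.sep r').encard ≤ 1 := by
        intro r r' h
        obtain ⟨X, hX⟩ := listSep_subset_of_braidMove hA hinv hf hc₀ (hred r) (hred r')
          (r.2.1.trans r'.2.1.symm) h c₀.1 c.1
        rw [hsep]
        exact (Set.encard_le_encard hX).trans (Set.encard_singleton X).le
      rw [wordGraph, SimpleGraph.fromRel_adj] at h
      rcases h.2 with h | h
      · exact hbraid r r' h
      · rw [ReducedWord.sep, pathSep_comm]
        exact hbraid r' r h) r₀ fun r hr => by
      obtain ⟨u, x, x', v, X, h1, hl', hlc', hlen, hx, hx', hhead, h2, h3⟩ :=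
        hacc (crossed 1 r.1) (hlist r).1 (hend r.1 (hred r) r.2.1) (fun h => hr (heq r h))
      obtain ⟨r', hr'⟩ := hword _ hl' hlc'
      have hX : X ∈ listSep A c₀.1 c.1 (crossed 1 r.1) (u ++ x' ++ v) := h2 ▸ rfl
      refine ⟨r', ?_, ?_⟩
      · rw [wordGraph, SimpleGraph.fromRel_adj]
        refine ⟨fun h => ?_, Or.inl (braidMove_of_crossed hA hinv hf hc₀ hgen (hred r) (hred r')
          hX.1.1.2 h1 hr' hlen hx hx' hhead)⟩
        rw [h, hr'] at h2
        have : X ∈ listSep A c₀.1 c.1 (u ++ x' ++ v) (u ++ x' ++ v) := h2 ▸ rfl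
        exact this.2 fun _ _ _ _ _ _ => Iff.rfl
      · rw [hsep, hsep, hr₀, hr']
        exact h3
  have hincid : ∀ r : ReducedWord A c₀ w, r.IncidentTo F ↔ crossed 1 r.1 = l₀ := fun r =>
    hinc (crossed 1 r.1) _ (hlist r).1 (hend r.1 (hred r) r.2.1) (hlist r).2
  exact ⟨⟨r₀, (hincid r₀).2 hr₀, fun r hr => heq r ((hincid r).1 hr), key.1⟩, key.2⟩

end ReflectionBounds

end GalleryGraph

namespace GalleryGraph

/-! ### Criteria for modular flags and closures; reflection formulas. -/

section FlagConstruction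

variable {V : Type*} [NormedAddCommGroup V] [InnerProductSpace ℝ V] [FiniteDimensional ℝ V]

variable {A : Set (Submodule ℝ V)}

/-- There is no room for a jump of dimension larger than one: induction from the top bounds the
dimensions above, induction from the bottom bounds them below. -/
theorem finrank_eq_of_strictMono {E : Fin (Module.finrank ℝ V + 1) → Submodule ℝ V}
    (hE : StrictMono E) (i : Fin (Module.finrank ℝ V + 1)) : Module.finrank ℝ (E i) = i := by
  have hlt : ∀ j : Fin (Module.finrank ℝ V),
      Module.finrank ℝ (E j.castSucc) < Module.finrank ℝ (E j.succ) := fun j =>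
    Submodule.finrank_lt_finrank_of_lt (hE (Fin.castSucc_lt_succ))
  apply le_antisymm
  · induction i using Fin.reverseInduction with
    | last => exact (Submodule.finrank_le _).trans (by simp)
    | cast j ih =>
      have := hlt j
      rw [Fin.val_succ] at ih
      rw [Fin.val_castSucc]
      omega
  · induction i using Fin.induction with
    | zero => simp
    | succ j ih =>
      have := hlt j
      rw [Fin.val_castSucc] at ih
      rw [Fin.val_succ]
      omega

/-- A criterion for a chain of subspaces to be a modular flag incident to a chamber. -/
theorem isModularFlag_of {c₀ : Chamber A} {F : Fin (Module.finrank ℝ V + 1) → Submodule ℝ V}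
    (hmem : ∀ i, F i ∈ intersections A) (hmono : Monotone F)
    (hpt : ∀ i : Fin (Module.finrank ℝ V), ∃ v ∈ closure c₀.1, v ∈ F i.succ ∧ v ∉ F i.castSucc)
    (hmod : ∀ i : Fin (Module.finrank ℝ V), ∀ H ∈ A, ∀ H' ∈ A, H ≠ H' → F i.castSucc ≤ H →
      F i.castSucc ≤ H' → ¬ F i.succ ≤ H → ¬ F i.succ ≤ H' →
      ∃ M ∈ A, F i.succ ≤ M ∧ H ⊓ H' ≤ M) :
    IsModularFlag A F ∧ ∀ i, Incident c₀.1 (F i) := by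
  have hF : StrictMono F := by
    rw [Fin.strictMono_iff_lt_succ]
    intro i
    obtain ⟨v, -, h1, h2⟩ := hpt i
    exact lt_of_le_of_ne (hmono (Fin.castSucc_le_succ i)) fun h => h2 (h ▸ h1)
  have hdim := finrank_eq_of_strictMono hF
  -- The spans of the faces increase strictly as well, hence have the full dimension `i`; this is
  -- incidence.
  have hE : StrictMono fun i => Submodule.span ℝ (closure c₀.1 ∩ (F i : Set V)) := by
    rw [Fin.strictMono_iff_lt_succ]
    intro i
    obtain ⟨v, h0, h1, h2⟩ := hpt i
    refine lt_of_le_of_ne (Submodule.span_mono (Set.inter_subset_inter_right _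
      (hmono (Fin.castSucc_le_succ i)))) fun h => h2 ?_
    have h3 : v ∈ Submodule.span ℝ (closure c₀.1 ∩ (F i.succ : Set V)) :=
      Submodule.subset_span ⟨h0, h1⟩
    rw [← h] at h3
    exact Submodule.span_le.2 Set.inter_subset_right h3
  refine ⟨⟨hmem, hdim, hmono, fun i => ⟨?_, ?_, ?_⟩⟩, fun i => ?_⟩
  · obtain ⟨S, hS, hFS⟩ := hmem i.succ
    have hle : ∀ H ∈ S, F i.castSucc ≤ H := fun H hH =>
      (hmono (Fin.castSucc_le_succ i)).trans (hFS ▸ sInf_le hH)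
    refine ⟨(fun H => H.map (F i.castSucc).mkQ) '' S, ?_, ?_⟩
    · rintro _ ⟨H, hH, rfl⟩
      exact ⟨H, hS hH, hle H hH, rfl⟩
    · apply Submodule.comap_injective_of_surjective (Submodule.mkQ_surjective _)
      rw [Submodule.comap_map_mkQ, sup_eq_right.2 (hmono (Fin.castSucc_le_succ i))]
      ext v
      simp only [Submodule.mem_comap, Submodule.mem_sInf, Set.forall_mem_image, hFS]
      refine forall₂_congr fun H hH => ?_
      rw [← Submodule.mem_comap, Submodule.comap_map_mkQ, sup_eq_right.2 (hle H hH)]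
  · have h1 := LinearMap.finrank_range_add_finrank_ker
      ((F i.castSucc).mkQ.domRestrict (F i.succ))
    rw [LinearMap.range_domRestrict, LinearMap.ker_domRestrict, Submodule.ker_mkQ,
      (Submodule.comapSubtypeEquivOfLe (hmono (Fin.castSucc_le_succ i))).finrank_eq, hdim, hdim,
      Fin.val_succ, Fin.val_castSucc] at h1
    omega
  · rintro _ ⟨H, hH, hFH, rfl⟩ _ ⟨H', hH', hFH', rfl⟩ hne h1 h2
    have hcm : ∀ K : Submodule ℝ V, F i.castSucc ≤ K →
        (K.map (F i.castSucc).mkQ).comap (F i.castSucc).mkQ = K := fun K hK => by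
      rw [Submodule.comap_map_mkQ, sup_eq_right.2 hK]
    have hle : ∀ K L : Submodule ℝ V, F i.castSucc ≤ K →
        (L.map (F i.castSucc).mkQ ≤ K.map (F i.castSucc).mkQ ↔ L ≤ K) := fun K L hK => by
      rw [Submodule.map_le_iff_le_comap, hcm K hK]
    rw [hle _ _ hFH] at h1
    rw [hle _ _ hFH'] at h2
    obtain ⟨M, hM, h3, h4⟩ := hmod i H hH H' hH' (fun h => hne (by rw [h])) hFH hFH' h1 h2
    have hFM := (hmono (Fin.castSucc_le_succ i)).trans h3
    refine ⟨_, ⟨M, hM, hFM, rfl⟩, (hle _ _ hFM).2 h3, ?_⟩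
    intro y hy
    obtain ⟨v, rfl⟩ := Submodule.mkQ_surjective _ y
    rw [Submodule.mem_inf, ← Submodule.mem_comap, ← Submodule.mem_comap, hcm H hFH,
      hcm H' hFH'] at hy
    exact Submodule.mem_map_of_mem (h4 hy)
  · rw [Incident, hdim, finrank_eq_of_strictMono hE]

/-- A point weakly on the same side of every hyperplane as a chamber is in its closure. -/
theorem mem_closure_chamber (hA : IsArrangement A) {c : Chamber A} {x v : V} (hx : x ∈ c.1)
    (h : ∀ H ∈ A, ∃ g : V →ₗ[ℝ] ℝ, (∀ u, u ∈ H ↔ g u = 0) ∧ 0 ≤ g v * g x) :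
    v ∈ closure c.1 := by
  obtain ⟨f, hf, hc⟩ := c.exists_functionals hA
  rw [hc] at hx ⊢
  refine mem_closure_of_nonneg hx fun H hH => ?_
  obtain ⟨g, hg, hgv⟩ := h H hH
  obtain ⟨a, b, hab⟩ := exists_combination (g := g) (h := g) (k := f H) (by
    intro u hu
    rw [hf H hH, hg]
    exact hu.1)
  have h1 := (hx H hH).2 (by simp)
  have hval : ∀ u, f H u = (a + b) * g u := fun u => by
    rw [hab]
    simp
    ring
  have h2 : 0 ≤ f H v * f H x := by
    rw [hval, hval]
    nlinarith [mul_nonneg (mul_self_nonneg (a + b)) hgv]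
  exact nonneg_of_mul_nonneg_left h2 h1

theorem preserves_reflection {H : Submodule ℝ V}
    (h : ∀ K ∈ A, act H.reflection K ∈ A) : Preserves A H.reflection := by
  refine fun K => ⟨fun hK => ?_, h K⟩
  have := h _ hK
  rwa [← act_mul, Submodule.reflection_mul_reflection, act_one] at this

theorem mem_act_reflection {H K : Submodule ℝ V} {v : V} :
    v ∈ act H.reflection K ↔ H.reflection v ∈ K := by
  rw [mem_act, Submodule.reflection_inv]

theorem reflection_apply_of_normal {H : Submodule ℝ V} {a : V}
    (ha : ∀ v, v ∈ H ↔ inner ℝ a v = 0) (v : V) :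
    H.reflection v = v - (2 * (inner ℝ a v / ‖a‖ ^ 2)) • a := by
  have hH : H = (Submodule.span ℝ {a})ᗮ := by
    ext u
    rw [ha, Submodule.mem_orthogonal_singleton_iff_inner_right]
  subst hH
  rw [Submodule.reflection_orthogonal_apply, Submodule.reflection_singleton_apply, neg_sub,
    mul_smul]
  norm_num [two_smul]

end FlagConstruction

end GalleryGraph

namespace GalleryGraph

/-! ### Type A: sorting coordinates. -/

section TypeA

variable {V : Type*} [NormedAddCommGroup V] [InnerProductSpace ℝ V]

variable {A : Set (Submodule ℝ V)} {n : ℕ}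

theorem mem_intersections_of {X : Submodule ℝ V}
    (h : ∀ v, (∀ H ∈ A, X ≤ H → v ∈ H) → v ∈ X) : X ∈ intersections A := by
  refine ⟨{H ∈ A | X ≤ H}, fun H hH => hH.1, le_antisymm (le_sInf fun H hH => hH.2) ?_⟩
  intro v hv
  rw [Submodule.mem_sInf] at hv
  exact h v fun H hH hXH => hv H ⟨hH, hXH⟩

/-- The vectors whose coordinates with index at most `m` agree. -/
def agreeing (y : Fin n → V →ₗ[ℝ] ℝ) (m : ℕ) : Submodule ℝ V :=
  ⨅ (a : Fin n) (b : Fin n) (_ : a.1 ≤ m) (_ : b.1 ≤ m), LinearMap.eqLocus (y a) (y b)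

theorem mem_agreeing {y : Fin n → V →ₗ[ℝ] ℝ} {m : ℕ} {v : V} :
    v ∈ agreeing y m ↔ ∀ a b : Fin n, a.1 ≤ m → b.1 ≤ m → y a v = y b v := by
  simp [agreeing, Submodule.mem_iInf]

/-- Vectors supported on one coordinate beyond `m + 1` show that such indices cannot occur in the
equation of `H`; the index `e` must occur, since otherwise `H` would contain the larger subspace. -/
theorem exists_pair_of_agreeing_le {y : Fin n → V →ₗ[ℝ] ℝ}
    (hsurj : ∀ z : Fin n → ℝ, ∃ v c, ∀ i, y i v = z i + c)
    (hA : A = {H | ∃ i j, i ≠ j ∧ ∀ v, v ∈ H ↔ y i v = y j v}) {H : Submodule ℝ V} (hH : H ∈ A)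
    {m : ℕ} {e : Fin n} (he : e.1 = m + 1) (h1 : agreeing y (m + 1) ≤ H)
    (h2 : ¬ agreeing y m ≤ H) : ∃ b : Fin n, b.1 ≤ m ∧ ∀ v, v ∈ H ↔ y e v = y b v := by
  rw [hA] at hH
  obtain ⟨i, j, hij, hH⟩ := hH
  have hle : ∀ a b : Fin n, a ≠ b → (∀ v, v ∈ H ↔ y a v = y b v) → a.1 ≤ m + 1 := by
    intro a b hab hv
    by_contra! ha
    obtain ⟨v, c, hvc⟩ := hsurj (Pi.single a 1)
    have h3 : v ∈ agreeing y (m + 1) := by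
      rw [mem_agreeing]
      intro a' b' ha' hb'
      rw [hvc, hvc, Pi.single_eq_of_ne (by rintro rfl; omega),
        Pi.single_eq_of_ne (by rintro rfl; omega)]
    have h4 := (hv v).1 (h1 h3)
    rw [hvc, hvc, Pi.single_eq_same, Pi.single_eq_of_ne hab.symm] at h4
    linarith
  have hi := hle i j hij hH
  have hj := hle j i hij.symm fun v => by rw [hH, eq_comm]
  have h3 : ¬ (i.1 ≤ m ∧ j.1 ≤ m) := fun h => h2 fun v hv =>
    (hH v).2 (mem_agreeing.1 hv i j h.1 h.2)
  have h4 : i.1 ≠ j.1 := fun h => hij (Fin.ext h)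
  rcases Nat.lt_or_ge m i with h | h
  · obtain rfl : i = e := Fin.ext (by omega)
    exact ⟨j, by omega, hH⟩
  · obtain rfl : j = e := Fin.ext (by omega)
    exact ⟨i, by omega, fun v => by rw [hH, eq_comm]⟩

theorem finrank_of_isTypeA {φ : V →ₗᵢ[ℝ] EuclideanSpace ℝ (Fin n)}
    (hφ : Set.range φ = {x | ∑ i, x i = 0}) : Module.finrank ℝ V = n - 1 := by
  have h1 : Module.finrank ℝ (LinearMap.range φ.toLinearMap) = Module.finrank ℝ V :=
    LinearMap.finrank_range_of_inj φ.injective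
  -- For `n = 0` the truncated difference `n - 1` still gives the correct dimension zero.
  rcases Nat.eq_zero_or_pos n with rfl | hn
  · rw [← h1]
    have h2 := Submodule.finrank_le (LinearMap.range φ.toLinearMap)
    rw [finrank_euclideanSpace_fin] at h2
    omega
  · let g : EuclideanSpace ℝ (Fin n) →ₗ[ℝ] ℝ := ∑ i, (EuclideanSpace.proj i).toLinearMap
    have hg : ∀ u, g u = ∑ i, u i := fun u => by simp [g]
    have h2 : LinearMap.range φ.toLinearMap = LinearMap.ker g := by
      ext u
      rw [LinearMap.mem_ker, hg]
      exact Set.ext_iff.1 hφ u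
    have h3 : g ≠ 0 := by
      intro h
      have h4 := congrArg (fun l => l (EuclideanSpace.single ⟨0, hn⟩ (1 : ℝ))) h
      simp [hg] at h4
    have h5 := Module.Dual.finrank_ker_add_one_of_ne_zero h3
    rw [finrank_euclideanSpace_fin, ← h2, h1] at h5
    omega

variable [FiniteDimensional ℝ V]

/-- Going up one step in the flag releases a coordinate `e`. The hyperplanes lost at this step are
`y e = y b`, and two of them meet inside `y b = y b'`. -/
theorem exists_flag_of_sorted {y : Fin n → V →ₗ[ℝ] ℝ}
    (hsurj : ∀ z : Fin n → ℝ, ∃ v c, ∀ i, y i v = z i + c) (hA : IsArrangement A)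
    (hAy : A = {H | ∃ i j, i ≠ j ∧ ∀ v, v ∈ H ↔ y i v = y j v})
    (hd : Module.finrank ℝ V = n - 1) {c₀ : Chamber A} {x : V} (hx : x ∈ c₀.1)
    (hmono : Monotone fun i => y i x) :
    ∃ F : Fin (Module.finrank ℝ V + 1) → Submodule ℝ V,
      IsModularFlag A F ∧ ∀ i, Incident c₀.1 (F i) := by
  have hpair : ∀ i j, i ≠ j → LinearMap.eqLocus (y i) (y j) ∈ A := fun i j hij => by
    rw [hAy]
    exact ⟨i, j, hij, fun v => Iff.rfl⟩
  have hanti : Antitone (agreeing y) := fun m m' h v hv => by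
    rw [mem_agreeing] at hv ⊢
    exact fun a b ha hb => hv a b (ha.trans h) (hb.trans h)
  refine ⟨fun i => agreeing y (Module.finrank ℝ V - i), isModularFlag_of (fun i => ?_) ?_
    (fun i => ?_) fun i H hH H' hH' hne h1 h1' h2 h2' => ?_⟩
  · refine mem_intersections_of fun v hv => mem_agreeing.2 fun a b ha hb => ?_
    by_cases hab : a = b
    · rw [hab]
    · exact hv _ (hpair a b hab) fun u hu => mem_agreeing.1 hu a b ha hb
  · exact fun i j h => hanti (by have := Fin.le_def.1 h; omega)
  · have hi := i.2
    set m := Module.finrank ℝ V - i - 1 with hm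
    have hs : Module.finrank ℝ V - i.succ = m := by
      rw [Fin.val_succ]
      omega
    have hc : Module.finrank ℝ V - i.castSucc = m + 1 := by
      rw [Fin.val_castSucc]
      omega
    rw [hs, hc]
    -- A step vector is monotone in the index like `x`, hence in the closed chamber; the jump after
    -- `m` separates the two flag members.
    obtain ⟨v, c, hv⟩ := hsurj fun a => if a.1 ≤ m then 0 else 1
    refine ⟨v, mem_closure_chamber hA hx fun H hH => ?_, ?_, ?_⟩
    · rw [hAy] at hH
      obtain ⟨a, b, -, hH⟩ := hH
      refine ⟨y a - y b, fun u => by rw [hH, LinearMap.sub_apply, sub_eq_zero], ?_⟩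
      simp only [LinearMap.sub_apply, hv]
      rcases le_total a b with hab | hab
      · have h3 : y a x ≤ y b x := hmono hab
        have h4 := Fin.le_def.1 hab
        refine mul_nonneg_of_nonpos_of_nonpos ?_ (by linarith)
        split_ifs <;> first | omega | norm_num
      · have h3 : y b x ≤ y a x := hmono hab
        have h4 := Fin.le_def.1 hab
        refine mul_nonneg ?_ (by linarith)
        split_ifs <;> first | omega | norm_num
    · rw [mem_agreeing]
      intro a b ha hb
      rw [hv, hv, if_pos ha, if_pos hb]
    · rw [mem_agreeing]
      intro h
      have h3 := h ⟨0, by omega⟩ ⟨m + 1, by omega⟩ (by simp) le_rfl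
      rw [hv, hv, if_pos (by simp), if_neg (by simp)] at h3
      linarith
  · have hi := i.2
    set m := Module.finrank ℝ V - i - 1 with hm
    have hs : Module.finrank ℝ V - i.succ = m := by
      rw [Fin.val_succ]
      omega
    have hc : Module.finrank ℝ V - i.castSucc = m + 1 := by
      rw [Fin.val_castSucc]
      omega
    rw [hs] at h2 h2' ⊢
    rw [hc] at h1 h1'
    obtain ⟨b, hb, hbH⟩ := exists_pair_of_agreeing_le hsurj hAy hH (e := ⟨m + 1, by omega⟩) rfl
      h1 h2
    obtain ⟨b', hb', hbH'⟩ := exists_pair_of_agreeing_le hsurj hAy hH' (e := ⟨m + 1, by omega⟩)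
      rfl h1' h2'
    have hbb : b ≠ b' := by
      rintro rfl
      exact hne (by ext v; rw [hbH, hbH'])
    refine ⟨_, hpair b b' hbb, fun u hu => mem_agreeing.1 hu b b' hb hb', fun u hu => ?_⟩
    exact ((hbH u).1 hu.1).symm.trans ((hbH' u).1 hu.2)

theorem map_reflection {m : ℕ} (φ : V →ₗᵢ[ℝ] EuclideanSpace ℝ (Fin m)) {H : Submodule ℝ V} {a : V}
    (ha : ∀ v, v ∈ H ↔ inner ℝ (φ a) (φ v) = 0) (v : V) (k : Fin m) :
    φ (H.reflection v) k =
      φ v k - 2 * (inner ℝ (φ a) (φ v) / ‖φ a‖ ^ 2) * φ a k := by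
  rw [reflection_apply_of_normal (a := a) (fun v => by rw [ha, φ.inner_map_map])]
  simp

/-- The reflection in `x_i = x_j` exchanges these two coordinates. -/
theorem IsTypeA.preserves (h : IsTypeA n A) : ∀ H ∈ A, Preserves A H.reflection := by
  obtain ⟨φ, hφ, rfl⟩ := h
  rintro H ⟨i, j, hij, hH⟩
  obtain ⟨a, ha⟩ : ∃ a, φ a = EuclideanSpace.single i 1 - EuclideanSpace.single j 1 := by
    have : EuclideanSpace.single i (1 : ℝ) - EuclideanSpace.single j 1 ∈ Set.range φ := by
      rw [hφ]
      simp
    exact this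
  have hin : ∀ v, inner ℝ (φ a) (φ v) = φ v i - φ v j := fun v => by
    rw [ha, inner_sub_left]
    simp [EuclideanSpace.inner_single_left]
  have hnorm : ‖φ a‖ ^ 2 = 2 := by
    rw [← real_inner_self_eq_norm_sq, hin, ha]
    simp [hij, hij.symm]
    norm_num
  have hs : ∀ v k, φ (H.reflection v) k = φ v (Equiv.swap i j k) := fun v k => by
    rw [map_reflection φ (fun v => by rw [hH, hin, sub_eq_zero]), hin, hnorm, ha]
    rcases eq_or_ne k i with rfl | hki
    · simp [hij]
      ring
    rcases eq_or_ne k j with rfl | hkj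
    · simp [hki]
      ring
    · simp [hki, hkj, Equiv.swap_apply_of_ne_of_ne]
  refine preserves_reflection ?_
  rintro K ⟨k, l, hkl, hK⟩
  refine ⟨Equiv.swap i j k, Equiv.swap i j l, by simpa using hkl, fun v => ?_⟩
  rw [mem_act_reflection, hK, hs, hs]

theorem IsTypeA.exists_flag (h : IsTypeA n A) (hA : IsArrangement A) (c₀ : Chamber A) :
    ∃ F : Fin (Module.finrank ℝ V + 1) → Submodule ℝ V,
      IsModularFlag A F ∧ ∀ i, Incident c₀.1 (F i) := by
  obtain ⟨φ, hφ, hAφ⟩ := h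
  obtain ⟨x, hx⟩ := c₀.nonempty
  set σ := Tuple.sort (fun i => φ x i)
  refine exists_flag_of_sorted
    (y := fun i => (EuclideanSpace.proj (σ i)).toLinearMap ∘ₗ φ.toLinearMap) (fun z => ?_) hA ?_
    (finrank_of_isTypeA hφ) hx (Tuple.monotone_sort fun i => φ x i)
  -- Subtracting the mean reaches the sum-zero space; the additive constant disappears in
  -- differences of coordinates.
  · have : WithLp.toLp 2 (fun i => z (σ.symm i) - (∑ j, z j) / n) ∈ Set.range φ := by
      rw [hφ]
      simp only [Set.mem_ofPred_eq, Finset.sum_sub_distrib, Finset.sum_const, Finset.card_univ,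
        Fintype.card_fin, nsmul_eq_mul]
      rw [Equiv.sum_comp σ.symm z]
      rcases Nat.eq_zero_or_pos n with rfl | hn
      · simp
      · field_simp
        simp
    obtain ⟨v, hv⟩ := this
    refine ⟨v, -((∑ j, z j) / n), fun i => ?_⟩
    simp [hv]
    ring
  · rw [hAφ]
    ext H
    constructor
    · rintro ⟨i, j, hij, hH⟩
      exact ⟨σ.symm i, σ.symm j, by simpa using hij, by simpa using hH⟩
    · rintro ⟨i, j, hij, hH⟩
      exact ⟨σ i, σ j, by simpa using hij, by simpa using hH⟩

end TypeA

end GalleryGraph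

namespace GalleryGraph

/-! ### Type B: sorting absolute values. -/

section TypeB

variable {V : Type*} [NormedAddCommGroup V] [InnerProductSpace ℝ V]

variable {A : Set (Submodule ℝ V)} {n : ℕ}

/-- The hyperplanes `y i = ε * y j` with `ε = ±1`, `i ≠ j`, and `y i = 0`. -/
def IsSigned (y : Fin n → V → ℝ) (H : Submodule ℝ V) : Prop :=
  (∃ i j, i ≠ j ∧ ∃ ε : ℝ, (ε = 1 ∨ ε = -1) ∧ ∀ v, v ∈ H ↔ y i v = ε * y j v) ∨
    ∃ i, ∀ v, v ∈ H ↔ y i v = 0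

theorem sign_mul {a b : ℝ} (ha : a = 1 ∨ a = -1) (hb : b = 1 ∨ b = -1) :
    a * b = 1 ∨ a * b = -1 := by
  rcases ha with rfl | rfl <;> rcases hb with rfl | rfl <;> norm_num

/-- Hyperplanes of signed type stay so under signed permutations of the coordinates. -/
theorem IsSigned.signed_perm {y y' : Fin n → V → ℝ} {g : V → V} {H K : Submodule ℝ V}
    (hK : IsSigned y K) {σ : Equiv.Perm (Fin n)} {η : Fin n → ℝ} (hη : ∀ i, η i = 1 ∨ η i = -1)
    (hy : ∀ v i, y i (g v) = η i * y' (σ i) v) (hH : ∀ v, v ∈ H ↔ g v ∈ K) : IsSigned y' H := by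
  have hsq : ∀ i, η i * η i = 1 := fun i => by rcases hη i with h | h <;> rw [h] <;> norm_num
  rcases hK with ⟨i, j, hij, ε, hε, hK⟩ | ⟨i, hK⟩
  · refine Or.inl ⟨σ i, σ j, by simpa using hij, η i * ε * η j,
      sign_mul (sign_mul (hη i) hε) (hη j), fun v => ?_⟩
    rw [hH, hK, hy, hy]
    constructor <;> intro h
    · linear_combination η i * h - y' (σ i) v * hsq i
    · linear_combination η i * h + ε * η j * y' (σ j) v * hsq i
  · refine Or.inr ⟨σ i, fun v => ?_⟩
    rw [hH, hK, hy]
    refine ⟨fun h => ?_, fun h => by rw [h, mul_zero]⟩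
    linear_combination η i * h - y' (σ i) v * hsq i

/-- The vectors whose coordinates with index less than `m` vanish. -/
def vanishing (y : Fin n → V →ₗ[ℝ] ℝ) (m : ℕ) : Submodule ℝ V :=
  ⨅ (a : Fin n) (_ : a.1 < m), LinearMap.ker (y a)

theorem mem_vanishing {y : Fin n → V →ₗ[ℝ] ℝ} {m : ℕ} {v : V} :
    v ∈ vanishing y m ↔ ∀ a : Fin n, a.1 < m → y a v = 0 := by
  simp [vanishing, Submodule.mem_iInf]

/-- Basis vectors with index beyond `e` lie in `H`, so these coordinates are absent from its
equation; if `e` were absent too, `H` would contain `vanishing y e`. -/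
theorem exists_of_vanishing_le {y : Fin n → V →ₗ[ℝ] ℝ}
    (hsurj : ∀ z : Fin n → ℝ, ∃ v, ∀ i, y i v = z i) {H : Submodule ℝ V}
    (hH : IsSigned (fun i v => y i v) H) {e : Fin n} (h1 : vanishing y (e + 1) ≤ H)
    (h2 : ¬ vanishing y e ≤ H) : (∀ v, v ∈ H ↔ y e v = 0) ∨
      ∃ b : Fin n, b < e ∧ ∃ ε : ℝ, (ε = 1 ∨ ε = -1) ∧ ∀ v, v ∈ H ↔ y e v = ε * y b v := by
  have hsingle : ∀ a : Fin n, e < a → ∃ v ∈ H, ∀ i, y i v = (Pi.single a 1 : Fin n → ℝ) i := by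
    intro a ha
    obtain ⟨v, hv⟩ := hsurj (Pi.single a 1)
    refine ⟨v, h1 (mem_vanishing.2 fun b hb => ?_), hv⟩
    rw [hv, Pi.single_eq_of_ne]
    rintro rfl
    have := Fin.lt_def.1 ha
    omega
  rcases hH with ⟨i, j, hij, ε, hε, hH⟩ | ⟨i, hH⟩
  · have hle : ∀ a b : Fin n, a ≠ b → (∀ v, v ∈ H ↔ y a v = ε * y b v) → a ≤ e := by
      intro a b hab hv
      by_contra! ha
      obtain ⟨v, hvH, hvc⟩ := hsingle a ha
      have h4 := (hv v).1 hvH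
      rw [hvc, hvc, Pi.single_eq_same, Pi.single_eq_of_ne hab.symm] at h4
      norm_num at h4
    have hH' : ∀ v, v ∈ H ↔ y j v = ε * y i v := fun v => by
      have hsq : ε * ε = 1 := by rcases hε with rfl | rfl <;> norm_num
      rw [hH]
      constructor <;> intro h
      · linear_combination (-ε) * h - y j v * hsq
      · linear_combination (-ε) * h - y i v * hsq
    have hi := hle i j hij hH
    have hj := hle j i hij.symm hH'
    rcases hi.eq_or_lt with rfl | hi
    · exact Or.inr ⟨j, lt_of_le_of_ne hj hij.symm, ε, hε, hH⟩
    rcases hj.eq_or_lt with rfl | hj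
    · exact Or.inr ⟨i, hi, ε, hε, hH'⟩
    · refine absurd (fun v hv => ?_) h2
      rw [mem_vanishing] at hv
      rw [hH]
      beta_reduce
      rw [hv i hi, hv j hj, mul_zero]
  · rcases lt_trichotomy i e with hi | rfl | hi
    · exact absurd (fun v hv => (hH v).2 (mem_vanishing.1 hv i hi)) h2
    · exact Or.inl hH
    · obtain ⟨v, hvH, hvc⟩ := hsingle i hi
      have h4 : y i v = 0 := (hH v).1 hvH
      rw [hvc, Pi.single_eq_same] at h4
      norm_num at h4

theorem IsTypeB.exists_isSigned (h : IsTypeB n A) :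
    ∃ φ : V ≃ₗᵢ[ℝ] EuclideanSpace ℝ (Fin n), ∀ H, H ∈ A ↔ IsSigned (fun i v => φ v i) H := by
  obtain ⟨φ, rfl⟩ := h
  refine ⟨φ, fun H => ⟨?_, ?_⟩⟩
  · rintro (⟨i, j, hij, hH⟩ | ⟨i, j, hij, hH⟩ | ⟨i, hH⟩)
    · exact Or.inl ⟨i, j, hij, 1, Or.inl rfl, by simpa using hH⟩
    · exact Or.inl ⟨i, j, hij, -1, Or.inr rfl, by simpa using hH⟩
    · exact Or.inr ⟨i, hH⟩
  · rintro (⟨i, j, hij, ε, rfl | rfl, hH⟩ | ⟨i, hH⟩)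
    · exact Or.inl ⟨i, j, hij, by simpa using hH⟩
    · exact Or.inr (Or.inl ⟨i, j, hij, by simpa using hH⟩)
    · exact Or.inr (Or.inr ⟨i, hH⟩)

variable [FiniteDimensional ℝ V]

/-- The hyperplanes lost at one step are `y e = 0` and `y e = ± y b` with `b < e`. Eliminating `y e`
from two of them leaves `y b = 0` or `y b = ± y b'`. -/
theorem exists_flag_of_signed_sorted {y : Fin n → V →ₗ[ℝ] ℝ}
    (hsurj : ∀ z : Fin n → ℝ, ∃ v, ∀ i, y i v = z i) (hA : IsArrangement A)
    (hAy : ∀ H, H ∈ A ↔ IsSigned (fun i v => y i v) H)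
    (hd : Module.finrank ℝ V = n) {c₀ : Chamber A} {x : V} (hx : x ∈ c₀.1)
    (hmono : Monotone fun i => y i x) (hpos : ∀ i, 0 ≤ y i x) :
    ∃ F : Fin (Module.finrank ℝ V + 1) → Submodule ℝ V,
      IsModularFlag A F ∧ ∀ i, Incident c₀.1 (F i) := by
  have hpair : ∀ i j, i ≠ j → ∀ ε : ℝ, (ε = 1 ∨ ε = -1) →
      LinearMap.eqLocus (y i) (ε • y j) ∈ A := fun i j hij ε hε =>
    (hAy _).2 (Or.inl ⟨i, j, hij, ε, hε, fun v => Iff.rfl⟩)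
  have hzero : ∀ i, LinearMap.ker (y i) ∈ A := fun i => (hAy _).2 (Or.inr ⟨i, fun v => Iff.rfl⟩)
  have hanti : Antitone (vanishing y) := fun m m' h v hv => by
    rw [mem_vanishing] at hv ⊢
    exact fun a ha => hv a (ha.trans_le h)
  refine ⟨fun i => vanishing y (Module.finrank ℝ V - i), isModularFlag_of (fun i => ?_) ?_
    (fun i => ?_) fun i H hH H' hH' hne h1 h1' h2 h2' => ?_⟩
  · exact mem_intersections_of fun v hv => mem_vanishing.2 fun a ha =>
      hv _ (hzero a) fun u hu => mem_vanishing.1 hu a ha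
  · exact fun i j h => hanti (by have := Fin.le_def.1 h; omega)
  · have hi := i.2
    -- The coordinate `e` is the one released between the two consecutive flag members.
    obtain ⟨e, he⟩ : ∃ e : Fin n, e.1 = Module.finrank ℝ V - i - 1 := ⟨⟨_, by omega⟩, rfl⟩
    have hs : Module.finrank ℝ V - i.succ = e := by
      rw [Fin.val_succ]
      omega
    have hc : Module.finrank ℝ V - i.castSucc = e + 1 := by
      rw [Fin.val_castSucc]
      omega
    rw [hs, hc]
    obtain ⟨v, hv⟩ := hsurj fun a => if a < e then 0 else 1
    refine ⟨v, mem_closure_chamber hA hx fun H hH => ?_, ?_, ?_⟩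
    · rcases (hAy H).1 hH with ⟨a, b, -, ε, hε, hH⟩ | ⟨a, hH⟩
      · refine ⟨y a - ε • y b, fun u => by
          rw [hH, LinearMap.sub_apply, sub_eq_zero, LinearMap.smul_apply, smul_eq_mul], ?_⟩
        simp only [LinearMap.sub_apply, LinearMap.smul_apply, smul_eq_mul, hv]
        have hxa := hpos a
        have hxb := hpos b
        rcases hε with rfl | rfl
        · rcases le_total a b with hab | hab
          · have h3 : y a x ≤ y b x := hmono hab
            refine mul_nonneg_of_nonpos_of_nonpos ?_ (by linarith)
            split_ifs <;> first | (exfalso; order) | norm_num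
          · have h3 : y b x ≤ y a x := hmono hab
            refine mul_nonneg ?_ (by linarith)
            split_ifs <;> first | (exfalso; order) | norm_num
        · refine mul_nonneg ?_ (by linarith)
          split_ifs <;> norm_num
      · refine ⟨y a, hH, mul_nonneg ?_ (hpos a)⟩
        rw [hv]
        split_ifs <;> norm_num
    · exact mem_vanishing.2 fun a ha => by rw [hv, if_pos (Fin.lt_def.2 ha)]
    · intro h
      have h3 := mem_vanishing.1 h e (Nat.lt_succ_self _)
      rw [hv, if_neg (lt_irrefl _)] at h3
      norm_num at h3
  · have hi := i.2
    obtain ⟨e, he⟩ : ∃ e : Fin n, e.1 = Module.finrank ℝ V - i - 1 := ⟨⟨_, by omega⟩, rfl⟩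
    have hs : Module.finrank ℝ V - i.succ = e := by
      rw [Fin.val_succ]
      omega
    have hc : Module.finrank ℝ V - i.castSucc = e + 1 := by
      rw [Fin.val_castSucc]
      omega
    rw [hs] at h2 h2' ⊢
    rw [hc] at h1 h1'
    rcases exists_of_vanishing_le hsurj ((hAy H).1 hH) h1 h2 with hH | ⟨b, hb, ε, hε, hH⟩ <;>
      rcases exists_of_vanishing_le hsurj ((hAy H').1 hH') h1' h2' with hH' | ⟨b', hb', δ, hδ, hH'⟩
    · exact absurd (by ext v; rw [hH, hH']) hne
    · refine ⟨_, hzero b', fun u hu => mem_vanishing.1 hu b' hb', fun u hu => ?_⟩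
      have h3 := (hH u).1 hu.1
      have h4 := (hH' u).1 hu.2
      rw [LinearMap.mem_ker]
      rcases hδ with rfl | rfl <;> linarith
    · refine ⟨_, hzero b, fun u hu => mem_vanishing.1 hu b hb, fun u hu => ?_⟩
      have h3 := (hH u).1 hu.1
      have h4 := (hH' u).1 hu.2
      rw [LinearMap.mem_ker]
      rcases hε with rfl | rfl <;> linarith
    · by_cases hbb : b = b'
      · subst hbb
        have hεδ : ε ≠ δ := by
          rintro rfl
          exact hne (by ext v; rw [hH, hH'])
        refine ⟨_, hzero b, fun u hu => mem_vanishing.1 hu b hb, fun u hu => ?_⟩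
        have h3 := (hH u).1 hu.1
        have h4 := (hH' u).1 hu.2
        rw [LinearMap.mem_ker]
        have h5 : (ε - δ) * y b u = 0 := by linarith
        exact (mul_eq_zero.1 h5).resolve_left (sub_ne_zero.2 hεδ)
      · refine ⟨_, hpair b b' hbb (ε * δ) (sign_mul hε hδ), fun u hu => ?_, fun u hu => ?_⟩
        · have h3 := mem_vanishing.1 hu b hb
          have h4 := mem_vanishing.1 hu b' hb'
          rw [LinearMap.mem_eqLocus, LinearMap.smul_apply, h3, h4, smul_zero]
        · have h3 := (hH u).1 hu.1
          have h4 := (hH' u).1 hu.2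
          rw [LinearMap.mem_eqLocus, LinearMap.smul_apply, smul_eq_mul]
          have hsq : ε * ε = 1 := by rcases hε with rfl | rfl <;> norm_num
          linear_combination ε * (h4 - h3) - y b u * hsq

/-- Each reflection acts as a signed permutation of coordinates: a transposition with common sign
`ε`, or one sign change. -/
theorem IsTypeB.preserves (h : IsTypeB n A) : ∀ H ∈ A, Preserves A H.reflection := by
  obtain ⟨φ, hφ⟩ := h.exists_isSigned
  intro H hH
  refine preserves_reflection fun K hK => ?_
  rw [hφ] at hK ⊢
  suffices h : ∃ (σ : Equiv.Perm (Fin n)) (η : Fin n → ℝ), (∀ i, η i = 1 ∨ η i = -1) ∧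
      ∀ v i, φ (H.reflection v) i = η i * φ v (σ i) by
    obtain ⟨σ, η, hη, hy⟩ := h
    exact hK.signed_perm hη hy fun v => mem_act_reflection
  rcases (hφ H).1 hH with ⟨i, j, hij, ε, hε, hH⟩ | ⟨i, hH⟩
  · obtain ⟨a, ha⟩ : ∃ a, φ a = EuclideanSpace.single i 1 - ε • EuclideanSpace.single j 1 :=
      φ.surjective _
    have hsq : ε * ε = 1 := by rcases hε with rfl | rfl <;> norm_num
    have hin : ∀ v, inner ℝ (φ a) (φ v) = φ v i - ε * φ v j := fun v => by
      rw [ha, inner_sub_left, inner_smul_left]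
      simp [EuclideanSpace.inner_single_left]
    have hnorm : ‖φ a‖ ^ 2 = 2 := by
      rw [← real_inner_self_eq_norm_sq, hin, ha]
      simp [hij, hij.symm, hsq]
      norm_num
    refine ⟨Equiv.swap i j, fun k => if k = i ∨ k = j then ε else 1, fun k => ?_, fun v k => ?_⟩
    · beta_reduce
      split_ifs
      exacts [hε, Or.inl rfl]
    have := map_reflection φ.toLinearIsometry (a := a) (H := H)
      (fun v => by rw [hH, ← sub_eq_zero, ← hin]; rfl) v k
    simp only [LinearIsometryEquiv.coe_toLinearIsometry] at this
    rw [this, hin, hnorm, ha]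
    rcases eq_or_ne k i with rfl | hki
    · simp [hij]
      ring
    rcases eq_or_ne k j with rfl | hkj
    · simp [hki]
      linear_combination (-φ v k) * hsq
    · simp [hki, hkj, Equiv.swap_apply_of_ne_of_ne]
  · obtain ⟨a, ha⟩ : ∃ a, φ a = EuclideanSpace.single i 1 := φ.surjective _
    have hin : ∀ v, inner ℝ (φ a) (φ v) = φ v i := fun v => by
      rw [ha]
      simp [EuclideanSpace.inner_single_left]
    have hnorm : ‖φ a‖ ^ 2 = 1 := by
      rw [ha]
      simp
    refine ⟨1, fun k => if k = i then -1 else 1, fun k => ?_, fun v k => ?_⟩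
    · beta_reduce
      split_ifs
      exacts [Or.inr rfl, Or.inl rfl]
    have := map_reflection φ.toLinearIsometry (a := a) (H := H)
      (fun v => (hH v).trans (by beta_reduce; rw [← hin]; rfl)) v k
    simp only [LinearIsometryEquiv.coe_toLinearIsometry] at this
    rw [this, hin, hnorm, ha]
    rcases eq_or_ne k i with rfl | hki
    · simp
      ring
    · simp [hki]

theorem IsTypeB.exists_flag (h : IsTypeB n A) (hA : IsArrangement A) (c₀ : Chamber A) :
    ∃ F : Fin (Module.finrank ℝ V + 1) → Submodule ℝ V,
      IsModularFlag A F ∧ ∀ i, Incident c₀.1 (F i) := by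
  obtain ⟨φ, hφ⟩ := h.exists_isSigned
  obtain ⟨x, hx⟩ := c₀.nonempty
  set σ := Tuple.sort (fun i => |φ x i|)
  -- These signs make all coordinates of `x` nonnegative, so that the new coordinates are sorted
  -- absolute values.
  let η : Fin n → ℝ := fun i => if 0 ≤ φ x (σ i) then 1 else -1
  have hη : ∀ i, η i = 1 ∨ η i = -1 := fun i => by
    simp only [η]
    split_ifs <;> simp
  have hsq : ∀ i, η i * η i = 1 := fun i => by rcases hη i with h | h <;> rw [h] <;> norm_num
  have hηx : ∀ i, η i * φ x (σ i) = |φ x (σ i)| := fun i => by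
    simp only [η]
    split_ifs with h
    · rw [one_mul, abs_of_nonneg h]
    · rw [neg_one_mul, abs_of_neg (not_le.1 h)]
  refine exists_flag_of_signed_sorted
    (y := fun i => η i • (EuclideanSpace.proj (σ i)).toLinearMap ∘ₗ φ.toLinearIsometry.toLinearMap)
    (fun z => ?_) hA (fun H => (hφ H).trans ⟨fun h => ?_, fun h => ?_⟩) ?_ hx ?_ fun i => ?_
  · refine ⟨φ.symm (WithLp.toLp 2 fun i => η (σ.symm i) * z (σ.symm i)), fun i => ?_⟩
    simp [← mul_assoc, hsq]
  · refine h.signed_perm (g := id) (σ := σ.symm) (η := fun i => η (σ.symm i)) (fun i => hη _)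
      (fun v i => ?_) fun v => Iff.rfl
    simp [← mul_assoc, hsq]
  · refine h.signed_perm (g := id) (σ := σ) (η := η) hη (fun v i => ?_) fun v => Iff.rfl
    simp
  · rw [φ.toLinearEquiv.finrank_eq, finrank_euclideanSpace_fin]
  · intro i j hij
    have := Tuple.monotone_sort (fun i => |φ x i|) hij
    simpa [hηx] using this
  · simp [hηx]

end TypeB

end GalleryGraph

namespace GalleryGraph

/-! ### Dihedral type: arrangements in the plane. -/

section Dihedral

variable {V : Type*} [NormedAddCommGroup V] [InnerProductSpace ℝ V] [FiniteDimensional ℝ V]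

variable {A : Set (Submodule ℝ V)}

theorem exists_ne_mem_closure (hA : IsArrangement A) (hd : Module.finrank ℝ V = 2)
    (c₀ : Chamber A) : ∃ H ∈ A, ∃ v ∈ closure c₀.1, v ∈ H ∧ v ≠ 0 := by
  have hexne : ∀ X : Submodule ℝ V, X ≠ ⊥ → ∃ H ∈ A, H ≠ X := by
    intro X hX
    by_contra! h
    exact hX (le_bot_iff.1 (hA.essential ▸ le_sInf fun H hH => (h H hH).ge))
  obtain ⟨H₁, hH₁, -⟩ := hexne ⊤ (by
    intro h
    rw [← finrank_top ℝ V, h, finrank_bot] at hd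
    omega)
  obtain ⟨H₂, hH₂, hne⟩ := hexne H₁ (by
    rintro rfl
    have := finrank_add_one_of_isCoatom (hA.hyperplane _ hH₁)
    rw [finrank_bot, hd] at this
    omega)
  obtain ⟨f, hf, hc₀⟩ := c₀.exists_functionals hA
  obtain ⟨x, hx⟩ := c₀.nonempty
  rw [hc₀] at hx ⊢
  have hpos : ∀ K ∈ A, 0 < f K x := fun K hK => (hx K hK).2 (by simp)
  -- The direction runs along `H₁` and towards `H₂`, so the ray from `x` leaves the chamber but
  -- never reaches the origin.
  obtain ⟨p, hp₁, hp₂⟩ : ∃ p, f H₁ p = 0 ∧ f H₂ p < 0 := by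
    obtain ⟨q, hq₁, hq₂⟩ := SetLike.not_le_iff_exists.1 (not_le_of_ne hA hH₁ hH₂ hne.symm)
    rw [← hf H₁ hH₁, LinearMap.mem_ker] at hq₁
    rw [← hf H₂ hH₂, LinearMap.mem_ker] at hq₂
    rcases lt_or_gt_of_ne hq₂ with h | h
    · exact ⟨q, hq₁, h⟩
    · exact ⟨-q, by simp [hq₁], by simpa using h⟩
  -- This is the first hyperplane met by the ray, so the meeting point is still in the closed
  -- chamber.
  obtain ⟨H, ⟨hH, hHp⟩, hmin⟩ := Set.exists_min_image {K ∈ A | f K p < 0}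
    (fun K => f K x / -f K p) (hA.finite.subset fun K hK => hK.1) ⟨H₂, hH₂, hp₂⟩
  set t := f H x / -f H p with ht
  have htpos : 0 < t := div_pos (hpos H hH) (neg_pos.2 hHp)
  refine ⟨H, hH, x + t • p, mem_closure_of_nonneg hx fun K hK => ?_, ?_, ?_⟩
  · rw [map_add, map_smul, smul_eq_mul]
    rcases le_or_gt 0 (f K p) with h | h
    · have := hpos K hK
      positivity
    · have h1 := hmin K ⟨hK, h⟩
      rw [le_div_iff₀ (neg_pos.2 h)] at h1
      linarith
  · rw [← hf H hH, LinearMap.mem_ker, map_add, map_smul, smul_eq_mul, ht]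
    have := hHp.ne
    field_simp
    ring
  · intro h
    have h1 := congrArg (f H₁) h
    rw [map_add, map_smul, hp₁, smul_zero, add_zero, map_zero] at h1
    exact (hpos H₁ hH₁).ne' h1

/-- In the plane modularity costs nothing: distinct lines meet in zero, and only `H` itself contains
`H`. Incidence alone restricts the choice of `H`. -/
theorem exists_flag_of_finrank_eq_two (hA : IsArrangement A) (hd : Module.finrank ℝ V = 2)
    (c₀ : Chamber A) : ∃ F : Fin (Module.finrank ℝ V + 1) → Submodule ℝ V,
      IsModularFlag A F ∧ ∀ i, Incident c₀.1 (F i) := by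
  obtain ⟨H, hH, v, hvc, hvH, hv0⟩ := exists_ne_mem_closure hA hd c₀
  obtain ⟨x, hx⟩ := c₀.nonempty
  have hxH : x ∉ H := by
    obtain ⟨y, hy, h⟩ := c₀.2
    exact (connectedComponentIn_subset _ _ (h ▸ hx) : x ∈ complement A) H hH
  let E : ℕ → Submodule ℝ V := fun i => if i = 0 then ⊥ else if i = 1 then H else ⊤
  refine ⟨fun i => E i, isModularFlag_of (fun i => ?_) (fun i j hij => ?_) (fun i => ?_)
    fun i K hK K' hK' hne h1 h1' h2 h2' => ?_⟩
  · simp only [E]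
    split_ifs
    · exact ⟨A, subset_rfl, hA.essential.symm⟩
    · exact ⟨{H}, by simpa using hH, by simp⟩
    · exact ⟨∅, Set.empty_subset _, by simp⟩
  · have := Fin.le_def.1 hij
    simp only [E]
    split_ifs <;> first | omega | simp
  · have hi : i.1 = 0 ∨ i.1 = 1 := by omega
    rcases hi with hi | hi
    · exact ⟨v, hvc, by simpa [E, hi] using hvH, by simpa [E, hi] using hv0⟩
    · exact ⟨x, subset_closure hx, by simp [E, hi], by simpa [E, hi] using hxH⟩
  · have hi : i.1 = 0 ∨ i.1 = 1 := by omega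
    rcases hi with hi | hi
    · refine ⟨H, hH, by simp [E, hi], ?_⟩
      have h3 := finrank_inf_add_two (hA.hyperplane K hK) (hA.hyperplane K' hK') hne
      have h4 : K ⊓ K' = ⊥ := Submodule.finrank_eq_zero.1 (by omega)
      rw [h4]
      exact bot_le
    · simp only [E, Fin.val_castSucc, hi, one_ne_zero, if_false, if_true] at h1 h1'
      have h3 : ∀ L ∈ A, H ≤ L → H = L := fun L hL hle => by
        by_contra h
        exact not_le_of_ne hA hH hL h hle
      exact absurd ((h3 K hK h1).symm.trans (h3 K' hK' h1')) hne

theorem reflected_angle (α β a b : ℝ) :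
    Real.cos β * (a - 2 * (Real.cos α * a + Real.sin α * b) * Real.cos α) +
      Real.sin β * (b - 2 * (Real.cos α * a + Real.sin α * b) * Real.sin α) =
    -(Real.cos (2 * α - β) * a + Real.sin (2 * α - β) * b) := by
  rw [Real.cos_sub, Real.sin_sub, Real.cos_two_mul, Real.sin_two_mul]
  linear_combination (-2 * b * Real.sin β) * Real.sin_sq_add_cos_sq α

theorem IsTypeI₂.preserves {m : ℕ} (h : IsTypeI₂ m A) : ∀ H ∈ A, Preserves A H.reflection := by
  obtain ⟨φ, rfl⟩ := h
  rintro H ⟨k, hk, hH⟩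
  refine preserves_reflection ?_
  rintro K ⟨j, hj, hK⟩
  have hm : (m : ℝ) ≠ 0 := by
    rw [Nat.cast_ne_zero]
    omega
  set α := k * Real.pi / m with hα
  set β := j * Real.pi / m with hβ
  obtain ⟨a, ha⟩ : ∃ a, φ a = !₂[Real.cos α, Real.sin α] := φ.surjective _
  have hin : ∀ v, inner ℝ (φ a) (φ v) = Real.cos α * φ v 0 + Real.sin α * φ v 1 := fun v => by
    rw [ha, PiLp.inner_apply, Fin.sum_univ_two]
    simp [mul_comm]
  have hnorm : ‖φ a‖ ^ 2 = 1 := by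
    rw [← real_inner_self_eq_norm_sq, hin, ha]
    simp [← sq]
  have hs : ∀ v i, φ (H.reflection v) i =
      φ v i - 2 * (Real.cos α * φ v 0 + Real.sin α * φ v 1) * φ a i := fun v i => by
    have := map_reflection φ.toLinearIsometry (a := a) (H := H)
      (fun v => (hH v).trans (by rw [← hin]; rfl)) v i
    simp only [LinearIsometryEquiv.coe_toLinearIsometry] at this
    rw [this, hin, hnorm, div_one]
  have hmem : ∀ v, v ∈ act H.reflection K ↔
      Real.cos (2 * α - β) * φ v 0 + Real.sin (2 * α - β) * φ v 1 = 0 := fun v => by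
    rw [mem_act_reflection, hK, hs, hs, ha, ← neg_eq_zero (a := _ + _),
      ← neg_eq_zero (a := Real.cos (2 * α - β) * _ + _), ← reflected_angle, neg_eq_zero]
    simp
  -- The reflected line has index `2 * k - j` modulo `m`; changing the angle by `π` only negates the
  -- equation.
  rcases Nat.lt_or_ge (2 * k) j with h1 | h1
  · refine ⟨2 * k + m - j, by omega, fun v => ?_⟩
    have h2 : ((2 * k + m - j : ℕ) : ℝ) * Real.pi / m = 2 * α - β + Real.pi := by
      rw [Nat.cast_sub (by omega), hα, hβ]
      push_cast
      field_simp
      ring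
    rw [hmem, h2, Real.cos_add_pi, Real.sin_add_pi, ← neg_eq_zero]
    ring_nf
  rcases Nat.lt_or_ge (2 * k - j) m with h2 | h2
  · refine ⟨2 * k - j, h2, fun v => ?_⟩
    have h3 : ((2 * k - j : ℕ) : ℝ) * Real.pi / m = 2 * α - β := by
      rw [Nat.cast_sub (by omega), hα, hβ]
      push_cast
      field_simp
    rw [hmem, h3]
  · refine ⟨2 * k - j - m, by omega, fun v => ?_⟩
    have h3 : ((2 * k - j - m : ℕ) : ℝ) * Real.pi / m = 2 * α - β - Real.pi := by
      rw [Nat.cast_sub (by omega), Nat.cast_sub (by omega), hα, hβ]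
      push_cast
      field_simp
    rw [hmem, h3, Real.cos_sub_pi, Real.sin_sub_pi, ← neg_eq_zero]
    ring_nf

theorem IsTypeI₂.exists_flag {m : ℕ} (h : IsTypeI₂ m A) (hA : IsArrangement A) (c₀ : Chamber A) :
    ∃ F : Fin (Module.finrank ℝ V + 1) → Submodule ℝ V,
      IsModularFlag A F ∧ ∀ i, Incident c₀.1 (F i) := by
  obtain ⟨φ, -⟩ := h
  exact exists_flag_of_finrank_eq_two hA
    (by rw [φ.toLinearEquiv.finrank_eq, finrank_euclideanSpace_fin]) c₀

end Dihedral

end GalleryGraph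

/-! ### The main theorem. -/

open GalleryGraph in
theorem mainTheorem4 {V : Type*} [NormedAddCommGroup V] [InnerProductSpace ℝ V]
    [FiniteDimensional ℝ V] (A : Set (Submodule ℝ V)) (hA : IsArrangement A) (c₀ : Chamber A) :
    -- supersolvable arrangements
    (∀ F : Fin (Module.finrank ℝ V + 1) → Submodule ℝ V,
      IsModularFlag A F → (∀ i, Incident c₀.1 (F i)) → ∀ c : Chamber A,
        (∃ r₀ : MinGallery A c₀ c, r₀.IncidentTo F ∧
          (∀ r : MinGallery A c₀ c, r.IncidentTo F → r = r₀) ∧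
          ∀ r r' : MinGallery A c₀ c,
            (r.sep r').encard ≤ (G₂ A c₀ c).edist r r' ∧
            (G₂ A c₀ c).edist r r' ≤ (r₀.sep r).encard + (r₀.sep r').encard ∧
            (r₀.sep r).encard + (r₀.sep r').encard ≤ 2 * (sep₂ A c₀.1 c.1).encard) ∧
        (G₂ A c₀ c).ediam ≤ 2 * (sep₂ A c₀.1 c.1).encard) ∧
    -- reflection arrangements of types A, B and I₂(m)
    ((∃ n, IsTypeA n A) ∨ (∃ n, IsTypeB n A) ∨ (∃ m, 2 ≤ m ∧ IsTypeI₂ m A) →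
      (∃ F : Fin (Module.finrank ℝ V + 1) → Submodule ℝ V,
        IsModularFlag A F ∧ ∀ i, Incident c₀.1 (F i)) ∧
      ∀ w ∈ reflGroup A,
        (∀ F : Fin (Module.finrank ℝ V + 1) → Submodule ℝ V,
          IsModularFlag A F → (∀ i, Incident c₀.1 (F i)) →
            ∃ r₀ : ReducedWord A c₀ w, r₀.IncidentTo F ∧
              (∀ r : ReducedWord A c₀ w, r.IncidentTo F → r = r₀) ∧
              ∀ r r' : ReducedWord A c₀ w,
                (r.sep r').encard ≤ (wordGraph A c₀ w).edist r r' ∧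
                (wordGraph A c₀ w).edist r r' ≤ (r₀.sep r).encard + (r₀.sep r').encard ∧
                (r₀.sep r).encard + (r₀.sep r').encard ≤ 2 * (elemSep₂ A c₀ w).encard) ∧
        (wordGraph A c₀ w).ediam ≤ 2 * (elemSep₂ A c₀ w).encard) := by
  refine ⟨fun F hF hinc c => supersolvable_bounds hA c₀ F hF hinc c, fun h => ?_⟩
  obtain ⟨hinv, F₀, hF₀, hinc₀⟩ : (∀ H ∈ A, Preserves A H.reflection) ∧
      ∃ F : Fin (Module.finrank ℝ V + 1) → Submodule ℝ V,
        IsModularFlag A F ∧ ∀ i, Incident c₀.1 (F i) := by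
    rcases h with ⟨n, h⟩ | ⟨n, h⟩ | ⟨m, -, h⟩
    · exact ⟨h.preserves, h.exists_flag hA c₀⟩
    · exact ⟨h.preserves, h.exists_flag hA c₀⟩
    · exact ⟨h.preserves, h.exists_flag hA c₀⟩
  -- The diameter bound mentions no flag, so the one constructed for `c₀` supplies it.
  exact ⟨⟨F₀, hF₀, hinc₀⟩, fun w hw =>
    ⟨fun F hF hinc => (reflection_bounds hA c₀ hinv hw F hF hinc).1,
      (reflection_bounds hA c₀ hinv hw F₀ hF₀ hinc₀).2⟩⟩
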